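/- **Conventions.** A lattice $N$ is a free abelian group of finite rank, and $N_{\mathbb R}=N\otimes\mathbb R$. A fan in $N_{\mathbb R}$ is a finite nonempty collection of strongly convex rational polyhedral cones, closed under taking faces, any two of which meet in a common face. For a cone $\sigma$, $N_\sigma\subset N$ is the sublattice generated by $\sigma\cap N$. If $\tau$ is a facet of $\sigma$, then $n_{\sigma,\tau}$ is any lattice point in the relative interior of $\sigma$ whose image generates $N_\sigma/N_\tau\cong\mathbb Z$. A *tropical fan* $(\Sigma,\omega)$ of dimension $d$ is a fan $\Sigma$, pure of dimension $d$, with a weight function $\omega:\Sigma_d\to\mathbb Z_{>0}$ on its $d$-dimensional cones such that $\sum_{\sigma\succ\tau}\omega(\sigma)n_{\sigma,\tau}\in N_\tau$ for every $\tau\in\Sigma_{d-1}$ (sum over $\sigma\in\Sigma_d$ having $\tau$ as a face). A *tropical refinement* of $(\Sigma,\omega)$ is a tropical fan with the same support, each of whose cones lies in a cone of $\Sigma$, with weights inherited from $\omega$. A *tropical fan cycle* in $N_{\mathbb R}$ is a class of tropical fans for the equivalence relation of having a common tropical refinement; its representatives are its *fan structures*. It is *reduced* if all weights are $1$, and *complete*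 if its support is $N_{\mathbb R}$. The product $\mathcal F\times\mathcal G$ of tropical fan cycles in $N_{\mathbb R}$ and $N'_{\mathbb R}$ is the cycle in $(N\times N')_{\mathbb R}$ given by the cones $\sigma\times\sigma'$ with weights $\omega(\sigma)\omega'(\sigma')$. Tropical fan cycles $\mathcal F$ and $\mathcal F'$ in $N_{\mathbb R}$ and $N'_{\mathbb R}$ are *isomorphic* if there are fan structures $\Sigma$, $\Sigma'$ on them and a lattice isomorphism $N\cap\operatorname{span}|\Sigma|\cong N'\cap\operatorname{span}|\Sigma'|$ whose real extension induces a bijection between the cones of $\Sigma$ and those of $\Sigma'$ and preserves the weights. A *piecewise integral linear function* $\varphi$ on a $d$-dimensional tropical fan $(\Sigma,\omega)$ is a continuous function $|\Sigma|\to\mathbb R$ that agrees on each cone $\sigma$ with an integral linear function $\varphi_\sigma\in\operatorname{Hom}(N_\sigma,\mathbb Z)$. For $\tau\in\Sigma_{d-1}$ put $$\operatorname{ord}_\tau(\varphi)=\varphi_\tau\Big(\sum_{\sigma\succ\tau}\omega(\sigma)n_{\sigma,\tau}\Big)-\sum_{\sigma\succ\tau}\varphi_\sigma\big(\omega(\sigma)n_{\sigma,\tau}\big).$$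 The divisor $\operatorname{div}(\varphi)$ consists of the cones $\tau\in\Sigma_{d-1}$ with $\operatorname{ord}_\tau(\varphi)\ne0$ and their faces, with weights $\operatorname{ord}_\tau(\varphi)$. The *tropical modification* of $\Sigma$ with respect to $\varphi$ is the tropical fan in $N_{\mathbb R}\times\mathbb R$ with cones $\widetilde\sigma=\{(x,\varphi(x)):x\in\sigma\}$ for $\sigma\in\Sigma$ and $\tau_{\ge}=\widetilde\tau+\mathbb R_{\ge0}(0,1)$ for $\tau\in\operatorname{div}(\varphi)$, and weights $\omega(\sigma)$ on $\widetilde\sigma$ ($\sigma\in\Sigma_d$) and $\operatorname{ord}_\tau(\varphi)$ on $\tau_\ge$ ($\tau\in\Sigma_{d-1}$, $\operatorname{ord}_\tau(\varphi)\neq 0$). A tropical fan cycle $\mathcal M$ is a *tropical modification of the cycle $\mathcal F$ along the tropical divisor $\mathcal D$* if, for some piecewise integral linear function $\varphi$ on some fan structure $\Sigma$ on $\mathcal F$, $\operatorname{div}(\varphi)$ is a tropical fan (nonzero, with positive weights) representing $\mathcal D$ and the tropical modification of $\Sigma$ with respect to $\varphi$ represents $\mathcal M$. *Quasilinear* tropical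 fan cycles form the smallest class such that a reduced tropical fan cycle is quasilinear whenever it is isomorphic to a complete tropical fan cycle, or to a tropical modification of a quasilinear tropical fan cycle along a quasilinear tropical divisor. **Theorem.** Let $N$, $N'$ be lattices of finite rank and let $\mathcal F$ in $N_{\mathbb R}$ and $\mathcal G$ in $N'_{\mathbb R}$ be reduced tropical fan cycles. Then $\mathcal F\times\mathcal G$ is quasilinear if and only if both $\mathcal F$ and $\mathcal G$ are quasilinear. -/

import Mathlib

universe u v

open Module

/-! ### Lattices and cones -/

/-- A lattice `N` of finite rank, given together with its realification `V = N_ℝ = N ⊗ ℝ`: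
`V` is a finite-dimensional real vector space and `N` is the `ℤ`-span of a basis of `V`. -/
structure RealLattice (V : Type u) [AddCommGroup V] [Module ℝ V] where
  carrier : Submodule ℤ V
  exists_basis : ∃ (n : ℕ) (b : Basis (Fin n) ℝ V), carrier = Submodule.span ℤ (Set.range b)

namespace RealLattice

theorem finite {V : Type u} [AddCommGroup V] [Module ℝ V] (N : RealLattice V) :
    Module.Finite ℝ V := by
  obtain ⟨n, b, -⟩ := N.exists_basis
  exact Module.Finite.of_basis b

/-- The standard lattice `ℤ ⊆ ℝ`. -/
def int : RealLattice.{0} ℝ where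
  carrier := Submodule.span ℤ {1}
  exists_basis := ⟨1, Basis.singleton (Fin 1) ℝ, by simp⟩

/-- The product lattice `N × N'` in `V × W`. -/
def prod {V : Type u} {W : Type v} [AddCommGroup V] [Module ℝ V] [AddCommGroup W] [Module ℝ W]
    (N : RealLattice V) (N' : RealLattice W) : RealLattice (V × W) where
  carrier := N.carrier.prod N'.carrier
  exists_basis := by
    obtain ⟨n, b, hb⟩ := N.exists_basis
    obtain ⟨m, c, hc⟩ := N'.exists_basis
    refine ⟨n + m, (b.prod c).reindex finSumFinEquiv, ?_⟩
    rw [Basis.range_reindex, hb, hc]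
    apply le_antisymm
    · rw [Submodule.prod_le_iff, Submodule.map_span, Submodule.map_span, Submodule.span_le,
        Submodule.span_le]
      constructor
      · rintro _ ⟨_, ⟨i, rfl⟩, rfl⟩
        exact Submodule.subset_span ⟨Sum.inl i, by ext <;> simp⟩
      · rintro _ ⟨_, ⟨i, rfl⟩, rfl⟩
        exact Submodule.subset_span ⟨Sum.inr i, by ext <;> simp⟩
    · rw [Submodule.span_le]
      rintro _ ⟨i | i, rfl⟩
      · exact ⟨by simpa using Submodule.subset_span (Set.mem_range_self i), by simp⟩
      · exact ⟨by simp, by simpa using Submodule.subset_span (Set.mem_range_self i)⟩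

end RealLattice

/-- The dimension of a cone: the dimension of its linear span. -/
noncomputable def coneDim {V : Type u} [AddCommGroup V] [Module ℝ V] (σ : PointedCone ℝ V) : ℕ :=
  finrank ℝ (Submodule.span ℝ (σ : Set V))

/-- The relative interior of a convex cone, in its algebraic description: `x ∈ σ` is a relative
interior point if from `x` one can go a little beyond, away from every other point of `σ`. -/
def coneRelInt {V : Type u} [AddCommGroup V] [Module ℝ V] (σ : PointedCone ℝ V) : Set V :=
  {x | x ∈ σ ∧ ∀ y ∈ σ, ∃ ε : ℝ, 0 < ε ∧ x - ε • y ∈ σ}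

/-- The sublattice `N_σ` of `N` generated by the lattice points of the cone `σ`. -/
def coneLattice {V : Type u} [AddCommGroup V] [Module ℝ V] (N : RealLattice V)
    (σ : PointedCone ℝ V) : Submodule ℤ V :=
  Submodule.span ℤ {x | x ∈ σ ∧ x ∈ N.carrier}

/-- `n` is an admissible choice of `n_{σ,τ}`: a lattice point in the relative interior of `σ` whose
image generates `N_σ / N_τ`. -/
def IsLatticeNormal {V : Type u} [AddCommGroup V] [Module ℝ V] (N : RealLattice V)
    (σ τ : PointedCone ℝ V) (n : V) : Prop :=
  n ∈ N.carrier ∧ n ∈ coneRelInt σ ∧ coneLattice N σ = coneLattice N τ ⊔ Submodule.span ℤ {n}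

/-- A choice of the lattice point `n_{σ,τ}`. -/
noncomputable def latticeNormal {V : Type u} [AddCommGroup V] [Module ℝ V] (N : RealLattice V)
    (σ τ : PointedCone ℝ V) : V :=
  Classical.epsilon (IsLatticeNormal N σ τ)

/-! ### Fans and tropical fans -/

/-- A fan in `N_ℝ`: a finite nonempty collection of strongly convex rational polyhedral cones,
closed under passing to faces, in which any two cones meet in a common face. -/
structure RatFan {V : Type u} [AddCommGroup V] [Module ℝ V] (N : RealLattice V) where
  cones : Finset (PointedCone ℝ V)
  nonempty : cones.Nonempty
  rational : ∀ σ ∈ cones, ∃ S : Finset V, (∀ x ∈ S, x ∈ N.carrier) ∧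
    σ = PointedCone.hull ℝ (S : Set V)
  stronglyConvex : ∀ σ ∈ cones, ∀ x ∈ σ, -x ∈ σ → x = 0
  face_mem : ∀ σ ∈ cones, ∀ τ : PointedCone ℝ V, τ.IsFaceOf σ → τ ∈ cones
  inter_face : ∀ σ ∈ cones, ∀ σ' ∈ cones, (σ ⊓ σ').IsFaceOf σ

/-- The support of a fan: the union of its cones. -/
def RatFan.support {V : Type u} [AddCommGroup V] [Module ℝ V] {N : RealLattice V}
    (S : RatFan N) : Set V :=
  {x | ∃ σ ∈ S.cones, x ∈ σ}

open Classical in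
/-- The cones of dimension `d` having `τ` as a face. -/
noncomputable def RatFan.conesAbove {V : Type u} [AddCommGroup V] [Module ℝ V] {N : RealLattice V}
    (S : RatFan N) (d : ℕ) (τ : PointedCone ℝ V) : Finset (PointedCone ℝ V) :=
  S.cones.filter fun σ => coneDim σ = d ∧ τ.IsFaceOf σ

/-- A tropical fan: a fan, pure of dimension `dim`, with positive integer weights on its
top-dimensional cones satisfying the balancing condition at every cone of codimension one.
Only the values of `weight` on top-dimensional cones are used. -/
structure TropicalFan {V : Type u} [AddCommGroup V] [Module ℝ V] (N : RealLattice V)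
    extends RatFan N where
  dim : ℕ
  pure : ∀ σ ∈ cones, ∃ σ' ∈ cones, coneDim σ' = dim ∧ σ ≤ σ'
  weight : PointedCone ℝ V → ℕ+
  balanced : ∀ τ ∈ cones, coneDim τ + 1 = dim → ∀ n : PointedCone ℝ V → V,
    (∀ σ ∈ toRatFan.conesAbove dim τ, IsLatticeNormal N σ τ (n σ)) →
      ∑ σ ∈ toRatFan.conesAbove dim τ, (weight σ : ℕ) • n σ ∈ coneLattice N τ

namespace TropicalFan

variable {V : Type u} {W : Type v} [AddCommGroup V] [Module ℝ V] [AddCommGroup W] [Module ℝ W]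
  {N : RealLattice V} {N' : RealLattice W}

/-- All weights of top-dimensional cones are equal to one. -/
def IsReduced (S : TropicalFan N) : Prop :=
  ∀ σ ∈ S.cones, coneDim σ = S.dim → S.weight σ = 1

/-- The support is the whole ambient space. -/
def IsComplete (S : TropicalFan N) : Prop :=
  S.support = Set.univ

/-- `T` is a tropical refinement of `S`: same support, every cone of `T` lies in a cone of `S`, and
each top-dimensional cone of `T` has the weight of the top-dimensional cone of `S` it lies in. -/
structure Refines (T S : TropicalFan N) : Prop where
  dim_eq : T.dim = S.dim
  support_eq : T.support = S.support
  exists_le : ∀ κ ∈ T.cones, ∃ σ ∈ S.cones, κ ≤ σ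
  weight_eq : ∀ κ ∈ T.cones, coneDim κ = T.dim →
    ∃ σ ∈ S.cones, coneDim σ = S.dim ∧ κ ≤ σ ∧ T.weight κ = S.weight σ

/-- Tropical equivalence: existence of a common tropical refinement. -/
def TropEquiv (S S' : TropicalFan N) : Prop :=
  ∃ T : TropicalFan N, T.Refines S ∧ T.Refines S'

theorem Refines.refl (S : TropicalFan N) : S.Refines S :=
  ⟨rfl, rfl, fun κ h => ⟨κ, h, le_rfl⟩, fun κ h hd => ⟨κ, h, hd, le_rfl, rfl⟩⟩

theorem coneDim_mono (N : RealLattice V) {σ σ' : PointedCone ℝ V} (h : σ ≤ σ') :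
    coneDim σ ≤ coneDim σ' := by
  have := N.finite
  exact Submodule.finrank_mono (Submodule.span_mono h)

theorem coneDim_le (S : TropicalFan N) {σ : PointedCone ℝ V} (h : σ ∈ S.cones) :
    coneDim σ ≤ S.dim := by
  obtain ⟨σ', -, hd, hle⟩ := S.pure σ h
  exact hd ▸ coneDim_mono N hle

theorem coneDim_prod (N : RealLattice V) (N' : RealLattice W) (σ : PointedCone ℝ V)
    (σ' : PointedCone ℝ W) : coneDim (σ.prod σ') = coneDim σ + coneDim σ' := by
  have := N.finite
  have := N'.finite
  unfold coneDim
  have h : Submodule.span ℝ ((σ.prod σ' : PointedCone ℝ (V × W)) : Set (V × W)) =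
      (Submodule.span ℝ (σ : Set V)).prod (Submodule.span ℝ (σ' : Set W)) := by
    rw [Submodule.prod_coe]
    exact Submodule.span_prod_eq (R := ℝ) (zero_mem σ) (zero_mem σ')
  have h' : (Submodule.span ℝ (σ : Set V)).prod (Submodule.span ℝ (σ' : Set W)) =
      LinearMap.range ((Submodule.span ℝ (σ : Set V)).subtype.prodMap
        (Submodule.span ℝ (σ' : Set W)).subtype) := by
    rw [LinearMap.range_prodMap, Submodule.range_subtype, Submodule.range_subtype]
  rw [h, h', LinearMap.finrank_range_of_inj, Module.finrank_prod]
  rw [LinearMap.coe_prodMap]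
  exact Function.Injective.prodMap Subtype.val_injective Subtype.val_injective

theorem coneLattice_prod (N : RealLattice V) (N' : RealLattice W) (σ : PointedCone ℝ V)
    (σ' : PointedCone ℝ W) :
    coneLattice (N.prod N') (σ.prod σ') = (coneLattice N σ).prod (coneLattice N' σ') := by
  unfold coneLattice
  rw [← Submodule.span_prod_eq (R := ℤ) (s := {x | x ∈ σ ∧ x ∈ N.carrier})
    (t := {x | x ∈ σ' ∧ x ∈ N'.carrier}) ⟨zero_mem σ, zero_mem _⟩ ⟨zero_mem σ', zero_mem _⟩]
  congr 1
  ext ⟨x, y⟩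
  constructor
  · rintro ⟨⟨h1, h2⟩, h3, h4⟩
    exact ⟨⟨h1, h3⟩, h2, h4⟩
  · rintro ⟨⟨h1, h3⟩, h2, h4⟩
    exact ⟨⟨h1, h2⟩, h3, h4⟩

theorem eq_prod_of_isFaceOf {σ : PointedCone ℝ V} {σ' : PointedCone ℝ W}
    {τ : PointedCone ℝ (V × W)} (h : τ.IsFaceOf (σ.prod σ')) :
    τ = (τ.map (LinearMap.fst ℝ V W)).prod (τ.map (LinearMap.snd ℝ V W)) := by
  apply le_antisymm
  · rintro ⟨x, y⟩ hx
    exact ⟨PointedCone.mem_map.2 ⟨(x, y), hx, rfl⟩, PointedCone.mem_map.2 ⟨(x, y), hx, rfl⟩⟩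
  · rintro ⟨x, y⟩ ⟨hx, hy⟩
    obtain ⟨⟨x', b⟩, h1, h1'⟩ := PointedCone.mem_map.1 hx
    obtain ⟨⟨a, y'⟩, h2, h2'⟩ := PointedCone.mem_map.1 hy
    simp only [LinearMap.fst_apply, LinearMap.snd_apply] at h1' h2'
    subst h1' h2'
    have e : (x', y') + (a, b) = (x', b) + (a, y') := by simp [add_comm]
    refine h.mem_of_add_mem_left (y := (a, b)) ⟨(h.le h1).1, (h.le h2).2⟩
      ⟨(h.le h2).1, (h.le h1).2⟩ ?_
    rw [e]
    exact add_mem h1 h2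

theorem map_fst_prod (σ : PointedCone ℝ V) (σ' : PointedCone ℝ W) :
    (PointedCone.map (LinearMap.fst ℝ V W) (σ.prod σ')) = σ := by
  ext x
  rw [PointedCone.mem_map]
  constructor
  · rintro ⟨⟨a, b⟩, h, rfl⟩
    exact h.1
  · intro h
    exact ⟨(x, 0), ⟨h, zero_mem σ'⟩, rfl⟩

theorem map_snd_prod (σ : PointedCone ℝ V) (σ' : PointedCone ℝ W) :
    (PointedCone.map (LinearMap.snd ℝ V W) (σ.prod σ')) = σ' := by
  ext x
  rw [PointedCone.mem_map]
  constructor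
  · rintro ⟨⟨a, b⟩, h, rfl⟩
    exact h.2
  · intro h
    exact ⟨(0, x), ⟨zero_mem σ, h⟩, rfl⟩

theorem prod_isFaceOf_iff {τ σ : PointedCone ℝ V} {τ' σ' : PointedCone ℝ W} :
    PointedCone.IsFaceOf (τ.prod τ' : PointedCone ℝ (V × W)) (σ.prod σ') ↔
      τ.IsFaceOf σ ∧ τ'.IsFaceOf σ' := by
  constructor
  · intro h
    have h1 := h.fst
    have h2 := h.snd
    rw [map_fst_prod] at h1
    rw [map_snd_prod] at h2
    exact ⟨h1, h2⟩
  · rintro ⟨h1, h2⟩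
    exact h1.prod h2

theorem coneRelInt_prod {σ : PointedCone ℝ V} {σ' : PointedCone ℝ W} {x : V × W}
    (h : x ∈ coneRelInt (σ.prod σ' : PointedCone ℝ (V × W))) :
    x.1 ∈ coneRelInt σ ∧ x.2 ∈ coneRelInt σ' := by
  refine ⟨⟨h.1.1, fun y hy => ?_⟩, ⟨h.1.2, fun y hy => ?_⟩⟩
  · obtain ⟨ε, hε, h'⟩ := h.2 (y, 0) ⟨hy, zero_mem σ'⟩
    exact ⟨ε, hε, h'.1⟩
  · obtain ⟨ε, hε, h'⟩ := h.2 (0, y) ⟨zero_mem σ, hy⟩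
    exact ⟨ε, hε, h'.2⟩

theorem isLatticeNormal_fst {σ τ : PointedCone ℝ V} {σ' τ' : PointedCone ℝ W} {n : V × W}
    (h : IsLatticeNormal (N.prod N') (σ.prod σ') (τ.prod τ') n) : IsLatticeNormal N σ τ n.1 := by
  obtain ⟨h1, h2, h3⟩ := h
  refine ⟨h1.1, (coneRelInt_prod h2).1, ?_⟩
  rw [coneLattice_prod, coneLattice_prod] at h3
  have := congrArg (Submodule.map (LinearMap.fst ℤ V W)) h3
  rwa [Submodule.map_sup, Submodule.prod_map_fst, Submodule.prod_map_fst, Submodule.map_span,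
    Set.image_singleton] at this

theorem isLatticeNormal_snd {σ τ : PointedCone ℝ V} {σ' τ' : PointedCone ℝ W} {n : V × W}
    (h : IsLatticeNormal (N.prod N') (σ.prod σ') (τ.prod τ') n) : IsLatticeNormal N' σ' τ' n.2 := by
  obtain ⟨h1, h2, h3⟩ := h
  refine ⟨h1.2, (coneRelInt_prod h2).2, ?_⟩
  rw [coneLattice_prod, coneLattice_prod] at h3
  have := congrArg (Submodule.map (LinearMap.snd ℤ V W)) h3
  rwa [Submodule.map_sup, Submodule.prod_map_snd, Submodule.prod_map_snd, Submodule.map_span,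
    Set.image_singleton] at this

theorem IsLatticeNormal.mem_coneLattice {σ τ : PointedCone ℝ V} {n : V}
    (h : IsLatticeNormal N σ τ n) : n ∈ coneLattice N σ :=
  Submodule.subset_span ⟨h.2.1.1, h.1⟩

end TropicalFan

open Classical in
/-- The product fan: its cones are the products `σ × σ'`. -/
noncomputable def RatFan.prod {V : Type u} {W : Type v} [AddCommGroup V] [Module ℝ V]
    [AddCommGroup W] [Module ℝ W] {N : RealLattice V} {N' : RealLattice W}
    (S : RatFan N) (S' : RatFan N') : RatFan (N.prod N') where
  cones := (S.cones ×ˢ S'.cones).image fun p => p.1.prod p.2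
  nonempty := (S.nonempty.product S'.nonempty).image _
  rational := by
    intro κ hκ
    simp only [Finset.mem_image, Finset.mem_product, Prod.exists] at hκ
    obtain ⟨σ, σ', ⟨h, h'⟩, rfl⟩ := hκ
    obtain ⟨A, hA, rfl⟩ := S.rational σ h
    obtain ⟨B, hB, rfl⟩ := S'.rational σ' h'
    refine ⟨insert 0 A ×ˢ insert 0 B, ?_, ?_⟩
    · rintro ⟨x, y⟩ hx
      simp only [Finset.mem_product, Finset.mem_insert] at hx
      refine ⟨?_, ?_⟩
      · rcases hx.1 with h0 | h0
        · simp [h0]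
        · exact hA _ h0
      · rcases hx.2 with h0 | h0
        · simp [h0]
        · exact hB _ h0
    · rw [Finset.coe_product, Finset.coe_insert, Finset.coe_insert]
      refine ((Submodule.span_prod_eq (R := {c : ℝ // 0 ≤ c}) (s := insert 0 (A : Set V))
        (t := insert 0 (B : Set W)) (by simp) (by simp)).trans ?_).symm
      rw [Submodule.span_insert_zero, Submodule.span_insert_zero]
  stronglyConvex := by
    intro κ hκ x hx hx'
    simp only [Finset.mem_image, Finset.mem_product, Prod.exists] at hκ
    obtain ⟨σ, σ', ⟨h, h'⟩, rfl⟩ := hκ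
    exact Prod.ext (S.stronglyConvex σ h _ hx.1 hx'.1) (S'.stronglyConvex σ' h' _ hx.2 hx'.2)
  face_mem := by
    intro κ hκ τ hτ
    simp only [Finset.mem_image, Finset.mem_product, Prod.exists] at hκ ⊢
    obtain ⟨σ, σ', ⟨h, h'⟩, rfl⟩ := hκ
    exact ⟨_, _, ⟨S.face_mem σ h _ hτ.fst, S'.face_mem σ' h' _ hτ.snd⟩,
      (TropicalFan.eq_prod_of_isFaceOf hτ).symm⟩
  inter_face := by
    intro κ hκ ρ hρ
    simp only [Finset.mem_image, Finset.mem_product, Prod.exists] at hκ hρ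
    obtain ⟨σ, σ', ⟨h, h'⟩, rfl⟩ := hκ
    obtain ⟨τ, τ', ⟨k, k'⟩, rfl⟩ := hρ
    rw [Submodule.prod_inf_prod]
    exact (S.inter_face σ h τ k).prod (S'.inter_face σ' h' τ' k')

namespace TropicalFan

variable {V : Type u} {W : Type v} [AddCommGroup V] [Module ℝ V] [AddCommGroup W] [Module ℝ W]
  {N : RealLattice V} {N' : RealLattice W}

theorem mem_prod_cones {S : RatFan N} {S' : RatFan N'} {κ : PointedCone ℝ (V × W)} :
    κ ∈ (S.prod S').cones ↔ ∃ σ ∈ S.cones, ∃ σ' ∈ S'.cones, κ = σ.prod σ' := by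
  simp only [RatFan.prod, Finset.mem_image, Finset.mem_product, Prod.exists]
  constructor
  · rintro ⟨σ, σ', ⟨h, h'⟩, rfl⟩
    exact ⟨σ, h, σ', h', rfl⟩
  · rintro ⟨σ, h, σ', h', rfl⟩
    exact ⟨σ, σ', ⟨h, h'⟩, rfl⟩

theorem prod_injective {σ τ : PointedCone ℝ V} {σ' τ' : PointedCone ℝ W}
    (h : (σ.prod σ' : PointedCone ℝ (V × W)) = τ.prod τ') : σ = τ ∧ σ' = τ' := by
  constructor
  · rw [← map_fst_prod σ σ', h, map_fst_prod]
  · rw [← map_snd_prod σ σ', h, map_snd_prod]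

theorem exists_sub_of_mem_span {σ : PointedCone ℝ V} {x : V}
    (hx : x ∈ Submodule.span ℝ (σ : Set V)) : ∃ a ∈ σ, ∃ b ∈ σ, x = a - b := by
  induction hx using Submodule.span_induction with
  | mem x h => exact ⟨x, h, 0, zero_mem σ, by simp⟩
  | zero => exact ⟨0, zero_mem σ, 0, zero_mem σ, by simp⟩
  | add x y _ _ hx hy =>
    obtain ⟨a, ha, b, hb, rfl⟩ := hx
    obtain ⟨c, hc, d, hd, rfl⟩ := hy
    exact ⟨a + c, add_mem ha hc, b + d, add_mem hb hd, by abel⟩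
  | smul r x _ hx =>
    obtain ⟨a, ha, b, hb, rfl⟩ := hx
    rcases le_total 0 r with hr | hr
    · exact ⟨r • a, σ.smul_mem hr ha, r • b,
        σ.smul_mem hr hb, smul_sub _ _ _⟩
    · refine ⟨(-r) • b, σ.smul_mem (neg_nonneg.2 hr) hb, (-r) • a,
        σ.smul_mem (neg_nonneg.2 hr) ha, ?_⟩
      module

theorem eq_of_isFaceOf_of_coneDim_eq (N : RealLattice V) {τ σ : PointedCone ℝ V}
    (h : τ.IsFaceOf σ) (hd : coneDim τ = coneDim σ) : τ = σ := by
  have := N.finite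
  have hs : Submodule.span ℝ (τ : Set V) = Submodule.span ℝ (σ : Set V) :=
    Submodule.eq_of_le_of_finrank_eq (Submodule.span_mono h.le) hd
  refine le_antisymm h.le fun x hx => ?_
  have hx' : x ∈ Submodule.span ℝ (τ : Set V) := hs ▸ Submodule.subset_span hx
  obtain ⟨a, ha, b, hb, rfl⟩ := exists_sub_of_mem_span hx'
  exact h.mem_of_add_mem_left hx (h.le hb) (by simpa using ha)

/-- The map `(σ, σ') ↦ σ × σ'` as an embedding. -/
def coneProdEmb : PointedCone ℝ V × PointedCone ℝ W ↪ PointedCone ℝ (V × W) where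
  toFun p := p.1.prod p.2
  inj' _ _ h := Prod.ext (prod_injective h).1 (prod_injective h).2

theorem coneProdEmb_apply (σ : PointedCone ℝ V) (σ' : PointedCone ℝ W) :
    coneProdEmb (σ, σ') = σ.prod σ' := rfl

theorem prod_conesAbove (S : TropicalFan N) (S' : TropicalFan N') (τ : PointedCone ℝ V)
    (τ' : PointedCone ℝ W) :
    (S.toRatFan.prod S'.toRatFan).conesAbove (S.dim + S'.dim) (τ.prod τ') =
      (S.conesAbove S.dim τ ×ˢ S'.conesAbove S'.dim τ').map
        coneProdEmb := by
  classical
  ext κ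
  simp only [RatFan.conesAbove, Finset.mem_filter, Finset.mem_map, Finset.mem_product,
    coneProdEmb_apply, Prod.exists, mem_prod_cones]
  constructor
  · rintro ⟨⟨σ, h, σ', h', rfl⟩, hd, hf⟩
    rw [coneDim_prod N N'] at hd
    have := S.coneDim_le h
    have := S'.coneDim_le h'
    obtain ⟨hf, hf'⟩ := prod_isFaceOf_iff.1 hf
    exact ⟨σ, σ', ⟨⟨h, by omega, hf⟩, ⟨h', by omega, hf'⟩⟩, rfl⟩
  · rintro ⟨σ, σ', ⟨⟨h, hd, hf⟩, ⟨h', hd', hf'⟩⟩, rfl⟩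
    exact ⟨⟨σ, h, σ', h', rfl⟩, by rw [coneDim_prod N N', hd, hd'], prod_isFaceOf_iff.2 ⟨hf, hf'⟩⟩

theorem mem_conesAbove {S : RatFan N} {d : ℕ} {τ σ : PointedCone ℝ V} :
    σ ∈ S.conesAbove d τ ↔ σ ∈ S.cones ∧ coneDim σ = d ∧ τ.IsFaceOf σ := by
  classical
  simp [RatFan.conesAbove]

/-- The product `(Σ × Σ', ω × ω')`, with `(ω × ω')(σ × σ') = ω(σ) ω'(σ')`. -/
noncomputable def prod (S : TropicalFan N) (S' : TropicalFan N') : TropicalFan (N.prod N') where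
  toRatFan := S.toRatFan.prod S'.toRatFan
  dim := S.dim + S'.dim
  pure := by
    intro κ hκ
    obtain ⟨σ, h, σ', h', rfl⟩ := mem_prod_cones.1 hκ
    obtain ⟨ρ, hρ, hd, hle⟩ := S.pure σ h
    obtain ⟨ρ', hρ', hd', hle'⟩ := S'.pure σ' h'
    exact ⟨ρ.prod ρ', mem_prod_cones.2 ⟨ρ, hρ, ρ', hρ', rfl⟩,
      by rw [coneDim_prod N N', hd, hd'], Submodule.prod_mono hle hle'⟩
  weight κ := S.weight (κ.map (LinearMap.fst ℝ V W)) * S'.weight (κ.map (LinearMap.snd ℝ V W))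
  balanced := by
    intro κ hκ hdim n hn
    obtain ⟨τ, h, τ', h', rfl⟩ := mem_prod_cones.1 hκ
    rw [coneDim_prod N N'] at hdim
    have hle := S.coneDim_le h
    have hle' := S'.coneDim_le h'
    rw [prod_conesAbove] at hn ⊢
    have hn' : ∀ σ ∈ S.conesAbove S.dim τ, ∀ σ' ∈ S'.conesAbove S'.dim τ',
        IsLatticeNormal (N.prod N') (σ.prod σ') (τ.prod τ') (n (σ.prod σ')) :=
      fun σ hσ σ' hσ' => hn _ (Finset.mem_map.2 ⟨(σ, σ'), Finset.mem_product.2 ⟨hσ, hσ'⟩, rfl⟩)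
    rw [Finset.sum_map, coneLattice_prod]
    rcases Nat.lt_or_ge (coneDim τ) S.dim with hlt | hge
    · have e : coneDim τ + 1 = S.dim := by omega
      have e' : coneDim τ' = S'.dim := by omega
      rw [Finset.sum_product_right]
      simp only [coneProdEmb_apply, map_fst_prod, map_snd_prod]
      refine sum_mem fun σ' hσ' => ?_
      have hτ : τ' = σ' := eq_of_isFaceOf_of_coneDim_eq N' (mem_conesAbove.1 hσ').2.2
        (e'.trans (mem_conesAbove.1 hσ').2.1.symm)
      refine ⟨?_, ?_⟩
      · have := S.balanced τ h e (fun σ => (n (σ.prod σ')).1)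
          fun σ hσ => isLatticeNormal_fst (hn' σ hσ σ' hσ')
        have := (coneLattice N τ).smul_mem ((S'.weight σ' : ℕ) : ℤ) this
        rw [Finset.smul_sum] at this
        rw [Prod.fst_sum]
        refine Eq.subst (motive := fun z => z ∈ coneLattice N τ)
          (Finset.sum_congr rfl fun σ hσ => ?_) this
        rw [Prod.smul_fst, PNat.mul_coe, mul_comm, mul_smul, Nat.cast_smul_eq_nsmul]
      · rw [Prod.snd_sum]
        refine sum_mem fun σ hσ => ?_
        have := IsLatticeNormal.mem_coneLattice (isLatticeNormal_snd (hn' σ hσ σ' hσ'))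
        rw [hτ]
        rw [Prod.smul_snd]
        exact (coneLattice N' σ').smul_of_tower_mem _ this
    · have e : coneDim τ = S.dim := by omega
      have e' : coneDim τ' + 1 = S'.dim := by omega
      rw [Finset.sum_product]
      simp only [coneProdEmb_apply, map_fst_prod, map_snd_prod]
      refine sum_mem fun σ hσ => ?_
      have hτ : τ = σ := eq_of_isFaceOf_of_coneDim_eq N (mem_conesAbove.1 hσ).2.2
        (e.trans (mem_conesAbove.1 hσ).2.1.symm)
      refine ⟨?_, ?_⟩
      · rw [Prod.fst_sum]
        refine sum_mem fun σ' hσ' => ?_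
        have := IsLatticeNormal.mem_coneLattice (isLatticeNormal_fst (hn' σ hσ σ' hσ'))
        rw [hτ]
        rw [Prod.smul_fst]
        exact (coneLattice N σ).smul_of_tower_mem _ this
      · have := S'.balanced τ' h' e' (fun σ' => (n (σ.prod σ')).2)
          fun σ' hσ' => isLatticeNormal_snd (hn' σ hσ σ' hσ')
        have := (coneLattice N' τ').smul_mem ((S.weight σ : ℕ) : ℤ) this
        rw [Finset.smul_sum] at this
        rw [Prod.snd_sum]
        refine Eq.subst (motive := fun z => z ∈ coneLattice N' τ')
          (Finset.sum_congr rfl fun σ' hσ' => ?_) this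
        rw [Prod.smul_snd, PNat.mul_coe, mul_smul, Nat.cast_smul_eq_nsmul]

theorem prod_dim (S : TropicalFan N) (S' : TropicalFan N') :
    (S.prod S').dim = S.dim + S'.dim := by
  rw [TropicalFan.prod]

theorem mem_prod_cones' {S : TropicalFan N} {S' : TropicalFan N'} {κ : PointedCone ℝ (V × W)} :
    κ ∈ (S.prod S').cones ↔ ∃ σ ∈ S.cones, ∃ σ' ∈ S'.cones, κ = σ.prod σ' := by
  rw [TropicalFan.prod]
  exact mem_prod_cones

theorem prod_weight (S : TropicalFan N) (S' : TropicalFan N') (σ : PointedCone ℝ V)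
    (σ' : PointedCone ℝ W) : (S.prod S').weight (σ.prod σ') = S.weight σ * S'.weight σ' := by
  simp only [TropicalFan.prod, map_fst_prod, map_snd_prod]

theorem prod_support (S : TropicalFan N) (S' : TropicalFan N') :
    (S.prod S').support = S.support ×ˢ S'.support := by
  ext ⟨x, y⟩
  constructor
  · rintro ⟨κ, hκ, hx⟩
    obtain ⟨σ, h, σ', h', rfl⟩ := mem_prod_cones'.1 hκ
    exact ⟨⟨σ, h, hx.1⟩, ⟨σ', h', hx.2⟩⟩
  · rintro ⟨⟨σ, h, hx⟩, ⟨σ', h', hy⟩⟩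
    exact ⟨σ.prod σ', mem_prod_cones'.2 ⟨σ, h, σ', h', rfl⟩, hx, hy⟩

theorem Refines.prod {T S : TropicalFan N} {T' S' : TropicalFan N'} (h : T.Refines S)
    (h' : T'.Refines S') : (T.prod T').Refines (S.prod S') where
  dim_eq := by rw [prod_dim, prod_dim, h.dim_eq, h'.dim_eq]
  support_eq := by rw [prod_support, prod_support, h.support_eq, h'.support_eq]
  exists_le := by
    intro κ hκ
    obtain ⟨ρ, hρ, ρ', hρ', rfl⟩ := mem_prod_cones'.1 hκ
    obtain ⟨σ, hσ, hle⟩ := h.exists_le ρ hρ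
    obtain ⟨σ', hσ', hle'⟩ := h'.exists_le ρ' hρ'
    exact ⟨σ.prod σ', mem_prod_cones'.2 ⟨σ, hσ, σ', hσ', rfl⟩, Submodule.prod_mono hle hle'⟩
  weight_eq := by
    intro κ hκ hd
    obtain ⟨ρ, hρ, ρ', hρ', rfl⟩ := mem_prod_cones'.1 hκ
    rw [coneDim_prod N N', prod_dim] at hd
    have := T.coneDim_le hρ
    have := T'.coneDim_le hρ'
    obtain ⟨σ, hσ, hdσ, hle, hw⟩ := h.weight_eq ρ hρ (by omega)
    obtain ⟨σ', hσ', hdσ', hle', hw'⟩ := h'.weight_eq ρ' hρ' (by omega)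
    refine ⟨σ.prod σ', mem_prod_cones'.2 ⟨σ, hσ, σ', hσ', rfl⟩, ?_, Submodule.prod_mono hle hle', ?_⟩
    · rw [coneDim_prod N N', hdσ, hdσ', prod_dim]
    · rw [prod_weight, prod_weight, hw, hw']

end TropicalFan

/-! ### Tropical fan cycles -/

/-- A tropical fan cycle in `N_ℝ`: a class of tropical fans for the relation of having a common
tropical refinement. -/
def FanCycle {V : Type u} [AddCommGroup V] [Module ℝ V] (N : RealLattice V) : Type u :=
  Quot (TropicalFan.TropEquiv (N := N))

namespace FanCycle

variable {V : Type u} {W : Type v} [AddCommGroup V] [Module ℝ V] [AddCommGroup W] [Module ℝ W]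
  {N : RealLattice V} {N' : RealLattice W}

/-- `S` is a fan structure on the cycle `F`, i.e. a representative of `F`. -/
def IsFanStructure (S : TropicalFan N) (F : FanCycle N) : Prop :=
  Quot.mk _ S = F

/-- The product `F × G` of tropical fan cycles. -/
noncomputable def prod (F : FanCycle N) (G : FanCycle N') : FanCycle (N.prod N') :=
  Quot.map₂ TropicalFan.prod
    (fun S _ _ ⟨T, h, h'⟩ => ⟨S.prod T, (TropicalFan.Refines.refl S).prod h,
      (TropicalFan.Refines.refl S).prod h'⟩)
    (fun _ _ S ⟨T, h, h'⟩ => ⟨T.prod S, h.prod (TropicalFan.Refines.refl S),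
      h'.prod (TropicalFan.Refines.refl S)⟩) F G

/-- A cycle is reduced if it has a fan structure all of whose weights are one. -/
def IsReduced (F : FanCycle N) : Prop :=
  ∃ S : TropicalFan N, IsFanStructure S F ∧ S.IsReduced

/-- A cycle is complete if it is supported on the whole ambient space. -/
def IsComplete (F : FanCycle N) : Prop :=
  ∃ S : TropicalFan N, IsFanStructure S F ∧ S.IsComplete

end FanCycle

/-! ### Isomorphisms -/

/-- An isomorphism of tropical fans `(Σ, ω) ≅ (Σ', ω')`: an isomorphism `N_Σ ≅ N_Σ'` between the
lattices `N_Σ = N ∩ span |Σ|` and `N_Σ' = N' ∩ span |Σ'|` (given by its real extension) which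
matches the cones of `Σ` with those of `Σ'` and preserves the weights. Since `N_σ` is mapped
isomorphically onto `N_{f(σ)}`, the lattice indices in the push-forward of weights are one. -/
structure TropicalFan.Iso {V : Type u} {W : Type v} [AddCommGroup V] [Module ℝ V]
    [AddCommGroup W] [Module ℝ W] {N : RealLattice V} {N' : RealLattice W}
    (S : TropicalFan N) (S' : TropicalFan N') where
  toLinearEquiv : Submodule.span ℝ S.support ≃ₗ[ℝ] Submodule.span ℝ S'.support
  mem_lattice_iff : ∀ x, (toLinearEquiv x : W) ∈ N'.carrier ↔ (x : V) ∈ N.carrier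
  map_cone : ∀ σ ∈ S.cones, ∃ σ' ∈ S'.cones, ∀ x, (toLinearEquiv x : W) ∈ σ' ↔ (x : V) ∈ σ
  comap_cone : ∀ σ' ∈ S'.cones, ∃ σ ∈ S.cones, ∀ x, (toLinearEquiv x : W) ∈ σ' ↔ (x : V) ∈ σ
  weight_eq : ∀ σ ∈ S.cones, ∀ σ' ∈ S'.cones, coneDim σ = S.dim →
    (∀ x, (toLinearEquiv x : W) ∈ σ' ↔ (x : V) ∈ σ) → S'.weight σ' = S.weight σ

/-- Two tropical fan cycles are isomorphic if they have isomorphic fan structures. -/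
def FanCycle.IsIsomorphic {V : Type u} {W : Type v} [AddCommGroup V] [Module ℝ V]
    [AddCommGroup W] [Module ℝ W] {N : RealLattice V} {N' : RealLattice W}
    (F : FanCycle N) (G : FanCycle N') : Prop :=
  ∃ (S : TropicalFan N) (S' : TropicalFan N'),
    FanCycle.IsFanStructure S F ∧ FanCycle.IsFanStructure S' G ∧ Nonempty (S.Iso S')

/-! ### Piecewise integral linear functions, divisors and tropical modifications -/

/-- A piecewise integral linear function `φ` on a fan: on each cone `σ` it is the restriction of a
linear function `φ_σ = lin σ` taking integral values on `N_σ`. Only the values of `toFun` on the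
support, and of `lin σ` on the span of a cone `σ` of the fan, are relevant. Continuity on the
support is automatic, as the fan consists of finitely many closed cones. -/
structure PLFunction {V : Type u} [AddCommGroup V] [Module ℝ V] {N : RealLattice V}
    (S : RatFan N) where
  toFun : V → ℝ
  lin : PointedCone ℝ V → V →ₗ[ℝ] ℝ
  integral : ∀ σ ∈ S.cones, ∀ x ∈ coneLattice N σ, ∃ k : ℤ, lin σ x = k
  eq_lin : ∀ σ ∈ S.cones, ∀ x ∈ σ, toFun x = lin σ x

namespace PLFunction

variable {V : Type u} [AddCommGroup V] [Module ℝ V] {N : RealLattice V} {S : TropicalFan N}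

/-- The order of vanishing of `φ` along a cone `τ` of codimension one. -/
noncomputable def ord (φ : PLFunction S.toRatFan) (τ : PointedCone ℝ V) : ℝ :=
  φ.lin τ (∑ σ ∈ S.conesAbove S.dim τ, (S.weight σ : ℕ) • latticeNormal N σ τ) -
    ∑ σ ∈ S.conesAbove S.dim τ, φ.lin σ ((S.weight σ : ℕ) • latticeNormal N σ τ)

/-- The cones of the divisor `div(φ)`: the cones of codimension one along which `φ` has nonzero
order of vanishing, and their faces. -/
def divCones (φ : PLFunction S.toRatFan) : Set (PointedCone ℝ V) :=
  {ρ | ∃ τ ∈ S.cones, coneDim τ + 1 = S.dim ∧ φ.ord τ ≠ 0 ∧ ρ.IsFaceOf τ}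

/-- The tropical fan `Δ` is the divisor `div(φ)`, with weights the orders of vanishing.
(In particular `div(φ)` is nonzero and effective.) -/
structure IsDivisor (φ : PLFunction S.toRatFan) (Δ : TropicalFan N) : Prop where
  dim_eq : Δ.dim + 1 = S.dim
  cones_eq : (Δ.cones : Set (PointedCone ℝ V)) = φ.divCones
  weight_eq : ∀ τ ∈ Δ.cones, coneDim τ = Δ.dim → ((Δ.weight τ : ℕ) : ℝ) = φ.ord τ

/-- The cone `{(x, φ(x)) | x ∈ σ}` of the graph of `φ`. -/
def graphCone (φ : PLFunction S.toRatFan) (σ : PointedCone ℝ V) : PointedCone ℝ (V × ℝ) :=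
  σ.map (LinearMap.id.prod (φ.lin σ))

/-- The cone `τ_≥ = {(x, φ(x)) | x ∈ τ} + ℝ_≥0 (0, 1)`. -/
def upperCone (φ : PLFunction S.toRatFan) (τ : PointedCone ℝ V) : PointedCone ℝ (V × ℝ) :=
  φ.graphCone τ ⊔ PointedCone.hull ℝ {(0, 1)}

/-- The tropical fan `T` in `N_ℝ × ℝ` is the tropical modification of `S` with respect to `φ`: its
cones are the graph cones over the cones of `S` and the cones `τ_≥` over the cones of `div(φ)`; its
weights are `ω(σ)` on the former and `ord_τ(φ)` on the latter. -/
structure IsModification (φ : PLFunction S.toRatFan) (T : TropicalFan (N.prod RealLattice.int)) :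
    Prop where
  dim_eq : T.dim = S.dim
  cones_eq : (T.cones : Set (PointedCone ℝ (V × ℝ))) =
    φ.graphCone '' (S.cones : Set (PointedCone ℝ V)) ∪ φ.upperCone '' φ.divCones
  weight_graph : ∀ σ ∈ S.cones, coneDim σ = S.dim → T.weight (φ.graphCone σ) = S.weight σ
  weight_upper : ∀ τ ∈ S.cones, coneDim τ + 1 = S.dim → φ.ord τ ≠ 0 →
    ((T.weight (φ.upperCone τ) : ℕ) : ℝ) = φ.ord τ

end PLFunction

/-- The cycle `M` is a tropical modification of the cycle `F` along the tropical divisor `D`: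
for some piecewise integral linear function `φ` on (a fan structure on) `F` one has `div(φ) = D`
and `M` is the tropical modification of `F` with respect to `φ`. -/
def FanCycle.IsModificationAlong {V : Type u} [AddCommGroup V] [Module ℝ V] {N : RealLattice V}
    (M : FanCycle (N.prod RealLattice.int)) (F D : FanCycle N) : Prop :=
  ∃ (S : TropicalFan N) (φ : PLFunction S.toRatFan) (Δ : TropicalFan N)
    (T : TropicalFan (N.prod RealLattice.int)),
    FanCycle.IsFanStructure S F ∧ φ.IsDivisor Δ ∧ FanCycle.IsFanStructure Δ D ∧
      φ.IsModification T ∧ FanCycle.IsFanStructure T M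

/-! ### Quasilinear cycles -/

/-- Quasilinear tropical fan cycles: a reduced tropical fan cycle is quasilinear if it is isomorphic
to a complete tropical fan cycle, or to a tropical modification of a quasilinear tropical fan cycle
along a quasilinear tropical divisor. -/
inductive FanCycle.IsQuasilinear : ∀ {V : Type u} [AddCommGroup V] [Module ℝ V] {N : RealLattice V},
    FanCycle N → Prop
  | of_complete {V V' : Type u} [AddCommGroup V] [Module ℝ V] [AddCommGroup V'] [Module ℝ V']
      {N : RealLattice V} {N' : RealLattice V'} (F : FanCycle N) (G : FanCycle N') :
      F.IsReduced → G.IsComplete → F.IsIsomorphic G → FanCycle.IsQuasilinear F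
  | of_modification {V V' : Type u} [AddCommGroup V] [Module ℝ V] [AddCommGroup V'] [Module ℝ V']
      {N : RealLattice V} {N' : RealLattice V'} (F : FanCycle N) (G D : FanCycle N')
      (M : FanCycle (N'.prod RealLattice.int)) :
      F.IsReduced → FanCycle.IsQuasilinear G → FanCycle.IsQuasilinear D →
      M.IsModificationAlong G D → F.IsIsomorphic M → FanCycle.IsQuasilinear F

open Filter Topology


/-! ### Cells of an arrangement of linear functionals, polyhedral sets and their stars -/

section Cells

variable {V : Type*} {W : Type*} [AddCommGroup V] [Module ℝ V] [AddCommGroup W] [Module ℝ W]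

/-- The closed cell of `x` in the arrangement of the functionals in `A`. -/
def cell (A : Set (V →ₗ[ℝ] ℝ)) (x : V) : PointedCone ℝ V where
  carrier := {y | ∀ f ∈ A, (0 ≤ f x → 0 ≤ f y) ∧ (f x ≤ 0 → f y ≤ 0)}
  zero_mem' := fun f _ => by simp
  add_mem' := fun {a b} ha hb f hf => by
    rw [map_add]
    exact ⟨fun h => add_nonneg ((ha f hf).1 h) ((hb f hf).1 h),
      fun h => add_nonpos ((ha f hf).2 h) ((hb f hf).2 h)⟩
  smul_mem' := fun c a ha f hf => by
    have : f (c • a) = (c : ℝ) * f a := by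
      rw [← smul_eq_mul, ← map_smul]; rfl
    rw [this]
    exact ⟨fun h => mul_nonneg c.2 ((ha f hf).1 h),
      fun h => mul_nonpos_of_nonneg_of_nonpos c.2 ((ha f hf).2 h)⟩

/-- The linear span of the cell of `x`. -/
def cellSpan (A : Set (V →ₗ[ℝ] ℝ)) (x : V) : Submodule ℝ V where
  carrier := {v | ∀ f ∈ A, f x = 0 → f v = 0}
  zero_mem' := fun f _ _ => map_zero f
  add_mem' := fun {a b} ha hb f hf h => by rw [map_add, ha f hf h, hb f hf h, add_zero]
  smul_mem' := fun c a ha f hf h => by rw [map_smul, ha f hf h, smul_zero]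

/-- `X` is a closed union of cells of the arrangement `A`. -/
def IsCellular (A : Set (V →ₗ[ℝ] ℝ)) (X : Set V) : Prop :=
  ∀ x ∈ X, ∀ y ∈ cell A x, y ∈ X

/-- The star of `X` at `x`: all directions in which one can go a little from `x` within `X`. -/
def localStar (X : Set V) (x : V) : Set V :=
  {v | ∀ᶠ t : ℝ in 𝓝[>] 0, x + t • v ∈ X}

variable {A B : Set (V →ₗ[ℝ] ℝ)} {X Y : Set V} {x y z v w : V}

theorem mem_cell : y ∈ cell A x ↔ ∀ f ∈ A, (0 ≤ f x → 0 ≤ f y) ∧ (f x ≤ 0 → f y ≤ 0) := Iff.rfl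

theorem mem_cellSpan : v ∈ cellSpan A x ↔ ∀ f ∈ A, f x = 0 → f v = 0 := Iff.rfl

theorem mem_localStar : v ∈ localStar X x ↔ ∀ᶠ t : ℝ in 𝓝[>] 0, x + t • v ∈ X := Iff.rfl

theorem self_mem_cell : x ∈ cell A x := fun _ _ => ⟨id, id⟩

theorem cell_trans (h : y ∈ cell A x) (h' : z ∈ cell A y) : z ∈ cell A x := fun f hf =>
  ⟨fun h0 => (h' f hf).1 ((h f hf).1 h0), fun h0 => (h' f hf).2 ((h f hf).2 h0)⟩

theorem cell_anti (h : A ⊆ B) : cell B x ≤ cell A x := fun _ hy f hf => hy f (h hf)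

theorem IsCellular.mono (h : IsCellular A X) (hAB : A ⊆ B) : IsCellular B X :=
  fun x hx y hy => h x hx y (cell_anti hAB hy)

theorem IsCellular.zero_mem_of_nonempty (h : IsCellular A X) (hX : X.Nonempty) : (0 : V) ∈ X :=
  let ⟨x, hx⟩ := hX
  h x hx 0 (zero_mem _)

theorem eq_zero_of_mem_cell (h : y ∈ cell A x) {f : V →ₗ[ℝ] ℝ} (hf : f ∈ A) (hx : f x = 0) :
    f y = 0 :=
  le_antisymm ((h f hf).2 hx.le) ((h f hf).1 hx.ge)

theorem cellSpan_mono (h : y ∈ cell A x) : cellSpan A y ≤ cellSpan A x :=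
  fun _ hv f hf hx => hv f hf (eq_zero_of_mem_cell h hf hx)

theorem cell_le_cellSpan : y ∈ cell A x → y ∈ cellSpan A x :=
  fun h _ hf hx => eq_zero_of_mem_cell h hf hx

/-! Signs of affine functions for small positive arguments. -/

theorem eventually_pos_of_pos {a : ℝ} (b : ℝ) (h : 0 < a) : ∀ᶠ t : ℝ in 𝓝[>] 0, 0 < a + t * b := by
  have : Tendsto (fun t : ℝ => a + t * b) (𝓝[>] 0) (𝓝 (a + 0 * b)) :=
    Tendsto.mono_left (by exact Continuous.tendsto (by fun_prop) _) nhdsWithin_le_nhds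
  rw [zero_mul, add_zero] at this
  exact this.eventually (lt_mem_nhds h)

theorem eventually_small (a : ℝ) (h : 0 < a) : ∀ᶠ t : ℝ in 𝓝[>] 0, t < a :=
  (eventually_pos_of_pos (-1) h).mono fun t ht => by linarith

theorem eventually_pos : ∀ᶠ t : ℝ in 𝓝[>] 0, 0 < t := eventually_mem_nhdsWithin

/-- The sign condition for `a + t b`, `t` small and positive. -/
def LexSign (a b c : ℝ) : Prop :=
  (0 < c ↔ 0 < a ∨ a = 0 ∧ 0 < b) ∧ (c < 0 ↔ a < 0 ∨ a = 0 ∧ b < 0)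

theorem eventually_lexSign (a b : ℝ) : ∀ᶠ t : ℝ in 𝓝[>] 0, LexSign a b (a + t * b) := by
  rcases lt_trichotomy a 0 with h | h | h
  · filter_upwards [eventually_pos_of_pos (-b) (neg_pos.2 h)] with t ht
    have : a + t * b < 0 := by linarith
    exact ⟨⟨fun h' => absurd h' this.le.not_gt, fun h' => by
      rcases h' with h' | ⟨h', -⟩ <;> linarith⟩, ⟨fun _ => Or.inl h, fun _ => this⟩⟩
  · filter_upwards [eventually_pos] with t ht
    subst h
    simp [LexSign, mul_pos_iff_of_pos_left ht, mul_neg_iff, ht, not_lt.2 ht.le]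
  · filter_upwards [eventually_pos_of_pos b h] with t ht
    exact ⟨⟨fun _ => Or.inl h, fun _ => ht⟩, ⟨fun h' => absurd h' ht.le.not_gt, fun h' => by
      rcases h' with h' | ⟨h', -⟩ <;> linarith⟩⟩

/-- Equality of signs. -/
def SignEq (a b : ℝ) : Prop := (0 < a ↔ 0 < b) ∧ (a < 0 ↔ b < 0)

theorem SignEq.symm {a b : ℝ} (h : SignEq a b) : SignEq b a := ⟨h.1.symm, h.2.symm⟩

theorem SignEq.eq_zero_iff {a b : ℝ} (h : SignEq a b) : a = 0 ↔ b = 0 := by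
  obtain ⟨h1, h2⟩ := h
  have := lt_trichotomy a 0
  have := lt_trichotomy b 0
  grind

theorem LexSign.signEq {a b c d : ℝ} (h : LexSign a b c) (h' : LexSign a b d) : SignEq c d :=
  ⟨h.1.trans h'.1.symm, h.2.trans h'.2.symm⟩

theorem LexSign.congr {a a' b b' c : ℝ} (h : LexSign a b c) (ha : SignEq a a')
    (hb : a = 0 → SignEq b b') : LexSign a' b' c := by
  have h0 := ha.eq_zero_iff
  obtain ⟨h1, h2⟩ := ha
  unfold LexSign SignEq at *
  grind

theorem mem_of_signEq (h : ∀ f ∈ A, SignEq (f x) (f y)) : y ∈ cell A x := fun f hf => by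
  have := h f hf
  refine ⟨fun h0 => ?_, fun h0 => ?_⟩
  · by_contra hn; exact absurd (this.2.2 (not_le.1 hn)) (not_lt.2 h0)
  · by_contra hn; exact absurd (this.1.2 (not_le.1 hn)) (not_lt.2 h0)

theorem IsCellular.mem_iff (hX : IsCellular A X) (h : ∀ f ∈ A, SignEq (f x) (f y)) : x ∈ X ↔ y ∈ X :=
  ⟨fun hx => hX x hx y (mem_of_signEq h),
    fun hy => hX y hy x (mem_of_signEq fun f hf => (h f hf).symm)⟩

theorem eventually_signs (hA : A.Finite) (x v : V) :
    ∀ᶠ t : ℝ in 𝓝[>] 0, ∀ f ∈ A, LexSign (f x) (f v) (f (x + t • v)) := by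
  rw [Filter.eventually_all_finite hA]
  intro f _
  simpa using eventually_lexSign (f x) (f v)

theorem eventually_mem_or (hA : A.Finite) (hX : IsCellular A X) (x v : V) :
    (∀ᶠ t : ℝ in 𝓝[>] 0, x + t • v ∈ X) ∨ ∀ᶠ t : ℝ in 𝓝[>] 0, x + t • v ∉ X := by
  have h := eventually_signs hA x v
  obtain ⟨t0, h0⟩ := h.exists
  by_cases hx : x + t0 • v ∈ X
  · refine Or.inl (h.mono fun t ht => ?_)
    exact (hX.mem_iff fun f hf => (h0 f hf).signEq (ht f hf)).1 hx
  · refine Or.inr (h.mono fun t ht h' => hx ?_)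
    exact (hX.mem_iff fun f hf => (h0 f hf).signEq (ht f hf)).2 h'

theorem notMem_localStar (hA : A.Finite) (hX : IsCellular A X) (h : v ∉ localStar X x) :
    ∀ᶠ t : ℝ in 𝓝[>] 0, x + t • v ∉ X :=
  (eventually_mem_or hA hX x v).resolve_left h

theorem mem_localStar_of_lexSign (hA : A.Finite) (hX : IsCellular A X)
    (h : ∀ f ∈ A, LexSign (f x) (f v) (f y)) : v ∈ localStar X x ↔ y ∈ X := by
  have h1 := eventually_signs hA x v
  constructor
  · intro hv
    obtain ⟨t, ht, ht'⟩ := ((mem_localStar.1 hv).and h1).exists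
    exact (hX.mem_iff fun f hf => (ht' f hf).signEq (h f hf)).1 ht
  · intro hy
    exact h1.mono fun t ht => (hX.mem_iff fun f hf => (ht f hf).signEq (h f hf)).2 hy

theorem localStar_mono (h : X ⊆ Y) : localStar X x ⊆ localStar Y x := fun _ hv =>
  (mem_localStar.1 hv).mono fun _ ht => h ht

theorem mem_of_mem_localStar (hX : IsCellular A X) (hA : A.Finite) (h : v ∈ localStar X x) : x ∈ X := by
  obtain ⟨t, h1, h2⟩ := ((mem_localStar.1 h).and (eventually_signs hA x v)).exists
  refine hX _ h1 x fun f hf => ?_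
  have := h2 f hf
  unfold LexSign at this
  grind

theorem mem_cell_of_lexSign (h : ∀ f ∈ A, LexSign (f x) (f v) (f y)) : x ∈ cell A y := by
  intro f hf
  have := h f hf
  unfold LexSign at this
  grind

/-- The star of a polyhedral set is polyhedral for the same arrangement. -/
theorem IsCellular.star (hA : A.Finite) (hX : IsCellular A X) (x : V) : IsCellular A (localStar X x) := by
  intro v hv w hw
  obtain ⟨t, h1, h2⟩ := ((mem_localStar.1 hv).and (eventually_signs hA x v)).exists
  refine (eventually_signs hA x w).mono fun s hs => hX _ h1 _ fun f hf => ?_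
  have := h2 f hf
  have := hs f hf
  have := hw f hf
  unfold LexSign at *
  grind

theorem localStar_localStar_eq_of_lexSign (hA : A.Finite) (hX : IsCellular A X)
    (h : ∀ f ∈ A, LexSign (f x) (f v) (f y)) : localStar (localStar X x) v = localStar X y := by
  ext w
  obtain ⟨s, hs⟩ := (eventually_signs hA v w).exists
  obtain ⟨r, hr⟩ := (eventually_signs hA y w).exists
  rw [mem_localStar_of_lexSign hA (hX.star hA x) hs, mem_localStar_of_lexSign hA hX hr]
  refine mem_localStar_of_lexSign hA hX fun f hf => ?_
  have := h f hf
  have := hs f hf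
  have := hr f hf
  unfold LexSign at *
  have := lt_trichotomy (f v) 0
  have := lt_trichotomy (f x) 0
  have := lt_trichotomy (f y) 0
  grind

theorem eventually_localStar_localStar (hA : A.Finite) (hX : IsCellular A X) (x v : V) :
    ∀ᶠ t : ℝ in 𝓝[>] 0, localStar (localStar X x) v = localStar X (x + t • v) :=
  (eventually_signs hA x v).mono fun _ ht => localStar_localStar_eq_of_lexSign hA hX ht

theorem lexSign_sub_of_mem_cell (h : y ∈ cell A x) :
    ∀ f ∈ A, LexSign (f y) (f (x - y)) (f x) := by
  intro f hf
  have := h f hf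
  rw [map_sub]
  unfold LexSign
  grind

theorem sub_mem_localStar (hA : A.Finite) (hX : IsCellular A X) (hx : x ∈ X) (h : y ∈ cell A x) :
    x - y ∈ localStar X y :=
  (mem_localStar_of_lexSign hA hX (lexSign_sub_of_mem_cell h)).2 hx

theorem localStar_localStar_sub (hA : A.Finite) (hX : IsCellular A X) (h : y ∈ cell A x) :
    localStar (localStar X y) (x - y) = localStar X x :=
  localStar_localStar_eq_of_lexSign hA hX (lexSign_sub_of_mem_cell h)

theorem zero_mem_localStar (hx : x ∈ X) : (0 : V) ∈ localStar X x := by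
  simp [mem_localStar, hx]

theorem smul_mem_localStar (h : v ∈ localStar X x) {c : ℝ} (hc : 0 < c) : c • v ∈ localStar X x := by
  rw [mem_localStar] at h ⊢
  have : Tendsto (fun t : ℝ => t * c) (𝓝[>] 0) (𝓝[>] 0) := by
    refine tendsto_nhdsWithin_iff.2 ⟨?_, ?_⟩
    · have : Tendsto (fun t : ℝ => t * c) (𝓝[>] 0) (𝓝 (0 * c)) :=
        Tendsto.mono_left (by exact Continuous.tendsto (by fun_prop) _) nhdsWithin_le_nhds
      rwa [zero_mul] at this
    · exact eventually_pos.mono fun t ht => mul_pos ht hc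
  exact (this.eventually h).mono fun t ht => by rwa [smul_smul]

theorem localStar_zero (hA : A.Finite) (hX : IsCellular A X) : localStar X 0 = X := by
  ext v
  exact mem_localStar_of_lexSign hA hX fun f _ => by simp [LexSign]

/-- The star at `x` only depends on the signs of those functionals that vanish at `x`. -/
theorem mem_localStar_congr (hA : A.Finite) (hX : IsCellular A X)
    (h : ∀ f ∈ A, f x = 0 → SignEq (f v) (f w)) : v ∈ localStar X x ↔ w ∈ localStar X x := by
  obtain ⟨s, hs⟩ := (eventually_signs hA x v).exists
  rw [mem_localStar_of_lexSign hA hX hs]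
  refine (mem_localStar_of_lexSign hA hX fun f hf => ?_).symm
  exact (hs f hf).congr ⟨Iff.rfl, Iff.rfl⟩ (h f hf)

/-- `Z` is invariant under translation by vectors in `L`. -/
def Invariant (Z : Set V) (L : Submodule ℝ V) : Prop :=
  ∀ z ∈ Z, ∀ l ∈ L, z + l ∈ Z

theorem localStar_invariant (hA : A.Finite) (hX : IsCellular A X) (x : V) :
    Invariant (localStar X x) (cellSpan A x) := by
  intro v hv l hl
  refine (mem_localStar_congr hA hX fun f hf h => ?_).1 hv
  rw [map_add, hl f hf h, add_zero]
  exact ⟨Iff.rfl, Iff.rfl⟩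

theorem Invariant.star {L : Submodule ℝ V} (h : Invariant X L) (x : V) :
    Invariant (localStar X x) L := by
  intro v hv l hl
  refine (mem_localStar.1 hv).mono fun t ht => ?_
  rw [smul_add, ← add_assoc]
  exact h _ ht _ (L.smul_mem t hl)

theorem Invariant.subset {L : Submodule ℝ V} (h : Invariant X L) (h0 : (0 : V) ∈ X) :
    (L : Set V) ⊆ X := fun l hl => by simpa using h 0 h0 l hl

/-- Translating within the star by a vector of a lineality space does not change the star. -/
theorem Invariant.localStar_eq {L : Submodule ℝ V} (h : Invariant X L) {l : V} (hl : l ∈ L) (x : V) :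
    localStar X (x + l) = localStar X x := by
  ext v
  simp only [mem_localStar]
  refine eventually_congr (Eventually.of_forall fun t => ?_)
  have e : x + l + t • v = (x + t • v) + l := by abel
  rw [e]
  refine ⟨fun h' => ?_, fun h' => h _ h' _ hl⟩
  simpa using h _ h' _ (neg_mem hl)

theorem localStar_subspace (U : Submodule ℝ V) (hx : x ∈ U) : localStar (U : Set V) x = U := by
  ext v
  simp only [mem_localStar, SetLike.mem_coe]
  constructor
  · intro h
    obtain ⟨t, h1, h2⟩ := (h.and eventually_pos).exists
    have : t • v ∈ U := by simpa using sub_mem h1 hx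
    simpa [smul_smul, h2.ne'] using U.smul_mem t⁻¹ this
  · intro hv
    exact Eventually.of_forall fun t => add_mem hx (U.smul_mem t hv)

theorem localStar_prod (Y : Set W) (p : V × W) :
    localStar (X ×ˢ Y) p = localStar X p.1 ×ˢ localStar Y p.2 := by
  ext v
  simp [mem_localStar, Filter.eventually_and]

theorem localStar_univ : localStar (Set.univ : Set V) x = Set.univ := by
  ext v; simp [mem_localStar]

theorem localStar_empty : localStar (∅ : Set V) x = ∅ := by
  ext v; simpa [mem_localStar] using (inferInstance : (𝓝[>] (0 : ℝ)).NeBot).ne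

theorem cell_comp (p : V →ₗ[ℝ] W) (A : Set (W →ₗ[ℝ] ℝ)) (x y : V) :
    y ∈ cell ((fun f => f ∘ₗ p) '' A) x ↔ p y ∈ cell A (p x) := by
  simp [mem_cell]

theorem IsCellular.preimage {A : Set (W →ₗ[ℝ] ℝ)} {Y : Set W} (h : IsCellular A Y) (p : V →ₗ[ℝ] W) :
    IsCellular ((fun f => f ∘ₗ p) '' A) (p ⁻¹' Y) :=
  fun _ hx _ hy => h _ hx _ ((cell_comp p A _ _).1 hy)

theorem isCellular_univ : IsCellular A (Set.univ : Set V) := fun _ _ _ _ => trivial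

/-- A subspace contains a vector on which no functional of a finite set vanishes, unless it
vanishes on the whole subspace. -/
theorem exists_generic (hA : A.Finite) (U : Submodule ℝ V) :
    ∃ u ∈ U, ∀ f ∈ A, f u = 0 → ∀ w ∈ U, f w = 0 := by
  induction A, hA using Set.Finite.induction_on with
  | empty => exact ⟨0, zero_mem _, by simp⟩
  | @insert f A _ hA ih =>
    obtain ⟨u, hu, h⟩ := ih
    by_cases hf : ∃ w ∈ U, f w ≠ 0
    · obtain ⟨w, hw, hfw⟩ := hf
      have h1 := eventually_signs (hA.insert f) u w
      obtain ⟨t, ht⟩ := h1.exists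
      refine ⟨u + t • w, add_mem hu (U.smul_mem t hw), ?_⟩
      rintro g (rfl | hg) h0
      · have := ht g (Set.mem_insert _ _)
        rw [h0] at this
        unfold LexSign at this
        grind
      · have := ht g (Set.mem_insert_of_mem _ hg)
        rw [h0] at this
        refine h g hg ?_
        unfold LexSign at this
        grind
    · push Not at hf
      refine ⟨u, hu, ?_⟩
      rintro g (rfl | hg) h0
      · exact hf
      · exact h g hg h0

theorem span_cell (hA : A.Finite) (x : V) :
    Submodule.span ℝ (cell A x : Set V) = cellSpan A x := by
  refine le_antisymm (Submodule.span_le.2 fun y hy => cell_le_cellSpan hy) fun v hv => ?_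
  obtain ⟨t, ht, h0⟩ := ((eventually_signs hA x v).and eventually_pos).exists
  have h1 : x + t • v ∈ cell A x := mem_of_signEq fun f hf => by
    have := ht f hf
    have := hv f hf
    unfold LexSign at *
    unfold SignEq
    grind
  have h2 := Submodule.sub_mem _ (Submodule.subset_span (R := ℝ) h1)
    (Submodule.subset_span (R := ℝ) (self_mem_cell (A := A) (x := x)))
  rw [add_sub_cancel_left] at h2
  simpa [smul_smul, h0.ne'] using Submodule.smul_mem _ t⁻¹ h2

end Cells

/-! ### Lattice maps, rational subspaces and rational cones -/

section Lattices

variable {V V' W : Type*} [AddCommGroup V] [Module ℝ V] [AddCommGroup V'] [Module ℝ V']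
  [AddCommGroup W] [Module ℝ W]

theorem RealLattice.mem_int {x : ℝ} : x ∈ RealLattice.int.carrier ↔ ∃ k : ℤ, (k : ℝ) = x := by
  simp [RealLattice.int, Submodule.mem_span_singleton]

/-- A linear map that sends lattice points to lattice points. -/
def LatMap (N : RealLattice V) (N' : RealLattice V') (p : V →ₗ[ℝ] V') : Prop :=
  ∀ x ∈ N.carrier, p x ∈ N'.carrier

variable {N : RealLattice V} {N' : RealLattice V'} {M : RealLattice W}

theorem LatMap.comp {q : V' →ₗ[ℝ] W} {p : V →ₗ[ℝ] V'} (hq : LatMap N' M q) (hp : LatMap N N' p) :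
    LatMap N M (q ∘ₗ p) := fun x hx => hq _ (hp x hx)

theorem latMap_id : LatMap N N LinearMap.id := fun _ hx => hx

theorem LatMap.add {p q : V →ₗ[ℝ] V'} (hp : LatMap N N' p) (hq : LatMap N N' q) :
    LatMap N N' (p + q) := fun x hx => add_mem (hp x hx) (hq x hx)

theorem LatMap.sub {p q : V →ₗ[ℝ] V'} (hp : LatMap N N' p) (hq : LatMap N N' q) :
    LatMap N N' (p - q) := fun x hx => sub_mem (hp x hx) (hq x hx)

theorem LatMap.neg {p : V →ₗ[ℝ] V'} (hp : LatMap N N' p) : LatMap N N' (-p) :=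
  fun x hx => neg_mem (hp x hx)

theorem LatMap.prod {p : V →ₗ[ℝ] V'} {q : V →ₗ[ℝ] W} (hp : LatMap N N' p) (hq : LatMap N M q) :
    LatMap N (N'.prod M) (p.prod q) := fun x hx => ⟨hp x hx, hq x hx⟩

theorem latMap_fst : LatMap (N.prod N') N (LinearMap.fst ℝ V V') := fun _ hx => hx.1

theorem latMap_snd : LatMap (N.prod N') N' (LinearMap.snd ℝ V V') := fun _ hx => hx.2

theorem latMap_inl : LatMap N (N.prod N') (LinearMap.inl ℝ V V') := fun _ hx => ⟨hx, zero_mem _⟩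

theorem latMap_inr : LatMap N' (N.prod N') (LinearMap.inr ℝ V V') := fun _ hx => ⟨zero_mem _, hx⟩

theorem RealLattice.smul_mem_of_mem_int {x : V} (hx : x ∈ N.carrier) {c : ℝ}
    (hc : c ∈ RealLattice.int.carrier) : c • x ∈ N.carrier := by
  obtain ⟨k, rfl⟩ := RealLattice.mem_int.1 hc
  rw [Int.cast_smul_eq_zsmul]
  exact N.carrier.smul_mem k hx

theorem LatMap.smul {p : V →ₗ[ℝ] V'} (hp : LatMap N N' p) {c : ℝ}
    (hc : c ∈ RealLattice.int.carrier) : LatMap N N' (c • p) :=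
  fun x hx => RealLattice.smul_mem_of_mem_int (hp x hx) hc

theorem RealLattice.one_mem_int : (1 : ℝ) ∈ RealLattice.int.carrier :=
  RealLattice.mem_int.2 ⟨1, by simp⟩

theorem RealLattice.span_eq_top (N : RealLattice V) :
    Submodule.span ℝ (N.carrier : Set V) = ⊤ := by
  obtain ⟨n, b, hb⟩ := N.exists_basis
  rw [eq_top_iff, ← b.span_eq, hb]
  exact Submodule.span_mono Submodule.subset_span

/-- Finitely many functionals, integral on the lattice. -/
def IsRatArr (N : RealLattice V) (A : Set (V →ₗ[ℝ] ℝ)) : Prop :=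
  A.Finite ∧ ∀ f ∈ A, LatMap N RealLattice.int f

theorem IsRatArr.union {A B : Set (V →ₗ[ℝ] ℝ)} (hA : IsRatArr N A) (hB : IsRatArr N B) :
    IsRatArr N (A ∪ B) :=
  ⟨hA.1.union hB.1, fun f hf => hf.elim (hA.2 f) (hB.2 f)⟩

theorem IsRatArr.comp {A : Set (V' →ₗ[ℝ] ℝ)} (hA : IsRatArr N' A) {p : V →ₗ[ℝ] V'}
    (hp : LatMap N N' p) : IsRatArr N ((fun f => f ∘ₗ p) '' A) :=
  ⟨hA.1.image _, by rintro _ ⟨f, hf, rfl⟩; exact (hA.2 f hf).comp hp⟩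

theorem isRatArr_empty : IsRatArr N (∅ : Set (V →ₗ[ℝ] ℝ)) := ⟨Set.finite_empty, by simp⟩

/-- Integral coordinate functionals. -/
theorem exists_coords (N : RealLattice V) :
    ∃ A, IsRatArr N A ∧ ∀ x : V, (∀ f ∈ A, f x = 0) → x = 0 := by
  obtain ⟨n, b, hb⟩ := N.exists_basis
  refine ⟨Set.range b.coord, ⟨Set.finite_range _, ?_⟩, fun x hx => ?_⟩
  · rintro _ ⟨i, rfl⟩ x hx
    rw [hb] at hx
    induction hx using Submodule.span_induction with
    | mem x h =>
      obtain ⟨j, rfl⟩ := h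
      rw [RealLattice.mem_int]
      refine ⟨if j = i then 1 else 0, ?_⟩
      rw [Basis.coord_apply, Basis.repr_self, Finsupp.single_apply]
      split <;> simp
    | zero => rw [map_zero]; exact zero_mem _
    | add x y _ _ h h' => rw [map_add]; exact add_mem h h'
    | smul k x _ h => rw [map_zsmul]; exact Submodule.smul_mem _ _ h
  · exact b.ext_elem fun i => by simpa using hx _ ⟨i, rfl⟩

/-- A subspace spanned by lattice points. -/
def IsRat (N : RealLattice V) (U : Submodule ℝ V) : Prop :=
  U ≤ Submodule.span ℝ {x | x ∈ U ∧ x ∈ N.carrier}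

theorem isRat_span {S : Set V} (h : ∀ x ∈ S, x ∈ N.carrier) : IsRat N (Submodule.span ℝ S) :=
  Submodule.span_mono fun _ hx => ⟨Submodule.subset_span hx, h _ hx⟩

theorem IsRat.map {U : Submodule ℝ V} (h : IsRat N U) {p : V →ₗ[ℝ] V'} (hp : LatMap N N' p) :
    IsRat N' (U.map p) := by
  refine (Submodule.map_mono h).trans ?_
  rw [Submodule.map_span]
  refine Submodule.span_mono ?_
  rintro _ ⟨x, hx, rfl⟩
  exact ⟨Submodule.mem_map_of_mem hx.1, hp x hx.2⟩

theorem IsRat.sup {U U' : Submodule ℝ V} (h : IsRat N U) (h' : IsRat N U') : IsRat N (U ⊔ U') :=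
  sup_le (h.trans (Submodule.span_mono fun _ hx => ⟨le_sup_left (a := U) hx.1, hx.2⟩))
    (h'.trans (Submodule.span_mono fun _ hx => ⟨le_sup_right (a := U) hx.1, hx.2⟩))

theorem isRat_top : IsRat N ⊤ := by
  have := isRat_span (N := N) (S := (N.carrier : Set V)) fun _ h => h
  rwa [N.span_eq_top] at this

theorem IsRat.prod {U : Submodule ℝ V} {U' : Submodule ℝ V'} (h : IsRat N U) (h' : IsRat N' U') :
    IsRat (N.prod N') (U.prod U') := by
  have := (h.map (latMap_inl (N := N) (N' := N'))).sup (h'.map (latMap_inr (N := N) (N' := N')))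
  rwa [← LinearMap.prod_eq_sup_map] at this

open Classical in
/-- A lattice basis adapted to a rational subspace. -/
theorem IsRat.exists_basis {U : Submodule ℝ V} (h : IsRat N U) :
    ∃ (m k : ℕ) (B : Basis (Fin m ⊕ Fin k) ℝ V), N.carrier = Submodule.span ℤ (Set.range B) ∧
      U = Submodule.span ℝ (Set.range (B ∘ Sum.inl)) := by
  obtain ⟨n, b, hb⟩ := N.exists_basis
  let bZ : Basis (Fin n) ℤ N.carrier :=
    (b.restrictScalars ℤ).map (LinearEquiv.ofEq _ _ hb.symm)
  have : Module.Free ℤ N.carrier := Module.Free.of_basis bZ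
  have : Module.Finite ℤ N.carrier := Module.Finite.of_basis bZ
  let P : Submodule ℤ N.carrier := (U.restrictScalars ℤ).comap N.carrier.subtype
  have hP : ∀ x : N.carrier, x ∈ P ↔ (x : V) ∈ U := fun x => Iff.rfl
  have tf : Module.IsTorsionFree ℤ (N.carrier ⧸ P) := by
    refine Module.IsTorsionFree.of_smul_eq_zero fun k x hx => or_iff_not_imp_left.2 fun hk => ?_
    obtain ⟨y, rfl⟩ := P.mkQ_surjective x
    rw [← map_smul, Submodule.mkQ_apply, Submodule.Quotient.mk_eq_zero, hP] at hx
    rw [Submodule.mkQ_apply, Submodule.Quotient.mk_eq_zero, hP]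
    have hx' : (k : ℝ) • (y : V) ∈ U := by rw [Int.cast_smul_eq_zsmul]; simpa using hx
    exact (Submodule.smul_mem_iff _ (Int.cast_ne_zero.2 hk)).1 hx'
  have : Module.Free ℤ (N.carrier ⧸ P) := Module.free_of_finite_type_torsion_free'
  obtain ⟨g, hg⟩ := Module.projective_lifting_property P.mkQ LinearMap.id P.mkQ_surjective
  have hg' : ∀ x, P.mkQ (g x) = x := fun x => LinearMap.congr_fun hg x
  let bP := Module.finBasis ℤ P
  let bQ := Module.finBasis ℤ (N.carrier ⧸ P)
  let w : Fin (finrank ℤ P) ⊕ Fin (finrank ℤ (N.carrier ⧸ P)) → N.carrier :=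
    Sum.elim (fun i => (bP i : N.carrier)) (fun j => g (bQ j))
  have hw : Submodule.span ℤ (Set.range w) = ⊤ := by
    rw [eq_top_iff]
    intro x _
    have h1 : ∀ y : P, (y : N.carrier) ∈ Submodule.span ℤ (Set.range w) := by
      intro y
      have hy : y ∈ Submodule.span ℤ (Set.range bP) := bP.span_eq ▸ Submodule.mem_top
      have := Submodule.apply_mem_span_image_of_mem_span P.subtype hy
      refine Submodule.span_mono ?_ this
      rintro _ ⟨_, ⟨i, rfl⟩, rfl⟩
      exact ⟨Sum.inl i, rfl⟩
    have h2 : ∀ y, g y ∈ Submodule.span ℤ (Set.range w) := by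
      intro y
      have hy : y ∈ Submodule.span ℤ (Set.range bQ) := bQ.span_eq ▸ Submodule.mem_top
      have := Submodule.apply_mem_span_image_of_mem_span g hy
      refine Submodule.span_mono ?_ this
      rintro _ ⟨_, ⟨i, rfl⟩, rfl⟩
      exact ⟨Sum.inr i, rfl⟩
    have h3 : x - g (P.mkQ x) ∈ P := by
      rw [← Submodule.Quotient.mk_eq_zero, ← Submodule.mkQ_apply, map_sub, hg', sub_self]
    have := add_mem (h1 ⟨_, h3⟩) (h2 (P.mkQ x))
    simpa using this
  have hV : Submodule.span ℤ (Set.range fun i => (w i : V)) = N.carrier := by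
    have := congrArg (Submodule.map N.carrier.subtype) hw
    rw [Submodule.map_span, Submodule.map_top, Submodule.range_subtype, ← Set.range_comp] at this
    exact this
  have hspan : ⊤ ≤ Submodule.span ℝ (Set.range fun i => (w i : V)) := by
    rw [← N.span_eq_top, Submodule.span_le]
    exact fun x hx => Submodule.span_subset_span ℤ ℝ _ (hV.ge hx)
  have hcard : Fintype.card (Fin (finrank ℤ P) ⊕ Fin (finrank ℤ (N.carrier ⧸ P))) =
      finrank ℝ V := by
    have h1 := P.finrank_quotient_add_finrank
    have h2 := Module.finrank_eq_card_basis bZ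
    have h3 := Module.finrank_eq_card_basis b
    simp only [Fintype.card_sum, Fintype.card_fin] at *
    omega
  let B := basisOfTopLeSpanOfCardEqFinrank _ hspan hcard
  have hB : ∀ i, B i = w i := fun i => by
    rw [coe_basisOfTopLeSpanOfCardEqFinrank]
  refine ⟨_, _, B, ?_, le_antisymm (h.trans (Submodule.span_le.2 ?_)) ?_⟩
  · rw [coe_basisOfTopLeSpanOfCardEqFinrank, hV]
  · rintro x ⟨hxU, hxN⟩
    have hy : (⟨⟨x, hxN⟩, hxU⟩ : P) ∈ Submodule.span ℤ (Set.range bP) :=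
      bP.span_eq ▸ Submodule.mem_top
    have := Submodule.apply_mem_span_image_of_mem_span (N.carrier.subtype ∘ₗ P.subtype) hy
    refine Submodule.span_subset_span ℤ ℝ _ (Submodule.span_mono ?_ this)
    rintro _ ⟨_, ⟨i, rfl⟩, rfl⟩
    exact ⟨i, hB _⟩
  · rw [Submodule.span_le]
    rintro _ ⟨i, rfl⟩
    change B (Sum.inl i) ∈ U
    rw [hB]
    exact (bP i).2

theorem latMap_of_basis {ι : Type*} {B : Basis ι ℝ V} (hB : N.carrier = Submodule.span ℤ (Set.range B))
    {p : V →ₗ[ℝ] V'} (h : ∀ i, p (B i) ∈ N'.carrier) : LatMap N N' p := by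
  intro x hx
  rw [hB] at hx
  have := Submodule.apply_mem_span_image_of_mem_span (p.restrictScalars ℤ) hx
  refine Submodule.span_le.2 ?_ this
  rintro _ ⟨_, ⟨i, rfl⟩, rfl⟩
  exact h i

/-- The lattice `N ∩ U` of a rational subspace `U`. -/
theorem IsRat.exists_lattice {U : Submodule ℝ V} (h : IsRat N U) :
    ∃ NU : RealLattice U, ∀ x : U, x ∈ NU.carrier ↔ (x : V) ∈ N.carrier := by
  obtain ⟨m, k, B, hB, hU⟩ := h.exists_basis
  have hmem : ∀ i, B (Sum.inl i) ∈ U := fun i => by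
    rw [hU]; exact Submodule.subset_span ⟨i, rfl⟩
  have hli : LinearIndependent ℝ fun i => (⟨B (Sum.inl i), hmem i⟩ : U) := by
    refine LinearIndependent.of_comp U.subtype ?_
    exact B.linearIndependent.comp Sum.inl Sum.inl_injective
  have hsp : ⊤ ≤ Submodule.span ℝ (Set.range fun i => (⟨B (Sum.inl i), hmem i⟩ : U)) := by
    rintro ⟨x, hx⟩ -
    have e : (Submodule.span ℝ (Set.range fun i => (⟨B (Sum.inl i), hmem i⟩ : U))).map U.subtype =
        U := by
      rw [Submodule.map_span, ← Set.range_comp]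
      exact hU.symm
    obtain ⟨y, hy, hyx⟩ := e.ge hx
    exact (Subtype.ext hyx : y = ⟨x, hx⟩) ▸ hy
  let bU := Basis.mk hli hsp
  have hbU : ∀ i, (bU i : V) = B (Sum.inl i) := fun i => by simp [bU]
  refine ⟨⟨Submodule.span ℤ (Set.range bU), m, bU, rfl⟩, fun x => ⟨fun hx => ?_, fun hx => ?_⟩⟩
  · have := Submodule.apply_mem_span_image_of_mem_span (U.subtype.restrictScalars ℤ) hx
    rw [hB]
    refine Submodule.span_mono ?_ this
    rintro _ ⟨_, ⟨i, rfl⟩, rfl⟩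
    exact ⟨Sum.inl i, (hbU i).symm⟩
  · have hp : LatMap N ⟨Submodule.span ℤ (Set.range bU), m, bU, rfl⟩ (B.constr ℝ (Sum.elim bU 0)) := by
      refine latMap_of_basis hB fun i => ?_
      rw [Basis.constr_basis]
      rcases i with i | i
      · exact Submodule.subset_span ⟨i, rfl⟩
      · exact zero_mem _
    have e : B.constr ℝ (Sum.elim bU 0) ∘ₗ U.subtype = LinearMap.id := by
      refine bU.ext fun i => ?_
      simp [hbU]
    have := hp _ hx
    have e' := LinearMap.congr_fun e x
    simp only [LinearMap.comp_apply, Submodule.subtype_apply, LinearMap.id_apply] at e'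
    rwa [e'] at this

/-- An integral projection onto a rational subspace. -/
theorem IsRat.exists_retraction {U : Submodule ℝ V} (h : IsRat N U) :
    ∃ r : V →ₗ[ℝ] V, LatMap N N r ∧ (∀ v, r v ∈ U) ∧ ∀ u ∈ U, r u = u := by
  obtain ⟨m, k, B, hB, hU⟩ := h.exists_basis
  refine ⟨B.constr ℝ (Sum.elim (B ∘ Sum.inl) 0), latMap_of_basis hB fun i => ?_, fun v => ?_,
    fun u hu => ?_⟩
  · rw [Basis.constr_basis, hB]
    rcases i with i | i
    · exact Submodule.subset_span ⟨Sum.inl i, rfl⟩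
    · exact zero_mem _
  · have hv : v ∈ Submodule.span ℝ (Set.range B) := B.span_eq ▸ Submodule.mem_top
    have := Submodule.apply_mem_span_image_of_mem_span (B.constr ℝ (Sum.elim (B ∘ Sum.inl) 0)) hv
    refine Submodule.span_le.2 ?_ this
    rintro _ ⟨_, ⟨i, rfl⟩, rfl⟩
    rw [Basis.constr_basis]
    rcases i with i | i
    · rw [hU]; exact Submodule.subset_span ⟨i, rfl⟩
    · exact zero_mem _
  · rw [hU] at hu
    induction hu using Submodule.span_induction with
    | mem x h =>
      obtain ⟨i, rfl⟩ := h
      simp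
    | zero => simp
    | add x y _ _ h h' => rw [map_add, h, h']
    | smul c x _ h => rw [map_smul, h]

/-- A lattice point generating the lattice of `K` over that of a rational hyperplane `L ⊂ K`. -/
theorem IsRat.exists_generator {L K : Submodule ℝ V} (hL : IsRat N L) (hK : IsRat N K) (hLK : L ≤ K)
    (hd : finrank ℝ L + 1 = finrank ℝ K) :
    ∃ n ∈ N.carrier, n ∈ K ∧ n ∉ L ∧ (∀ x ∈ K, ∃ c : ℝ, x - c • n ∈ L) ∧
      ∀ x ∈ N.carrier, x ∈ K → ∃ k : ℤ, x - (k : ℝ) • n ∈ L := by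
  have := N.finite
  obtain ⟨r, hr, hrL, hrid⟩ := hL.exists_retraction
  have hne : ¬ K ≤ L := fun h => by
    have := Submodule.finrank_mono h
    omega
  obtain ⟨v, hvK, hvN, hvL⟩ : ∃ v ∈ K, v ∈ N.carrier ∧ v ∉ L := by
    by_contra hcon
    push Not at hcon
    exact hne (hK.trans (Submodule.span_le.2 fun x hx => hcon x hx.1 hx.2))
  have hKsup : ∀ x ∈ K, ∃ c : ℝ, x - c • v ∈ L := by
    have h1 : L ⊔ Submodule.span ℝ {v} = K := by
      refine Submodule.eq_of_le_of_finrank_le (sup_le hLK (by simpa using hvK)) ?_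
      rw [← hd]
      refine Submodule.finrank_lt_finrank_of_lt (lt_of_le_of_ne le_sup_left fun h => hvL ?_)
      rw [h]
      exact Submodule.mem_sup_right (Submodule.mem_span_singleton_self v)
    intro x hx
    rw [← h1, Submodule.mem_sup] at hx
    obtain ⟨l, hl, z, hz, rfl⟩ := hx
    obtain ⟨c, rfl⟩ := Submodule.mem_span_singleton.1 hz
    exact ⟨c, by simpa using hl⟩
  obtain ⟨A, hA, hA0⟩ := exists_coords N
  have hv0 : v - r v ≠ 0 := fun h => hvL (by rw [sub_eq_zero.1 h]; exact hrL v)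
  obtain ⟨f, hf, hfv⟩ : ∃ f ∈ A, f (v - r v) ≠ 0 := by
    by_contra hcon
    push Not at hcon
    exact hv0 (hA0 _ hcon)
  set g : V →ₗ[ℝ] ℝ := f ∘ₗ (LinearMap.id - r) with hg
  have hgN : LatMap N RealLattice.int g := (hA.2 f hf).comp (latMap_id.sub hr)
  have hgL : ∀ l ∈ L, g l = 0 := fun l hl => by simp [hg, hrid l hl]
  have hgv : g v ≠ 0 := by simpa [hg] using hfv
  have hgK : ∀ x ∈ K, g x = 0 → x ∈ L := fun x hx h0 => by
    obtain ⟨c, hc⟩ := hKsup x hx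
    have := hgL _ hc
    rw [map_sub, h0, map_smul, zero_sub, neg_eq_zero, smul_eq_mul, mul_eq_zero] at this
    rcases this with h | h
    · simpa [h] using hc
    · exact absurd h hgv
  let I : AddSubgroup ℤ :=
    { carrier := {k | ∃ x ∈ N.carrier, x ∈ K ∧ g x = k}
      zero_mem' := ⟨0, zero_mem _, zero_mem _, by simp⟩
      add_mem' := by
        rintro a b ⟨x, hx, hxK, hxa⟩ ⟨y, hy, hyK, hyb⟩
        exact ⟨x + y, add_mem hx hy, add_mem hxK hyK, by rw [map_add, hxa, hyb]; push_cast; rfl⟩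
      neg_mem' := by
        rintro a ⟨x, hx, hxK, hxa⟩
        exact ⟨-x, neg_mem hx, neg_mem hxK, by rw [map_neg, hxa]; push_cast; rfl⟩ }
  obtain ⟨a, ha⟩ := Int.subgroup_cyclic I
  obtain ⟨n, hnN, hnK, hna⟩ : a ∈ I := by rw [ha]; exact AddSubgroup.mem_closure_singleton_self a
  have hmul : ∀ x ∈ N.carrier, x ∈ K → ∃ k : ℤ, g x = k * g n := by
    intro x hx hxK
    obtain ⟨b, hb⟩ := RealLattice.mem_int.1 (hgN x hx)
    have hbI : b ∈ I := ⟨x, hx, hxK, hb.symm⟩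
    rw [ha, AddSubgroup.mem_closure_singleton] at hbI
    obtain ⟨k, hk⟩ := hbI
    refine ⟨k, ?_⟩
    rw [← hb, hna, ← hk]
    simp
  have hgn : g n ≠ 0 := by
    obtain ⟨k, hk⟩ := hmul v hvN hvK
    intro h0
    rw [h0, mul_zero] at hk
    exact hgv hk
  refine ⟨n, hnN, hnK, fun h => hgn (hgL n h), fun x hx => ⟨g x / g n, ?_⟩, fun x hx hxK => ?_⟩
  · refine hgK _ (sub_mem hx (K.smul_mem _ hnK)) ?_
    rw [map_sub, map_smul, smul_eq_mul, div_mul_cancel₀ _ hgn, sub_self]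
  · obtain ⟨k, hk⟩ := hmul x hx hxK
    refine ⟨k, hgK _ (sub_mem hxK (K.smul_mem _ hnK)) ?_⟩
    rw [map_sub, map_smul, hk, smul_eq_mul, sub_self]

/-! Rational cones: generators and inequalities. -/

/-- A cone generated by finitely many lattice points. -/
def IsRatCone (N : RealLattice V) (σ : PointedCone ℝ V) : Prop :=
  ∃ S : Finset V, (∀ x ∈ S, x ∈ N.carrier) ∧ σ = PointedCone.hull ℝ (S : Set V)

theorem mem_hull_insert {S : Set V} {v x : V} :
    x ∈ PointedCone.hull ℝ (insert v S) ↔ ∃ t : ℝ, 0 ≤ t ∧ x - t • v ∈ PointedCone.hull ℝ S := by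
  unfold PointedCone.hull
  rw [Submodule.mem_span_insert]
  constructor
  · rintro ⟨a, z, hz, rfl⟩
    refine ⟨a, a.2, ?_⟩
    have e : (a • v : V) = (a : ℝ) • v := rfl
    rw [e, add_sub_cancel_left]
    exact hz
  · rintro ⟨t, ht, h⟩
    refine ⟨⟨t, ht⟩, _, h, ?_⟩
    have e : ((⟨t, ht⟩ : {c : ℝ // 0 ≤ c}) • v : V) = t • v := rfl
    rw [e, add_sub_cancel]

/-- Fourier–Motzkin elimination: a rational cone is cut out by finitely many integral
inequalities. -/
theorem IsRatCone.exists_inequalities {σ : PointedCone ℝ V} (h : IsRatCone N σ) :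
    ∃ A, IsRatArr N A ∧ ∀ x, x ∈ σ ↔ ∀ f ∈ A, 0 ≤ f x := by
  classical
  obtain ⟨S, hS, rfl⟩ := h
  induction S using Finset.induction_on with
  | empty =>
    obtain ⟨A, hA, hA0⟩ := exists_coords N
    refine ⟨A ∪ Neg.neg '' A, hA.union ⟨hA.1.image _, ?_⟩, fun x => ?_⟩
    · rintro _ ⟨f, hf, rfl⟩
      exact (hA.2 f hf).neg
    · simp only [Finset.coe_empty, PointedCone.hull, Submodule.span_empty, Submodule.mem_bot]
      constructor
      · rintro rfl f -
        simp
      · intro h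
        refine hA0 x fun f hf => le_antisymm ?_ (h f (Or.inl hf))
        simpa using h (-f) (Or.inr ⟨f, hf, rfl⟩)
  | insert v S hvS ih =>
    obtain ⟨A, hA, hA'⟩ := ih fun x hx => hS x (Finset.mem_insert_of_mem hx)
    have hv := hS v (Finset.mem_insert_self _ _)
    refine ⟨{f ∈ A | 0 ≤ f v} ∪ (fun p : (V →ₗ[ℝ] ℝ) × (V →ₗ[ℝ] ℝ) => p.1 v • p.2 - p.2 v • p.1) ''
      ({f ∈ A | 0 ≤ f v} ×ˢ {g ∈ A | g v ≤ 0}), ⟨?_, ?_⟩, fun x => ?_⟩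
    · exact (hA.1.sep _).union (((hA.1.sep _).prod (hA.1.sep _)).image _)
    · rintro f (hf | ⟨⟨f, g⟩, ⟨hf, hg⟩, rfl⟩)
      · exact hA.2 f hf.1
      · exact ((hA.2 g hg.1).smul (hA.2 f hf.1 v hv)).sub ((hA.2 f hf.1).smul (hA.2 g hg.1 v hv))
    · rw [Finset.coe_insert, mem_hull_insert]
      constructor
      · rintro ⟨t, ht, hx⟩
        have hx' := (hA' _).1 hx
        rintro f (hf | ⟨⟨f, g⟩, ⟨hf, hg⟩, rfl⟩)
        · have h1 := hx' f hf.1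
          rw [map_sub, map_smul, smul_eq_mul] at h1
          have := mul_nonneg ht hf.2
          linarith
        · have h1 := hx' f hf.1
          have h2 := hx' g hg.1
          rw [map_sub, map_smul, smul_eq_mul] at h1 h2
          simp only [LinearMap.sub_apply, LinearMap.smul_apply, smul_eq_mul]
          have h3 := mul_nonneg hf.2 h2
          have h4 := mul_nonneg (neg_nonneg.2 hg.2) h1
          linarith
      · intro h
        have key : ∃ t : ℝ, 0 ≤ t ∧ (∀ g ∈ A, g v < 0 → g x / g v ≤ t) ∧
            (t = 0 ∨ ∃ g ∈ A, g v < 0 ∧ t = g x / g v) := by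
          rcases ({g ∈ A | g v < 0} : Set _).eq_empty_or_nonempty with he | hne
          · refine ⟨0, le_rfl, fun g hg hg' => ?_, Or.inl rfl⟩
            exact absurd (show g ∈ {g ∈ A | g v < 0} from ⟨hg, hg'⟩) (he ▸ Set.notMem_empty _)
          · obtain ⟨g, hg, hmax⟩ := Set.exists_max_image _ (fun g : V →ₗ[ℝ] ℝ => g x / g v)
              (hA.1.sep _) hne
            rcases le_total 0 (g x / g v) with h0 | h0
            · exact ⟨_, h0, fun g' h1 h2 => hmax g' ⟨h1, h2⟩, Or.inr ⟨g, hg.1, hg.2, rfl⟩⟩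
            · exact ⟨0, le_rfl, fun g' h1 h2 => (hmax g' ⟨h1, h2⟩).trans h0, Or.inl rfl⟩
        obtain ⟨t, ht, hlow, hcase⟩ := key
        refine ⟨t, ht, (hA' _).2 fun f hf => ?_⟩
        rw [map_sub, map_smul, smul_eq_mul]
        rcases lt_or_ge (f v) 0 with hneg | hpos
        · have := hlow f hf hneg
          rw [div_le_iff_of_neg hneg] at this
          linarith
        · have h1 := h f (Or.inl ⟨hf, hpos⟩)
          rcases hcase with rfl | ⟨g, hg, hgv, rfl⟩
          · linarith
          · have h2 := h _ (Or.inr ⟨(f, g), ⟨⟨hf, hpos⟩, ⟨hg, hgv.le⟩⟩, rfl⟩)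
            simp only [LinearMap.sub_apply, LinearMap.smul_apply, smul_eq_mul] at h2
            have h3 : g x / g v * f v ≤ f x := by
              rw [div_mul_eq_mul_div, div_le_iff_of_neg hgv]
              linarith
            linarith

/-- The dual lattice. -/
theorem exists_dualLattice (N : RealLattice V) :
    ∃ D : RealLattice (V →ₗ[ℝ] ℝ), (∀ f, f ∈ D.carrier ↔ LatMap N RealLattice.int f) ∧
      ∀ F : (V →ₗ[ℝ] ℝ) →ₗ[ℝ] ℝ, LatMap D RealLattice.int F →
        ∃ x ∈ N.carrier, ∀ f, F f = f x := by
  classical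
  obtain ⟨n, b, hb⟩ := N.exists_basis
  have hco : ∀ i, LatMap N RealLattice.int (b.coord i) := fun i => by
    refine latMap_of_basis hb fun j => ?_
    rw [RealLattice.mem_int]
    refine ⟨if j = i then 1 else 0, ?_⟩
    rw [Basis.coord_apply, Basis.repr_self, Finsupp.single_apply]
    split <;> simp
  have hexp : ∀ f : V →ₗ[ℝ] ℝ, f = ∑ i, f (b i) • b.coord i := fun f => by
    refine b.ext fun j => ?_
    simp
  refine ⟨⟨Submodule.span ℤ (Set.range b.dualBasis), n, b.dualBasis, rfl⟩, fun f => ⟨fun hf => ?_, fun hf => ?_⟩, fun F hF => ?_⟩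
  · intro x hx
    induction hf using Submodule.span_induction with
    | mem f h =>
      obtain ⟨i, rfl⟩ := h
      rw [Basis.coe_dualBasis]
      exact hco i x hx
    | zero => exact zero_mem _
    | add f g _ _ h h' => exact add_mem h h'
    | smul k f _ h => exact Submodule.smul_mem _ k h
  · change f ∈ Submodule.span ℤ (Set.range b.dualBasis)
    rw [hexp f]
    refine Submodule.sum_mem _ fun i _ => ?_
    obtain ⟨k, hk⟩ := RealLattice.mem_int.1 (hf (b i) (hb ▸ Submodule.subset_span ⟨i, rfl⟩))
    have e : (k : ℝ) • b.coord i = k • b.coord i := by ext v; simp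
    rw [← hk, e]
    refine Submodule.smul_mem _ k (Submodule.subset_span ⟨i, ?_⟩)
    rw [Basis.coe_dualBasis]
  · refine ⟨∑ i, F (b.coord i) • b i, ?_, fun f => ?_⟩
    · refine sum_mem fun i _ => RealLattice.smul_mem_of_mem_int ?_ ?_
      · rw [hb]; exact Submodule.subset_span ⟨i, rfl⟩
      · refine hF _ (Submodule.subset_span ⟨i, ?_⟩)
        rw [Basis.coe_dualBasis]
    · conv_lhs => rw [hexp f]
      simp only [map_sum, map_smul, smul_eq_mul]
      exact Finset.sum_congr rfl fun i _ => mul_comm _ _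

/-- A cone cut out by finitely many integral inequalities is generated by lattice points. -/
theorem isRatCone_of_inequalities {σ : PointedCone ℝ V} {A : Set (V →ₗ[ℝ] ℝ)} (hA : IsRatArr N A)
    (hσ : ∀ x, x ∈ σ ↔ ∀ f ∈ A, 0 ≤ f x) : IsRatCone N σ := by
  classical
  obtain ⟨D, hD, hDN⟩ := exists_dualLattice N
  have hC : IsRatCone D (PointedCone.hull ℝ A) :=
    ⟨hA.1.toFinset, fun f hf => (hD f).2 (hA.2 f (by simpa using hf)), by simp⟩
  obtain ⟨E, hE, hE'⟩ := hC.exists_inequalities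
  choose! pt hptN hpt using fun F (hF : F ∈ E) => hDN F (hE.2 F hF)
  refine ⟨(hE.1.image pt).toFinset, fun x hx => ?_, le_antisymm (fun y hy => ?_) ?_⟩
  · obtain ⟨F, hF, rfl⟩ : x ∈ pt '' E := by simpa using hx
    exact hptN F hF
  · have hR : IsRatCone N (PointedCone.hull ℝ (pt '' E)) :=
      ⟨(hE.1.image pt).toFinset, fun x hx => by
        obtain ⟨F, hF, rfl⟩ : x ∈ pt '' E := by simpa using hx
        exact hptN F hF, by simp⟩
    obtain ⟨G, hG, hG'⟩ := hR.exists_inequalities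
    rw [Set.Finite.coe_toFinset, hG']
    intro g hg
    have hgA : g ∈ PointedCone.hull ℝ A := by
      rw [hE']
      intro F hF
      rw [hpt F hF]
      exact (hG' _).1 (Submodule.subset_span ⟨F, hF, rfl⟩) g hg
    clear hg
    induction hgA using Submodule.span_induction with
    | mem f h => exact (hσ y).1 hy f h
    | zero => simp
    | add f g _ _ h h' => exact add_nonneg h h'
    | smul c f _ h => exact mul_nonneg c.2 h
  · rw [Set.Finite.coe_toFinset]
    refine Submodule.span_le.2 ?_
    rintro _ ⟨F, hF, rfl⟩
    refine (hσ _).2 fun f hf => ?_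
    rw [← hpt F hF]
    exact (hE' f).1 (Submodule.subset_span hf) F hF

theorem isRatCone_cell {A : Set (V →ₗ[ℝ] ℝ)} (hA : IsRatArr N A) (x : V) : IsRatCone N (cell A x) := by
  refine isRatCone_of_inequalities (A := {f ∈ A | 0 ≤ f x} ∪ Neg.neg '' {f ∈ A | f x ≤ 0})
    ⟨(hA.1.sep _).union ((hA.1.sep _).image _), ?_⟩ fun y => ?_
  · rintro f (hf | ⟨f, hf, rfl⟩)
    · exact hA.2 f hf.1
    · exact (hA.2 f hf.1).neg
  · constructor
    · rintro h f (hf | ⟨f, hf, rfl⟩)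
      · exact (h f hf.1).1 hf.2
      · simpa using (h f hf.1).2 hf.2
    · intro h f hf
      refine ⟨fun h0 => h f (Or.inl ⟨hf, h0⟩), fun h0 => ?_⟩
      simpa using h (-f) (Or.inr ⟨f, ⟨hf, h0⟩, rfl⟩)

theorem IsRatCone.isRat_span {σ : PointedCone ℝ V} (h : IsRatCone N σ) :
    IsRat N (Submodule.span ℝ (σ : Set V)) := by
  obtain ⟨S, hS, rfl⟩ := h
  have e : Submodule.span ℝ ((PointedCone.hull ℝ (S : Set V) : PointedCone ℝ V) : Set V) =
      Submodule.span ℝ (S : Set V) := by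
    refine le_antisymm (Submodule.span_le.2 ?_) (Submodule.span_mono Submodule.subset_span)
    intro x hx
    exact Submodule.span_subset_span {c : ℝ // 0 ≤ c} ℝ _ hx
  rw [e]
  exact _root_.isRat_span hS

theorem isRat_cellSpan {A : Set (V →ₗ[ℝ] ℝ)} (hA : IsRatArr N A) (x : V) :
    IsRat N (cellSpan A x) := by
  rw [← span_cell hA.1]
  exact (isRatCone_cell hA x).isRat_span

theorem isRat_ker {f : V →ₗ[ℝ] ℝ} (hf : LatMap N RealLattice.int f) : IsRat N (LinearMap.ker f) := by
  have := isRat_cellSpan (N := N) (A := {f}) ⟨Set.finite_singleton _, by simpa using hf⟩ 0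
  have e : cellSpan {f} 0 = LinearMap.ker f := by
    ext v; simp [mem_cellSpan]
  rwa [e] at this

/-- A rational cone contains a lattice point in its relative interior. -/
theorem IsRatCone.exists_interior {σ : PointedCone ℝ V} (h : IsRatCone N σ) :
    ∃ p ∈ N.carrier, p ∈ coneRelInt σ := by
  classical
  obtain ⟨S, hS, rfl⟩ := h
  refine ⟨∑ s ∈ S, s, sum_mem hS, sum_mem fun s hs => Submodule.subset_span hs, fun y hy => ?_⟩
  induction hy using Submodule.span_induction with
  | mem y h =>
    refine ⟨1, one_pos, ?_⟩
    rw [one_smul, ← Finset.sum_erase_eq_sub h]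
    exact sum_mem fun s hs => Submodule.subset_span (Finset.mem_of_mem_erase hs)
  | zero => exact ⟨1, one_pos, by simpa using sum_mem fun s hs => Submodule.subset_span hs⟩
  | add x y _ _ hx hy =>
    obtain ⟨a, ha, hx⟩ := hx
    obtain ⟨b, hb, hy⟩ := hy
    refine ⟨a * b / (a + b), by positivity, ?_⟩
    have e : ∑ s ∈ S, s - (a * b / (a + b)) • (x + y) =
        (b / (a + b)) • (∑ s ∈ S, s - a • x) + (a / (a + b)) • (∑ s ∈ S, s - b • y) := by
      have : b / (a + b) + a / (a + b) = 1 := by field_simp; ring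
      have h2 : ∑ s ∈ S, s = (b / (a + b) + a / (a + b)) • ∑ s ∈ S, s := by rw [this, one_smul]
      conv_lhs => rw [h2]
      module
    rw [e]
    exact add_mem (PointedCone.smul_mem _ (by positivity) hx)
      (PointedCone.smul_mem _ (by positivity) hy)
  | smul c x _ hx =>
    obtain ⟨a, ha, hx⟩ := hx
    have e : ((c : {c : ℝ // 0 ≤ c}) • x : V) = (c : ℝ) • x := rfl
    rcases c.2.eq_or_lt with h0 | h0
    · refine ⟨1, one_pos, ?_⟩
      rw [e, ← h0]
      simpa using sum_mem fun s hs => Submodule.subset_span hs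
    · refine ⟨a / c, by positivity, ?_⟩
      rw [e, smul_smul, div_mul_cancel₀ _ h0.ne']
      exact hx

theorem coneRelInt_add_mem {σ : PointedCone ℝ V} {p v : V} (hp : p ∈ coneRelInt σ)
    (hv : v ∈ Submodule.span ℝ (σ : Set V)) : ∃ ε : ℝ, 0 < ε ∧ ∀ t, 0 ≤ t → t ≤ ε → p + t • v ∈ σ := by
  obtain ⟨a, ha, b, hb, rfl⟩ := TropicalFan.exists_sub_of_mem_span hv
  obtain ⟨ε, hε, h⟩ := hp.2 b hb
  refine ⟨ε, hε, fun t ht hte => ?_⟩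
  have e : p + t • (a - b) = t • a + ((t / ε) • (p - ε • b) + (1 - t / ε) • p) := by
    have : t = t / ε * ε := by field_simp
    conv_lhs => rw [smul_sub, this]
    conv_rhs => rw [this]
    match_scalars <;> field_simp <;> ring
  rw [e]
  refine add_mem (σ.smul_mem ht ha) (add_mem (σ.smul_mem (by positivity) h) (σ.smul_mem ?_ hp.1))
  rw [sub_nonneg, div_le_one hε]
  exact hte

theorem coneRelInt_eventually {σ : PointedCone ℝ V} {p v : V} (hp : p ∈ coneRelInt σ)
    (hv : v ∈ Submodule.span ℝ (σ : Set V)) : ∀ᶠ t : ℝ in 𝓝[>] 0, p + t • v ∈ σ := by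
  obtain ⟨ε, hε, h⟩ := coneRelInt_add_mem hp hv
  filter_upwards [eventually_pos, eventually_small ε hε] with t h1 h2
  exact h t h1.le h2.le

/-- The lattice of a rational cone consists of all lattice points of its span. -/
theorem IsRatCone.mem_coneLattice {σ : PointedCone ℝ V} (h : IsRatCone N σ) {x : V} :
    x ∈ coneLattice N σ ↔ x ∈ N.carrier ∧ x ∈ Submodule.span ℝ (σ : Set V) := by
  constructor
  · intro hx
    refine ⟨(Submodule.span_le.2 fun y hy => hy.2 : coneLattice N σ ≤ N.carrier) hx, ?_⟩
    exact Submodule.span_subset_span ℤ ℝ _ (Submodule.span_mono (R := ℤ)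
      (fun y (hy : y ∈ σ ∧ y ∈ N.carrier) => hy.1) hx)
  · intro hx'
    have hxN := hx'.1
    have hx := hx'.2
    obtain ⟨p, hpN, hp⟩ := h.exists_interior
    obtain ⟨ε, hε, h1⟩ := coneRelInt_add_mem hp hx
    obtain ⟨k, hk⟩ := exists_nat_gt (1 / ε)
    have hk0 : (0 : ℝ) < k := lt_trans (by positivity) hk
    have h2 := h1 (1 / k) (by positivity) (by
      rw [div_le_iff₀ hk0]; rw [div_lt_iff₀ hε] at hk; linarith)
    have h3 := σ.smul_mem hk0.le h2
    rw [smul_add, smul_smul, mul_one_div_cancel hk0.ne', one_smul, Nat.cast_smul_eq_nsmul] at h3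
    have h4 : (k • p + x) ∈ coneLattice N σ :=
      Submodule.subset_span ⟨h3, add_mem (nsmul_mem hpN k) hxN⟩
    have h5 : p ∈ coneLattice N σ := Submodule.subset_span ⟨hp.1, hpN⟩
    simpa using sub_mem h4 (nsmul_mem h5 k)

end Lattices

/-! ### Tropical sets: supports of reduced tropical fans, described without a fan structure -/

section TropicalSets

variable {V V' W : Type*} [AddCommGroup V] [Module ℝ V] [AddCommGroup V'] [Module ℝ V']
  [AddCommGroup W] [Module ℝ W]
variable {N : RealLattice V} {N' : RealLattice V'} {M : RealLattice W}

/-- The set `Z` is the union of the half-spaces `L + ℝ_≥0 n` for `n ∈ s`, each `n` being primitive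
modulo `L`. -/
structure IsNormals (N : RealLattice V) (L : Submodule ℝ V) (Z : Set V) (s : Finset V) : Prop where
  mem_lattice : ∀ n ∈ s, n ∈ N.carrier
  notMem : ∀ n ∈ s, n ∉ L
  primitive : ∀ n ∈ s, ∀ x ∈ N.carrier, ∀ c : ℝ, x - c • n ∈ L → ∃ k : ℤ, (k : ℝ) = c
  cover : ∀ z, z ∈ Z ↔ ∃ n ∈ s, ∃ c : ℝ, 0 ≤ c ∧ z - c • n ∈ L
  distinct : ∀ n ∈ s, ∀ m ∈ s, ∀ c : ℝ, 0 ≤ c → n - c • m ∈ L → n = m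

theorem IsNormals.mem {L : Submodule ℝ V} {Z : Set V} {s : Finset V} (h : IsNormals N L Z s) {n : V}
    (hn : n ∈ s) : n ∈ Z :=
  (h.cover n).2 ⟨n, hn, 1, zero_le_one, by simp⟩

theorem IsNormals.sum_sub_sum_mem {L : Submodule ℝ V} {Z : Set V} {s s' : Finset V}
    (h : IsNormals N L Z s) (h' : IsNormals N L Z s') : ∑ n ∈ s, n - ∑ n ∈ s', n ∈ L := by
  have key : ∀ {s s' : Finset V}, IsNormals N L Z s → IsNormals N L Z s' →
      ∀ n ∈ s, ∃ m ∈ s', n - m ∈ L := by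
    intro s s' h h' n hn
    obtain ⟨m, hm, c, hc, hcm⟩ := (h'.cover n).1 (h.mem hn)
    obtain ⟨n', hn', c', hc', hcn⟩ := (h.cover m).1 (h'.mem hm)
    have e1 : n - (c * c') • n' ∈ L := by
      have := add_mem hcm (L.smul_mem c hcn)
      have e : n - c • m + c • (m - c' • n') = n - (c * c') • n' := by module
      rwa [e] at this
    have := h.distinct n hn n' hn' _ (mul_nonneg hc hc') e1
    subst this
    have e2 : c * c' = 1 := by
      by_contra hne
      have e : n - (c * c') • n = (1 - c * c') • n := by module
      rw [e] at e1
      exact h.notMem n hn ((Submodule.smul_mem_iff _ (sub_ne_zero.2 (Ne.symm hne))).1 e1)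
    obtain ⟨k, rfl⟩ := h'.primitive m hm n (h.mem_lattice n hn) c hcm
    obtain ⟨l, rfl⟩ := h.primitive n hn m (h'.mem_lattice m hm) c' hcn
    have hk : k = 1 := by
      have e3 : k * l = 1 := by exact_mod_cast e2
      have hk0 : 0 ≤ k := by exact_mod_cast hc
      exact Int.eq_one_of_mul_eq_one_right hk0 e3
    subst hk
    exact ⟨m, hm, by simpa using hcm⟩
  choose! g hg hgL using key h h'
  have hinj : Set.InjOn g s := by
    intro a ha b hb hab
    refine h.distinct a ha b hb 1 zero_le_one ?_
    have := sub_mem (hgL a ha) (hgL b hb)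
    rw [hab] at this
    simpa using this
  have hsum : ∑ n ∈ s', n = ∑ n ∈ s, g n := by
    refine (Finset.sum_bij (fun a _ => g a) (fun a ha => hg a ha) (fun a ha b hb hab => hinj ha hb hab)
      (fun b hb => ?_) (fun a _ => rfl)).symm
    obtain ⟨a, ha, hba⟩ := key h' h b hb
    refine ⟨a, ha, (h'.distinct b hb (g a) (hg a ha) 1 zero_le_one ?_).symm⟩
    simpa using add_mem hba (hgL a ha)
  rw [hsum, ← Finset.sum_sub_distrib]
  exact sum_mem fun n hn => hgL n hn

/-- A rational hyperplane in a rational subspace has two opposite normals. -/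
theorem exists_normals_of_hyperplane {L K : Submodule ℝ V} (hL : IsRat N L) (hK : IsRat N K)
    (hLK : L ≤ K) (hd : finrank ℝ L + 1 = finrank ℝ K) :
    ∃ s, IsNormals N L (K : Set V) s ∧ ∑ n ∈ s, n ∈ L := by
  classical
  obtain ⟨n, hnN, hnK, hnL, hspan, hprim⟩ := hL.exists_generator hK hLK hd
  have hmul : ∀ c : ℝ, c • n ∈ L → c = 0 := fun c hc => by
    by_contra h0
    exact hnL ((Submodule.smul_mem_iff _ h0).1 hc)
  have hne : n ≠ -n := fun h => by
    have h2 : (2 : ℝ) • n = 0 := by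
      rw [two_smul]; nth_rewrite 1 [h]; exact neg_add_cancel n
    have : n = 0 := by simpa using h2
    exact hnL (this ▸ zero_mem L)
  have hp1 : ∀ x ∈ N.carrier, ∀ c : ℝ, x - c • n ∈ L → ∃ k : ℤ, (k : ℝ) = c := by
    intro x hx c hc
    have hxK : x ∈ K := by
      have := add_mem (hLK hc) (K.smul_mem c hnK)
      simpa using this
    obtain ⟨k, hk⟩ := hprim x hx hxK
    refine ⟨k, ?_⟩
    have := sub_mem hc hk
    have e : x - c • n - (x - (k : ℝ) • n) = ((k : ℝ) - c) • n := by module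
    rw [e] at this
    exact sub_eq_zero.1 (hmul _ this)
  refine ⟨{n, -n}, ⟨?_, ?_, ?_, ?_, ?_⟩, ?_⟩
  · simp only [Finset.mem_insert, Finset.mem_singleton]
    rintro m (rfl | rfl)
    · exact hnN
    · exact neg_mem hnN
  · simp only [Finset.mem_insert, Finset.mem_singleton]
    rintro m (rfl | rfl)
    · exact hnL
    · simpa using hnL
  · simp only [Finset.mem_insert, Finset.mem_singleton]
    rintro m (rfl | rfl) x hx c hc
    · exact hp1 x hx c hc
    · obtain ⟨k, hk⟩ := hp1 x hx (-c) (by simpa using hc)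
      exact ⟨-k, by push_cast; linarith⟩
  · intro z
    simp only [Finset.mem_insert, Finset.mem_singleton, SetLike.mem_coe]
    constructor
    · intro hz
      obtain ⟨c, hc⟩ := hspan z hz
      rcases le_total 0 c with h0 | h0
      · exact ⟨n, Or.inl rfl, c, h0, hc⟩
      · exact ⟨-n, Or.inr rfl, -c, neg_nonneg.2 h0, by simpa using hc⟩
    · rintro ⟨m, hm, c, -, h⟩
      have hmK : m ∈ K := by
        rcases hm with rfl | rfl
        · exact hnK
        · exact neg_mem hnK
      simpa using add_mem (hLK h) (K.smul_mem c hmK)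
  · simp only [Finset.mem_insert, Finset.mem_singleton]
    rintro a (rfl | rfl) b (rfl | rfl) c hc h
    · rfl
    · have e : a - c • -a = (1 + c) • a := by module
      rw [e] at h
      have := hmul _ h
      linarith
    · have e : -b - c • b = (-(1 + c)) • b := by module
      rw [e] at h
      have := hmul _ h
      linarith
    · rfl
  · rw [Finset.sum_pair hne, add_neg_cancel]
    exact zero_mem L

/-- `X` is pure of dimension `d`. -/
def IsPureSet (d : ℕ) (X : Set V) : Prop :=
  ∀ x ∈ X, ∃ v ∈ localStar X x, ∃ U : Submodule ℝ V, finrank ℝ U = d ∧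
    localStar (localStar X x) v = U

/-- The balancing condition, with all weights equal to one. -/
def IsBalanced (N : RealLattice V) (d : ℕ) (X : Set V) : Prop :=
  ∀ x ∈ X, ∀ L : Submodule ℝ V, IsRat N L → finrank ℝ L + 1 = d → Invariant (localStar X x) L →
    ∃ s, IsNormals N L (localStar X x) s ∧ ∑ n ∈ s, n ∈ L

/-- The set `X` is a nonempty rational polyhedral fan set, pure of dimension `d`, balanced with
weights one. -/
structure IsTropSet (N : RealLattice V) (d : ℕ) (X : Set V) : Prop where
  nonempty : X.Nonempty
  poly : ∃ A, IsRatArr N A ∧ IsCellular A X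
  pure : IsPureSet d X
  balanced : IsBalanced N d X

theorem IsTropSet.zero_mem {d : ℕ} {X : Set V} (h : IsTropSet N d X) : (0 : V) ∈ X := by
  obtain ⟨A, -, hX⟩ := h.poly
  exact hX.zero_mem_of_nonempty h.nonempty

section Criterion

variable {A : Set (V →ₗ[ℝ] ℝ)} {X : Set V} {d : ℕ} {x : V}

theorem IsPureSet.finrank_cellSpan_le (N : RealLattice V) (hA : A.Finite) (hX : IsCellular A X)
    (h : IsPureSet d X) (hx : x ∈ X) : finrank ℝ (cellSpan A x) ≤ d := by
  have := N.finite
  obtain ⟨v, hv, U, hU, hvU⟩ := h x hx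
  rw [← hU]
  refine Submodule.finrank_mono ?_
  have h1 : Invariant (U : Set V) (cellSpan A x) := hvU ▸ (localStar_invariant hA hX x).star v
  exact h1.subset (zero_mem U)

theorem localStar_eq_cellSpan (N : RealLattice V) (hA : A.Finite) (hX : IsCellular A X)
    (hle : ∀ x ∈ X, finrank ℝ (cellSpan A x) ≤ d) (hx : x ∈ X)
    (hd : finrank ℝ (cellSpan A x) = d) : localStar X x = cellSpan A x := by
  have := N.finite
  refine Set.Subset.antisymm (fun v hv => ?_)
    ((localStar_invariant hA hX x).subset (zero_mem_localStar hx))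
  obtain ⟨t, h1, h2⟩ := ((mem_localStar.1 hv).and (eventually_signs hA x v)).exists
  have hle' : cellSpan A x ≤ cellSpan A (x + t • v) :=
    cellSpan_mono (mem_cell_of_lexSign h2)
  have heq := Submodule.eq_of_le_of_finrank_le hle' (by rw [hd]; exact hle _ h1)
  rw [SetLike.mem_coe, heq, mem_cellSpan]
  intro f hf h0
  have := h2 f hf
  unfold LexSign at this
  grind

theorem IsPureSet.exists_cell (hA : A.Finite) (hX : IsCellular A X)
    (h : IsPureSet d X) (hx : x ∈ X) :
    ∃ z ∈ X, x ∈ cell A z ∧ finrank ℝ (cellSpan A z) = d := by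
  obtain ⟨v, hv, U, hU, hvU⟩ := h x hx
  obtain ⟨t, ⟨h1, h2⟩, h3⟩ := (((mem_localStar.1 hv).and (eventually_signs hA x v)).and
    (eventually_localStar_localStar hA hX x v)).exists
  set z0 := x + t • v with hz0
  obtain ⟨u, huU, hu⟩ := exists_generic hA U
  have hstar : localStar X z0 = U := by rw [← h3, hvU]
  obtain ⟨r, ⟨g1, g2⟩, g3⟩ := (((mem_localStar.1 (show u ∈ localStar X z0 by rw [hstar]; exact huU)).and
    (eventually_signs hA z0 u)).and (eventually_localStar_localStar hA hX z0 u)).exists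
  refine ⟨z0 + r • u, g1, cell_trans (mem_cell_of_lexSign g2) (mem_cell_of_lexSign h2), ?_⟩
  have e : localStar X (z0 + r • u) = U := by rw [← g3, hstar, localStar_subspace U huU]
  have heq : cellSpan A (z0 + r • u) = U := by
    refine le_antisymm ?_ ?_
    · have := (localStar_invariant hA hX (z0 + r • u)).subset (zero_mem_localStar g1)
      rw [e] at this
      exact this
    · intro w hw f hf h0
      refine hu f hf ?_ w hw
      have := g2 f hf
      rw [h0] at this
      unfold LexSign at this
      grind
  rw [heq, hU]

/-- To check that a set is tropical it suffices to consider the cells of one arrangement. -/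
theorem isTropSet_of_cells (hA : IsRatArr N A) (hX : IsCellular A X) (hne : X.Nonempty)
    (hp : ∀ x ∈ X, ∃ z ∈ X, x ∈ cell A z ∧ finrank ℝ (cellSpan A z) = d)
    (hle : ∀ x ∈ X, finrank ℝ (cellSpan A x) ≤ d)
    (hb : ∀ x ∈ X, finrank ℝ (cellSpan A x) + 1 = d →
      ∃ s, IsNormals N (cellSpan A x) (localStar X x) s ∧ ∑ n ∈ s, n ∈ cellSpan A x) :
    IsTropSet N d X := by
  have := N.finite
  refine ⟨hne, ⟨A, hA, hX⟩, fun x hx => ?_, fun x hx L hL hd hinv => ?_⟩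
  · obtain ⟨z, hz, hxz, hd⟩ := hp x hx
    exact ⟨z - x, sub_mem_localStar hA.1 hX hz hxz, cellSpan A z, hd, by
      rw [localStar_localStar_sub hA.1 hX hxz, localStar_eq_cellSpan N hA.1 hX hle hz hd]⟩
  · obtain ⟨l, hl, hgen⟩ := exists_generic hA.1 L
    have hlX : l ∈ localStar X x := hinv.subset (zero_mem_localStar hx) hl
    obtain ⟨t, ⟨h1, h2⟩, h3⟩ := (((mem_localStar.1 hlX).and (eventually_signs hA.1 x l)).and
      (eventually_localStar_localStar hA.1 hX x l)).exists
    have e : localStar (localStar X x) l = localStar X x := by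
      have := hinv.localStar_eq hl 0
      rwa [zero_add, localStar_zero hA.1 (hX.star hA.1 x)] at this
    rw [e] at h3
    rw [h3]
    have hLle : L ≤ cellSpan A (x + t • l) := fun w hw f hf h0 => by
      refine hgen f hf ?_ w hw
      have := h2 f hf
      rw [h0] at this
      unfold LexSign at this
      grind
    rcases (hle _ h1).eq_or_lt with heq | hlt
    · rw [localStar_eq_cellSpan N hA.1 hX hle h1 heq]
      exact exists_normals_of_hyperplane hL (isRat_cellSpan hA _) hLle (by rw [hd, heq])
    · have heq : L = cellSpan A (x + t • l) :=
        Submodule.eq_of_le_of_finrank_le hLle (by omega)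
      rw [heq] at hd ⊢
      exact hb _ h1 hd

theorem IsTropSet.star (h : IsTropSet N d X) (hx : x ∈ X) : IsTropSet N d (localStar X x) := by
  obtain ⟨A, hA, hX⟩ := h.poly
  refine ⟨⟨0, zero_mem_localStar hx⟩, ⟨A, hA, hX.star hA.1 x⟩, fun v hv => ?_,
    fun v hv L hL hd hinv => ?_⟩
  · obtain ⟨t, h1, h2⟩ :=
      ((mem_localStar.1 hv).and (eventually_localStar_localStar hA.1 hX x v)).exists
    rw [h2]
    exact h.pure _ h1
  · obtain ⟨t, h1, h2⟩ :=
      ((mem_localStar.1 hv).and (eventually_localStar_localStar hA.1 hX x v)).exists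
    rw [h2] at hinv ⊢
    exact h.balanced _ h1 L hL hd hinv

end Criterion

/-! Isomorphisms of sets. -/

/-- Mutually inverse integral maps between two sets, defined on the ambient spaces. -/
structure IsSetIso (N : RealLattice V) (X : Set V) (N' : RealLattice V') (X' : Set V')
    (p : V →ₗ[ℝ] V') (q : V' →ₗ[ℝ] V) : Prop where
  lat : LatMap N N' p
  lat_symm : LatMap N' N q
  mem : ∀ x ∈ X, p x ∈ X'
  mem_symm : ∀ x ∈ X', q x ∈ X
  left_inv : ∀ x ∈ X, q (p x) = x
  right_inv : ∀ x ∈ X', p (q x) = x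

/-- Isomorphism of sets by integral linear maps. -/
def SetIso (N : RealLattice V) (X : Set V) (N' : RealLattice V') (X' : Set V') : Prop :=
  ∃ p q, IsSetIso N X N' X' p q

section Iso

variable {X : Set V} {X' : Set V'} {p : V →ₗ[ℝ] V'} {q : V' →ₗ[ℝ] V} {d : ℕ} {x : V}

theorem IsSetIso.symm (h : IsSetIso N X N' X' p q) : IsSetIso N' X' N X q p :=
  ⟨h.lat_symm, h.lat, h.mem_symm, h.mem, h.right_inv, h.left_inv⟩

theorem IsSetIso.trans {X'' : Set W} {p' : V' →ₗ[ℝ] W} {q' : W →ₗ[ℝ] V'}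
    (h : IsSetIso N X N' X' p q) (h' : IsSetIso N' X' M X'' p' q') :
    IsSetIso N X M X'' (p' ∘ₗ p) (q ∘ₗ q') where
  lat := h'.lat.comp h.lat
  lat_symm := h.lat_symm.comp h'.lat_symm
  mem x hx := h'.mem _ (h.mem x hx)
  mem_symm x hx := h.mem_symm _ (h'.mem_symm x hx)
  left_inv x hx := by simp [h'.left_inv _ (h.mem x hx), h.left_inv x hx]
  right_inv x hx := by simp [h.right_inv _ (h'.mem_symm x hx), h'.right_inv x hx]

theorem SetIso.symm (h : SetIso N X N' X') : SetIso N' X' N X :=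
  let ⟨_, _, h⟩ := h
  ⟨_, _, h.symm⟩

theorem SetIso.trans {X'' : Set W} (h : SetIso N X N' X') (h' : SetIso N' X' M X'') :
    SetIso N X M X'' :=
  let ⟨_, _, h⟩ := h
  let ⟨_, _, h'⟩ := h'
  ⟨_, _, h.trans h'⟩

theorem SetIso.refl (N : RealLattice V) (X : Set V) : SetIso N X N X :=
  ⟨LinearMap.id, LinearMap.id, latMap_id, latMap_id, fun _ h => h, fun _ h => h, fun _ _ => rfl,
    fun _ _ => rfl⟩

theorem IsSetIso.mem_star (h : IsSetIso N X N' X' p q) {v : V} (hv : v ∈ localStar X x) :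
    p v ∈ localStar X' (p x) := by
  refine (mem_localStar.1 hv).mono fun t ht => ?_
  simpa using h.mem _ ht

theorem IsSetIso.left_inv_star (h : IsSetIso N X N' X' p q) (hx : x ∈ X) {v : V}
    (hv : v ∈ localStar X x) : q (p v) = v := by
  obtain ⟨t, h1, h2⟩ := ((mem_localStar.1 hv).and eventually_pos).exists
  have h3 := h.left_inv _ h1
  rw [map_add, map_add, h.left_inv x hx, map_smul, map_smul, add_right_inj] at h3
  exact smul_right_injective V h2.ne' h3

theorem IsSetIso.star (h : IsSetIso N X N' X' p q) (hx : x ∈ X) :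
    IsSetIso N (localStar X x) N' (localStar X' (p x)) p q where
  lat := h.lat
  lat_symm := h.lat_symm
  mem _ hv := h.mem_star hv
  mem_symm v hv := by
    have := h.symm.mem_star hv
    rwa [h.left_inv x hx] at this
  left_inv v hv := h.left_inv_star hx hv
  right_inv v hv := h.symm.left_inv_star (h.mem x hx) hv

theorem IsSetIso.exists_subspace {U : Submodule ℝ V} (h : IsSetIso N (U : Set V) N' X' p q) :
    finrank ℝ (U.map p) = finrank ℝ U ∧ X' = (U.map p : Submodule ℝ V') := by
  have := N.finite
  have := N'.finite
  have e : (U.map p).map q = U := by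
    ext x
    constructor
    · rintro ⟨_, ⟨y, hy, rfl⟩, rfl⟩
      rw [h.left_inv y hy]; exact hy
    · intro hx
      exact ⟨p x, ⟨x, hx, rfl⟩, h.left_inv x hx⟩
  refine ⟨le_antisymm (Submodule.finrank_map_le p U) ?_, ?_⟩
  · conv_lhs => rw [← e]
    exact Submodule.finrank_map_le q _
  · ext x
    constructor
    · intro hx
      exact ⟨q x, h.mem_symm x hx, h.right_inv x hx⟩
    · rintro ⟨y, hy, rfl⟩
      exact h.mem y hy

open Classical in
theorem IsNormals.map_iso {Z : Set V} {Z' : Set V'} {L : Submodule ℝ V} {s : Finset V}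
    (hs : IsNormals N L Z s) (h : IsSetIso N Z N' Z' p q) (hL : (L : Set V) ⊆ Z) :
    IsNormals N' (L.map p) Z' (s.image p) ∧ ∑ n ∈ s.image p, n = p (∑ n ∈ s, n) := by
  have hq : ∀ l ∈ L.map p, q l ∈ L ∧ p (q l) = l := by
    rintro _ ⟨l, hl, rfl⟩
    rw [h.left_inv l (hL hl)]
    exact ⟨hl, rfl⟩
  have hqp : ∀ n ∈ s, q (p n) = n := fun n hn => h.left_inv n (hs.mem hn)
  refine ⟨⟨?_, ?_, ?_, ?_, ?_⟩, ?_⟩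
  · simp only [Finset.mem_image]
    rintro _ ⟨n, hn, rfl⟩
    exact h.lat n (hs.mem_lattice n hn)
  · simp only [Finset.mem_image]
    rintro _ ⟨n, hn, rfl⟩ hc
    have := (hq _ hc).1
    rw [hqp n hn] at this
    exact hs.notMem n hn this
  · simp only [Finset.mem_image]
    rintro _ ⟨n, hn, rfl⟩ x hx c hc
    have := (hq _ hc).1
    rw [map_sub, map_smul, hqp n hn] at this
    exact hs.primitive n hn _ (h.lat_symm x hx) c this
  · intro z
    constructor
    · intro hz
      obtain ⟨n, hn, c, hc, h1⟩ := (hs.cover _).1 (h.mem_symm z hz)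
      refine ⟨p n, Finset.mem_image_of_mem p hn, c, hc, q z - c • n, h1, ?_⟩
      rw [map_sub, map_smul, h.right_inv z hz]
    · rintro ⟨m, hm, c, hc, h1⟩
      obtain ⟨n, hn, rfl⟩ := Finset.mem_image.1 hm
      obtain ⟨h2, h3⟩ := hq _ h1
      rw [map_sub, map_smul, hqp n hn] at h2 h3
      have h4 := h.mem _ ((hs.cover _).2 ⟨n, hn, c, hc, h2⟩)
      rw [map_sub, map_smul, sub_left_inj] at h3
      rwa [h3] at h4
  · simp only [Finset.mem_image]
    rintro _ ⟨n, hn, rfl⟩ _ ⟨m, hm, rfl⟩ c hc h1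
    have := (hq _ h1).1
    rw [map_sub, map_smul, hqp n hn, hqp m hm] at this
    rw [hs.distinct n hn m hm c hc this]
  · rw [Finset.sum_image, map_sum]
    intro a ha b hb hab
    rw [← hqp a ha, ← hqp b hb, hab]

theorem IsSetIso.isCellular (h : IsSetIso N X N' X' p q) {A : Set (V →ₗ[ℝ] ℝ)} (hA : IsRatArr N A)
    (hX : IsCellular A X) : ∃ A', IsRatArr N' A' ∧ IsCellular A' X' := by
  obtain ⟨C, hC, hC0⟩ := exists_coords N'
  refine ⟨_, (hA.comp h.lat_symm).union (hC.comp ((h.lat.comp h.lat_symm).sub latMap_id)), ?_⟩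
  intro x hx y hy
  have h1 : q y ∈ X := hX _ (h.mem_symm x hx) _
    ((cell_comp q A x y).1 (cell_anti Set.subset_union_left hy))
  have h2 : p (q y) - y = 0 := by
    refine hC0 _ fun f hf => ?_
    have := (cell_comp _ C x y).1 (cell_anti Set.subset_union_right hy)
    simpa [h.right_inv x hx] using eq_zero_of_mem_cell this hf (by simp [h.right_inv x hx])
  rw [sub_eq_zero] at h2
  rw [← h2]
  exact h.mem _ h1

theorem IsTropSet.of_iso (hX : IsTropSet N d X) (h : IsSetIso N X N' X' p q) : IsTropSet N' d X' := by
  classical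
  have := N.finite
  have := N'.finite
  obtain ⟨A, hA, hXA⟩ := hX.poly
  refine ⟨⟨p 0, h.mem _ hX.zero_mem⟩, h.isCellular hA hXA, fun x' hx' => ?_,
    fun x' hx' L' hL' hd hinv => ?_⟩
  · obtain ⟨v, hv, U, hU, hvU⟩ := hX.pure _ (h.mem_symm x' hx')
    have h1 := (h.star (h.mem_symm x' hx'))
    have h2 := h1.star hv
    rw [h.right_inv x' hx'] at h1 h2
    rw [hvU] at h2
    exact ⟨p v, h1.mem v hv, _, h2.exists_subspace.1.trans hU, h2.exists_subspace.2⟩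
  · have h1 := (h.star (h.mem_symm x' hx'))
    rw [h.right_inv x' hx'] at h1
    have hsub := hinv.subset (zero_mem_localStar hx')
    have e : (L'.map q).map p = L' := by
      ext y
      constructor
      · rintro ⟨_, ⟨z, hz, rfl⟩, rfl⟩
        rw [h1.right_inv z (hsub hz)]; exact hz
      · intro hy
        exact ⟨q y, ⟨y, hy, rfl⟩, h1.right_inv y (hsub hy)⟩
    have hdim : finrank ℝ (L'.map q) = finrank ℝ L' := by
      refine le_antisymm (Submodule.finrank_map_le q L') ?_
      conv_lhs => rw [← e]
      exact Submodule.finrank_map_le p _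
    have hinv' : Invariant (localStar X (q x')) (L'.map q) := by
      rintro z hz _ ⟨l, hl, rfl⟩
      have := h1.mem_symm _ (hinv _ (h1.mem z hz) l hl)
      rwa [map_add, h1.left_inv z hz] at this
    obtain ⟨s, hs, hsum⟩ := hX.balanced _ (h.mem_symm x' hx') (L'.map q) (hL'.map h.lat_symm)
      (by rw [hdim, hd]) hinv'
    obtain ⟨h2, h3⟩ := hs.map_iso h1 (hinv'.subset (zero_mem_localStar (h.mem_symm x' hx')))
    rw [e] at h2
    refine ⟨_, h2, ?_⟩
    rw [h3, ← e]
    exact Submodule.mem_map_of_mem hsum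

theorem IsTropSet.of_setIso (hX : IsTropSet N d X) (h : SetIso N X N' X') : IsTropSet N' d X' :=
  let ⟨_, _, h⟩ := h
  hX.of_iso h

end Iso

/-- A rational subspace is isomorphic to the full set of its own lattice. -/
theorem IsRat.setIso {U : Submodule ℝ V} (h : IsRat N U) :
    ∃ NU : RealLattice U, (∀ x : U, x ∈ NU.carrier ↔ (x : V) ∈ N.carrier) ∧
      SetIso N (U : Set V) NU Set.univ := by
  obtain ⟨NU, hNU⟩ := h.exists_lattice
  obtain ⟨r, hr, hrU, hru⟩ := h.exists_retraction
  refine ⟨NU, hNU, r.codRestrict U hrU, U.subtype, fun x hx => (hNU _).2 (hr x hx),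
    fun x hx => (hNU _).1 hx, fun _ _ => trivial, fun x _ => x.2, fun x hx => hru x hx,
    fun x _ => Subtype.ext (hru x x.2)⟩

theorem isTropSet_univ (N : RealLattice V) : IsTropSet N (finrank ℝ V) (Set.univ : Set V) := by
  refine isTropSet_of_cells isRatArr_empty isCellular_univ ⟨0, trivial⟩ (fun x _ => ⟨x, trivial, ?_, ?_⟩)
    (fun x _ => ?_) (fun x _ h => ?_)
  · exact self_mem_cell
  · have : cellSpan (∅ : Set (V →ₗ[ℝ] ℝ)) x = ⊤ := by ext; simp [mem_cellSpan]
    rw [this, finrank_top]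
  · have := N.finite
    exact Submodule.finrank_le _
  · have : cellSpan (∅ : Set (V →ₗ[ℝ] ℝ)) x = ⊤ := by ext; simp [mem_cellSpan]
    rw [this, finrank_top] at h
    omega

/-! Products. -/

section Prod

variable {A : Set (V →ₗ[ℝ] ℝ)} {B : Set (W →ₗ[ℝ] ℝ)}

/-- The product arrangement. -/
def prodArr (A : Set (V →ₗ[ℝ] ℝ)) (B : Set (W →ₗ[ℝ] ℝ)) : Set (V × W →ₗ[ℝ] ℝ) :=
  (fun f => f ∘ₗ LinearMap.fst ℝ V W) '' A ∪ (fun f => f ∘ₗ LinearMap.snd ℝ V W) '' B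

theorem IsRatArr.prod (hA : IsRatArr N A) (hB : IsRatArr M B) : IsRatArr (N.prod M) (prodArr A B) :=
  (hA.comp latMap_fst).union (hB.comp latMap_snd)

theorem mem_cell_prod {z w : V × W} :
    w ∈ cell (prodArr A B) z ↔ w.1 ∈ cell A z.1 ∧ w.2 ∈ cell B z.2 := by
  constructor
  · intro h
    exact ⟨(cell_comp _ A _ _).1 (cell_anti Set.subset_union_left h),
      (cell_comp _ B _ _).1 (cell_anti Set.subset_union_right h)⟩
  · rintro ⟨h1, h2⟩ _ (⟨f, hf, rfl⟩ | ⟨f, hf, rfl⟩)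
    · exact h1 f hf
    · exact h2 f hf

theorem cellSpan_prodArr (z : V × W) :
    cellSpan (prodArr A B) z = (cellSpan A z.1).prod (cellSpan B z.2) := by
  ext w
  constructor
  · intro h
    exact ⟨fun f hf h0 => h _ (Or.inl ⟨f, hf, rfl⟩) h0, fun f hf h0 => h _ (Or.inr ⟨f, hf, rfl⟩) h0⟩
  · rintro ⟨h1, h2⟩ _ (⟨f, hf, rfl⟩ | ⟨f, hf, rfl⟩) h0
    · exact h1 f hf h0
    · exact h2 f hf h0

theorem IsCellular.prod {X : Set V} {Y : Set W} (hX : IsCellular A X) (hY : IsCellular B Y) :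
    IsCellular (prodArr A B) (X ×ˢ Y) := fun _ hz _ hw =>
  ⟨hX _ hz.1 _ (mem_cell_prod.1 hw).1, hY _ hz.2 _ (mem_cell_prod.1 hw).2⟩

theorem finrank_prod_submodule (N : RealLattice V) (M : RealLattice W) (U : Submodule ℝ V)
    (U' : Submodule ℝ W) : finrank ℝ (U.prod U') = finrank ℝ U + finrank ℝ U' := by
  have := N.finite
  have := M.finite
  have h : U.prod U' = LinearMap.range (U.subtype.prodMap U'.subtype) := by
    rw [LinearMap.range_prodMap, Submodule.range_subtype, Submodule.range_subtype]
  rw [h, LinearMap.finrank_range_of_inj, Module.finrank_prod]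
  rw [LinearMap.coe_prodMap]
  exact Function.Injective.prodMap Subtype.val_injective Subtype.val_injective

open Classical in
theorem IsNormals.prod_left {L : Submodule ℝ V} {Z : Set V} {s : Finset V} (h : IsNormals N L Z s)
    (M : RealLattice W) (U : Submodule ℝ W) :
    IsNormals (N.prod M) (L.prod U) (Z ×ˢ (U : Set W)) (s.image fun n => (n, 0)) ∧
      (∑ n ∈ s, n ∈ L → ∑ n ∈ s.image (fun n => (n, (0 : W))), n ∈ L.prod U) := by
  refine ⟨⟨?_, ?_, ?_, ?_, ?_⟩, fun hsum => ?_⟩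
  · simp only [Finset.mem_image]
    rintro _ ⟨n, hn, rfl⟩
    exact ⟨h.mem_lattice n hn, zero_mem _⟩
  · simp only [Finset.mem_image]
    rintro _ ⟨n, hn, rfl⟩ hc
    exact h.notMem n hn hc.1
  · simp only [Finset.mem_image]
    rintro _ ⟨n, hn, rfl⟩ x hx c hc
    exact h.primitive n hn x.1 hx.1 c hc.1
  · rintro ⟨z, w⟩
    constructor
    · rintro ⟨hz, hw⟩
      obtain ⟨n, hn, c, hc, h1⟩ := (h.cover z).1 hz
      exact ⟨(n, 0), Finset.mem_image.2 ⟨n, hn, rfl⟩, c, hc, h1, by simpa using hw⟩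
    · rintro ⟨m, hm, c, hc, h1, h2⟩
      obtain ⟨n, hn, rfl⟩ := Finset.mem_image.1 hm
      exact ⟨(h.cover z).2 ⟨n, hn, c, hc, h1⟩, by simpa using h2⟩
  · simp only [Finset.mem_image]
    rintro _ ⟨n, hn, rfl⟩ _ ⟨m, hm, rfl⟩ c hc h1
    rw [h.distinct n hn m hm c hc h1.1]
  · rw [Finset.sum_image (fun a _ b _ hab => (Prod.ext_iff.1 hab).1)]
    refine ⟨?_, ?_⟩
    · rw [Prod.fst_sum]; exact hsum
    · rw [Prod.snd_sum]; simp

open Classical in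
theorem IsNormals.prod_right {L : Submodule ℝ W} {Z : Set W} {s : Finset W} (h : IsNormals M L Z s)
    (N : RealLattice V) (U : Submodule ℝ V) :
    IsNormals (N.prod M) (U.prod L) ((U : Set V) ×ˢ Z) (s.image fun n => (0, n)) ∧
      (∑ n ∈ s, n ∈ L → ∑ n ∈ s.image (fun n => ((0 : V), n)), n ∈ U.prod L) := by
  refine ⟨⟨?_, ?_, ?_, ?_, ?_⟩, fun hsum => ?_⟩
  · simp only [Finset.mem_image]
    rintro _ ⟨n, hn, rfl⟩
    exact ⟨zero_mem _, h.mem_lattice n hn⟩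
  · simp only [Finset.mem_image]
    rintro _ ⟨n, hn, rfl⟩ hc
    exact h.notMem n hn hc.2
  · simp only [Finset.mem_image]
    rintro _ ⟨n, hn, rfl⟩ x hx c hc
    exact h.primitive n hn x.2 hx.2 c hc.2
  · rintro ⟨z, w⟩
    constructor
    · rintro ⟨hz, hw⟩
      obtain ⟨n, hn, c, hc, h1⟩ := (h.cover w).1 hw
      exact ⟨(0, n), Finset.mem_image.2 ⟨n, hn, rfl⟩, c, hc, by simpa using hz, h1⟩
    · rintro ⟨m, hm, c, hc, h1, h2⟩
      obtain ⟨n, hn, rfl⟩ := Finset.mem_image.1 hm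
      exact ⟨by simpa using h1, (h.cover w).2 ⟨n, hn, c, hc, h2⟩⟩
  · simp only [Finset.mem_image]
    rintro _ ⟨n, hn, rfl⟩ _ ⟨m, hm, rfl⟩ c hc h1
    rw [h.distinct n hn m hm c hc h1.2]
  · rw [Finset.sum_image (fun a _ b _ hab => (Prod.ext_iff.1 hab).2)]
    refine ⟨?_, ?_⟩
    · rw [Prod.fst_sum]; simp
    · rw [Prod.snd_sum]; exact hsum

theorem IsTropSet.prod {X : Set V} {Y : Set W} {d e : ℕ} (hX : IsTropSet N d X)
    (hY : IsTropSet M e Y) : IsTropSet (N.prod M) (d + e) (X ×ˢ Y) := by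
  obtain ⟨A, hA, hXA⟩ := hX.poly
  obtain ⟨B, hB, hYB⟩ := hY.poly
  have hdX := fun x hx => hX.pure.finrank_cellSpan_le N hA.1 hXA (x := x) hx
  have hdY := fun x hx => hY.pure.finrank_cellSpan_le M hB.1 hYB (x := x) hx
  refine isTropSet_of_cells (hA.prod hB) (hXA.prod hYB) (hX.nonempty.prod hY.nonempty) ?_ ?_ ?_
  · rintro ⟨x, y⟩ ⟨hx, hy⟩
    obtain ⟨z, hz, hxz, h1⟩ := hX.pure.exists_cell hA.1 hXA hx
    obtain ⟨w, hw, hyw, h2⟩ := hY.pure.exists_cell hB.1 hYB hy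
    refine ⟨(z, w), ⟨hz, hw⟩, mem_cell_prod.2 ⟨hxz, hyw⟩, ?_⟩
    rw [cellSpan_prodArr, finrank_prod_submodule N M, h1, h2]
  · rintro ⟨x, y⟩ ⟨hx, hy⟩
    rw [cellSpan_prodArr, finrank_prod_submodule N M]
    exact add_le_add (hdX x hx) (hdY y hy)
  · rintro ⟨x, y⟩ ⟨hx, hy⟩ hd
    rw [cellSpan_prodArr, finrank_prod_submodule N M] at hd
    have h1 := hdX x hx
    have h2 := hdY y hy
    rw [cellSpan_prodArr, localStar_prod]
    dsimp only at h1 h2 hx hy hd ⊢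
    rcases h2.eq_or_lt with h2 | h2
    · obtain ⟨s, hs, hsum⟩ := hX.balanced x hx _ (isRat_cellSpan hA x) (by omega)
        (localStar_invariant hA.1 hXA x)
      rw [localStar_eq_cellSpan M hB.1 hYB hdY hy h2]
      exact ⟨_, (hs.prod_left M _).1, (hs.prod_left M _).2 hsum⟩
    · obtain ⟨s, hs, hsum⟩ := hY.balanced y hy _ (isRat_cellSpan hB y) (by omega)
        (localStar_invariant hB.1 hYB y)
      rw [localStar_eq_cellSpan N hA.1 hXA hdX hx (by omega)]
      exact ⟨_, (hs.prod_right N _).1, (hs.prod_right N _).2 hsum⟩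

open Classical in
/-- A linear factor can be cancelled from a tropical set. -/
theorem IsTropSet.cancel {X : Set V} {d : ℕ}
    (h : IsTropSet (N.prod M) d (X ×ˢ (Set.univ : Set W))) :
    ∃ e, e + finrank ℝ W = d ∧ IsTropSet N e X := by
  have key : ∀ x ∈ X, ∃ v ∈ localStar X x, ∃ U : Submodule ℝ V, finrank ℝ U + finrank ℝ W = d ∧
      localStar (localStar X x) v = U := by
    intro x hx
    obtain ⟨⟨v, w⟩, hv, U, hU, hvU⟩ := h.pure (x, 0) ⟨hx, trivial⟩
    rw [localStar_prod, localStar_univ] at hv hvU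
    rw [localStar_prod, localStar_univ] at hvU
    refine ⟨v, hv.1, U.comap (LinearMap.inl ℝ V W), ?_, ?_⟩
    · have e : (U.comap (LinearMap.inl ℝ V W)).prod ⊤ = U := by
        ext ⟨a, b⟩
        have h1 : ∀ a b, (a, b) ∈ U ↔ a ∈ localStar (localStar X x) v := fun a b => by
          rw [← SetLike.mem_coe, ← hvU]; simp
        simp [h1]
      rw [← hU, ← e, finrank_prod_submodule N M, finrank_top, e]
    · ext a
      change _ ↔ (a, (0 : W)) ∈ (U : Set (V × W))
      rw [← hvU]; simp
  have hne : X.Nonempty := h.nonempty.fst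
  obtain ⟨x0, hx0⟩ := hne
  obtain ⟨-, -, U0, hU0, -⟩ := key x0 hx0
  obtain ⟨A, hA, hXA⟩ := h.poly
  refine ⟨_, hU0, ⟨x0, hx0⟩, ⟨_, hA.comp latMap_inl, ?_⟩, fun x hx => ?_, fun x hx L hL hd hinv => ?_⟩
  · have := hXA.preimage (LinearMap.inl ℝ V W)
    have e : LinearMap.inl ℝ V W ⁻¹' (X ×ˢ Set.univ) = X := by ext; simp
    rwa [e] at this
  · obtain ⟨v, hv, U, hU, h1⟩ := key x hx
    exact ⟨v, hv, U, by omega, h1⟩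
  · obtain ⟨s, hs, hsum⟩ := h.balanced (x, 0) ⟨hx, trivial⟩ (L.prod ⊤) (hL.prod isRat_top)
      (by rw [finrank_prod_submodule N M, finrank_top]; omega) (by
        rw [localStar_prod, localStar_univ]
        rintro ⟨a, b⟩ ⟨ha, -⟩ ⟨l, l'⟩ ⟨hl, -⟩
        exact ⟨hinv a ha l hl, trivial⟩)
    rw [localStar_prod, localStar_univ] at hs
    have hinj : Set.InjOn Prod.fst (s : Set (V × W)) := by
      intro a ha b hb hab
      refine hs.distinct a ha b hb 1 zero_le_one ⟨?_, trivial⟩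
      simp [hab]
    refine ⟨s.image Prod.fst, ⟨?_, ?_, ?_, ?_, ?_⟩, ?_⟩
    · simp only [Finset.mem_image]
      rintro _ ⟨n, hn, rfl⟩
      exact (hs.mem_lattice n hn).1
    · simp only [Finset.mem_image]
      rintro _ ⟨n, hn, rfl⟩ hc
      exact hs.notMem n hn ⟨hc, trivial⟩
    · simp only [Finset.mem_image]
      rintro _ ⟨n, hn, rfl⟩ y hy c hc
      exact hs.primitive n hn (y, 0) ⟨hy, M.carrier.zero_mem⟩ c ⟨hc, trivial⟩
    · intro z
      constructor
      · intro hz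
        obtain ⟨n, hn, c, hc, h1⟩ := (hs.cover (z, 0)).1 ⟨hz, trivial⟩
        exact ⟨n.1, Finset.mem_image_of_mem _ hn, c, hc, h1.1⟩
      · rintro ⟨m, hm, c, hc, h1⟩
        obtain ⟨n, hn, rfl⟩ := Finset.mem_image.1 hm
        exact ((hs.cover (z, 0)).2 ⟨n, hn, c, hc, h1, trivial⟩).1
    · simp only [Finset.mem_image]
      rintro _ ⟨n, hn, rfl⟩ _ ⟨m, hm, rfl⟩ c hc h1
      rw [hs.distinct n hn m hm c hc ⟨h1, trivial⟩]
    · rw [Finset.sum_image hinj, ← Prod.fst_sum]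
      exact hsum.1

end Prod

end TropicalSets

/-! ### Piecewise linear functions and modifications of sets -/

section Modifications

variable {V V' W : Type*} [AddCommGroup V] [Module ℝ V] [AddCommGroup V'] [Module ℝ V']
  [AddCommGroup W] [Module ℝ W]
variable {N : RealLattice V} {N' : RealLattice V'} {M : RealLattice W}

/-- `φ` is integral linear on every cell of `A` contained in `X`. -/
def IsPLFor (N : RealLattice V) (A : Set (V →ₗ[ℝ] ℝ)) (X : Set V) (φ : V → ℝ) : Prop :=
  ∀ x ∈ X, ∃ l : V →ₗ[ℝ] ℝ, LatMap N RealLattice.int l ∧ ∀ y ∈ cell A x, φ y = l y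

/-- `φ` is a piecewise integral linear function on `X`. -/
def IsPL (N : RealLattice V) (X : Set V) (φ : V → ℝ) : Prop :=
  ∃ A, IsRatArr N A ∧ IsCellular A X ∧ IsPLFor N A X φ

/-- The graph of `φ` over `Y`, together with everything above it over `E`. -/
def modif (Y E : Set V) (φ : V → ℝ) : Set (V × ℝ) :=
  {z | (z.1 ∈ Y ∧ z.2 = φ z.1) ∨ (z.1 ∈ E ∧ φ z.1 ≤ z.2)}

/-- The one-sided directional derivative of a piecewise linear function. -/
noncomputable def der (φ : V → ℝ) (x v : V) : ℝ :=
  Classical.epsilon fun r => ∀ᶠ t : ℝ in 𝓝[>] 0, φ (x + t • v) = φ x + t * r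

variable {A B : Set (V →ₗ[ℝ] ℝ)} {X Y E Z : Set V} {φ ψ : V → ℝ} {x y v w : V}

theorem eventually_der {r : ℝ} (h : ∀ᶠ t : ℝ in 𝓝[>] 0, φ (x + t • v) = φ x + t * r) :
    ∀ᶠ t : ℝ in 𝓝[>] 0, φ (x + t • v) = φ x + t * der φ x v :=
  Classical.epsilon_spec (p := fun r => ∀ᶠ t : ℝ in 𝓝[>] 0, φ (x + t • v) = φ x + t * r) ⟨r, h⟩

theorem der_eq {r : ℝ} (h : ∀ᶠ t : ℝ in 𝓝[>] 0, φ (x + t • v) = φ x + t * r) : der φ x v = r := by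
  obtain ⟨t, ⟨h1, h2⟩, h3⟩ := ((h.and (eventually_der h)).and eventually_pos).exists
  rw [h1, add_right_inj] at h2
  exact (mul_left_cancel₀ h3.ne' h2).symm

theorem IsPLFor.mono (h : IsPLFor N A X φ) (hAB : A ⊆ B) : IsPLFor N B X φ := fun x hx =>
  let ⟨l, hl, h'⟩ := h x hx
  ⟨l, hl, fun y hy => h' y (cell_anti hAB hy)⟩

theorem IsPLFor.comp {A : Set (V' →ₗ[ℝ] ℝ)} {X' : Set V'} {φ : V' → ℝ} (h : IsPLFor N' A X' φ)
    {p : V →ₗ[ℝ] V'} (hp : LatMap N N' p) (hX : ∀ x ∈ X, p x ∈ X') :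
    IsPLFor N ((fun f => f ∘ₗ p) '' A) X (φ ∘ p) := fun x hx =>
  let ⟨l, hl, h'⟩ := h _ (hX x hx)
  ⟨l ∘ₗ p, hl.comp hp, fun y hy => h' _ ((cell_comp p A x y).1 hy)⟩

theorem IsPL.comp {X' : Set V'} {φ : V' → ℝ} (h : IsPL N' X' φ) (hA : IsRatArr N A)
    (hX : IsCellular A X) {p : V →ₗ[ℝ] V'} (hp : LatMap N N' p) (hXX : ∀ x ∈ X, p x ∈ X') :
    IsPL N X (φ ∘ p) := by
  obtain ⟨B, hB, -, hφ⟩ := h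
  exact ⟨_, hA.union (hB.comp hp), hX.mono Set.subset_union_left,
    (hφ.comp hp hXX).mono Set.subset_union_right⟩

theorem IsPLFor.sub_linear (h : IsPLFor N A X φ) {l : V →ₗ[ℝ] ℝ} (hl : LatMap N RealLattice.int l) :
    IsPLFor N A X (fun x => φ x - l x) := fun x hx =>
  let ⟨m, hm, h'⟩ := h x hx
  ⟨m - l, hm.sub hl, fun y hy => by simp [h' y hy]⟩

theorem eqOn_cellSpan (hA : A.Finite) {l m : V →ₗ[ℝ] ℝ} (h : ∀ y ∈ cell A x, l y = m y) {v : V}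
    (hv : v ∈ cellSpan A x) : l v = m v := by
  rw [← span_cell hA] at hv
  exact LinearMap.eqOn_span h hv

/-- Near `x`, in the direction of `v`, the function is linear. -/
theorem IsPLFor.exists_linear (hA : A.Finite) (h : IsPLFor N A X φ) (hv : v ∈ localStar X x) :
    ∃ l : V →ₗ[ℝ] ℝ, LatMap N RealLattice.int l ∧ (∀ z ∈ cell A x, φ z = l z) ∧
      ∀ w, (∀ f ∈ A, f x = 0 → (0 ≤ f v → 0 ≤ f w) ∧ (f v ≤ 0 → f w ≤ 0)) →
        ∀ᶠ t : ℝ in 𝓝[>] 0, φ (x + t • w) = φ x + t * l w := by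
  obtain ⟨t, h1, h2⟩ := ((mem_localStar.1 hv).and (eventually_signs hA x v)).exists
  obtain ⟨l, hl, h3⟩ := h _ h1
  have hx : x ∈ cell A (x + t • v) := mem_cell_of_lexSign h2
  refine ⟨l, hl, fun z hz => h3 z (cell_trans hx hz), fun w hw => ?_⟩
  refine (eventually_signs hA x w).mono fun s hs => ?_
  rw [h3 _ fun f hf => ?_, h3 x hx]
  · simp
  · have := h2 f hf
    have := hs f hf
    have := hw f hf
    unfold LexSign at *
    grind

theorem IsPLFor.eventually_der (hA : A.Finite) (h : IsPLFor N A X φ) (hv : v ∈ localStar X x) :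
    ∀ᶠ t : ℝ in 𝓝[>] 0, φ (x + t • v) = φ x + t * der φ x v := by
  obtain ⟨l, -, -, h'⟩ := h.exists_linear hA hv
  exact _root_.eventually_der (h' v fun _ _ _ => ⟨id, id⟩)

theorem IsPLFor.star (hA : A.Finite) (h : IsPLFor N A X φ) (x : V) :
    IsPLFor N A (localStar X x) (der φ x) := fun v hv => by
  obtain ⟨l, hl, -, h'⟩ := h.exists_linear hA hv
  exact ⟨l, hl, fun w hw => der_eq (h' w fun f hf _ => hw f hf)⟩

theorem IsPLFor.der_add (hA : A.Finite) (h : IsPLFor N A X φ) {l : V →ₗ[ℝ] ℝ}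
    (hl : ∀ z ∈ cell A x, φ z = l z) (hv : v ∈ localStar X x) {u : V} (hu : u ∈ cellSpan A x) {c : ℝ}
    (hc : 0 ≤ c) : der φ x (u + c • v) = l u + c * der φ x v := by
  obtain ⟨m, -, h1, h2⟩ := h.exists_linear hA hv
  have e : l u = m u := eqOn_cellSpan hA (fun y hy => by rw [← hl y hy, h1 y hy]) hu
  rw [der_eq (h2 v fun _ _ _ => ⟨id, id⟩), der_eq (h2 (u + c • v) fun f hf h0 => ?_), e]
  · simp
  · rw [map_add, hu f hf h0, map_smul, smul_eq_mul, zero_add]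
    exact ⟨fun h => mul_nonneg hc h, fun h => mul_nonpos_of_nonneg_of_nonpos hc h⟩

theorem IsPLFor.der_cellSpan (hA : A.Finite) (h : IsPLFor N A X φ) {l : V →ₗ[ℝ] ℝ} (hx : x ∈ X)
    (hl : ∀ z ∈ cell A x, φ z = l z) {u : V} (hu : u ∈ cellSpan A x) : der φ x u = l u := by
  have := h.der_add hA hl (zero_mem_localStar hx) hu le_rfl
  simpa using this

theorem IsPLFor.map_zero (h : IsPLFor N A X φ) (hx : x ∈ X) : φ 0 = 0 := by
  obtain ⟨l, -, h'⟩ := h x hx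
  rw [h' 0 (zero_mem _), _root_.map_zero]

theorem IsPLFor.map_smul (h : IsPLFor N A X φ) (hx : x ∈ X) {c : ℝ} (hc : 0 ≤ c) :
    φ (c • x) = c * φ x := by
  obtain ⟨l, -, h'⟩ := h x hx
  rw [h' _ ((cell A x).smul_mem hc self_mem_cell), h' x self_mem_cell, _root_.map_smul, smul_eq_mul]

theorem IsPLFor.map_lattice (h : IsPLFor N A X φ) (hx : x ∈ X) (hxN : x ∈ N.carrier) :
    φ x ∈ RealLattice.int.carrier := by
  obtain ⟨l, hl, h'⟩ := h x hx
  rw [h' x self_mem_cell]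
  exact hl x hxN

theorem modif_localStar (hA : A.Finite) (hY : IsCellular A Y) (hE : IsCellular A E) (hEY : E ⊆ Y)
    (hφ : IsPLFor N A Y φ) (y : V) :
    localStar (modif Y E φ) (y, φ y) = modif (localStar Y y) (localStar E y) (der φ y) := by
  ext ⟨v, r⟩
  by_cases hv : v ∈ localStar Y y
  · have hd := hφ.eventually_der hA hv
    constructor
    · intro h
      by_cases hvE : v ∈ localStar E y
      · right
        obtain ⟨t, ⟨h1, h2⟩, h3⟩ := (((mem_localStar.1 h).and hd).and eventually_pos).exists
        refine ⟨hvE, ?_⟩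
        have h4 : φ y + t * der φ y v ≤ φ y + t * r := by
          rcases h1 with h1 | h1
          · have := h1.2
            simp only [Prod.snd_add, Prod.smul_snd, Prod.fst_add, Prod.smul_fst, smul_eq_mul] at this
            rw [this, h2]
          · have := h1.2
            simp only [Prod.snd_add, Prod.smul_snd, Prod.fst_add, Prod.smul_fst, smul_eq_mul] at this
            rwa [h2] at this
        exact le_of_mul_le_mul_left (by linarith) h3
      · left
        obtain ⟨t, ⟨⟨h1, h2⟩, h3⟩, h5⟩ := ((((mem_localStar.1 h).and hd).and eventually_pos).and
          (notMem_localStar hA hE hvE)).exists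
        refine ⟨hv, ?_⟩
        rcases h1 with h1 | h1
        · have := h1.2
          simp only [Prod.snd_add, Prod.smul_snd, Prod.fst_add, Prod.smul_fst, smul_eq_mul] at this
          rw [h2, add_right_inj] at this
          exact mul_left_cancel₀ h3.ne' this
        · exact absurd h1.1 h5
    · rintro (⟨-, h⟩ | ⟨hvE, h⟩)
      · dsimp only at h
        filter_upwards [mem_localStar.1 hv, hd] with t h1 h2
        refine Or.inl ⟨h1, ?_⟩
        simp [h2, h]
      · dsimp only at h
        filter_upwards [mem_localStar.1 hvE, hd, eventually_pos] with t h1 h2 h3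
        refine Or.inr ⟨h1, ?_⟩
        simp only [Prod.snd_add, Prod.smul_snd, Prod.fst_add, Prod.smul_fst, smul_eq_mul, h2]
        have := mul_le_mul_of_nonneg_left h h3.le
        linarith
  · have hvE : v ∉ localStar E y := fun h => hv (localStar_mono hEY h)
    constructor
    · intro h
      obtain ⟨t, h1, h2⟩ := ((mem_localStar.1 h).and (notMem_localStar hA hY hv)).exists
      rcases h1 with h1 | h1
      · exact absurd h1.1 h2
      · exact absurd (hEY h1.1) h2
    · rintro (⟨h, -⟩ | ⟨h, -⟩)
      · exact absurd h hv
      · exact absurd h hvE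

theorem modif_localStar_upper (hA : A.Finite) (hE : IsCellular A E) (hEY : E ⊆ Y)
    (hφ : IsPLFor N A Y φ) (hY : IsCellular A Y) {y : V} {s : ℝ} (hs : φ y < s) :
    localStar (modif Y E φ) (y, s) = localStar E y ×ˢ Set.univ := by
  ext ⟨v, r⟩
  constructor
  · intro h
    refine ⟨?_, trivial⟩
    by_contra hv
    dsimp only at hv
    have h1 := (mem_localStar.1 h).and (notMem_localStar hA hE hv)
    have hvY : v ∈ localStar Y y := by
      by_contra hvY
      obtain ⟨t, h2, h3⟩ := (h1.and (notMem_localStar hA hY hvY)).exists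
      rcases h2.1 with h4 | h4
      · exact h3 h4.1
      · exact h2.2 h4.1
    have hd := hφ.eventually_der hA hvY
    have hsm := eventually_pos_of_pos (r - der φ y v) (sub_pos.2 hs)
    obtain ⟨t, ⟨h2, h3⟩, h4⟩ := ((h1.and hd).and hsm).exists
    rcases h2.1 with h5 | h5
    · have := h5.2
      simp only [Prod.snd_add, Prod.smul_snd, Prod.fst_add, Prod.smul_fst, smul_eq_mul] at this
      rw [h3] at this
      linarith
    · exact h2.2 h5.1
  · rintro ⟨hv, -⟩
    have hd := hφ.eventually_der hA (localStar_mono hEY hv)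
    filter_upwards [mem_localStar.1 hv, hd, eventually_pos_of_pos (r - der φ y v) (sub_pos.2 hs)]
      with t h1 h2 h3
    refine Or.inr ⟨h1, ?_⟩
    simp only [Prod.snd_add, Prod.smul_snd, Prod.fst_add, Prod.smul_fst, smul_eq_mul, h2]
    linarith

theorem finite_cells (hA : A.Finite) : (Set.range (cell A)).Finite := by
  let g : Set (V →ₗ[ℝ] ℝ) × Set (V →ₗ[ℝ] ℝ) → Set V := fun p =>
    {y | (∀ f ∈ p.1, 0 ≤ f y) ∧ ∀ f ∈ p.2, f y ≤ 0}
  have h1 : ((fun σ : PointedCone ℝ V => (σ : Set V)) '' Set.range (cell A)).Finite := by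
    refine ((hA.finite_subsets.prod hA.finite_subsets).image g).subset ?_
    rintro _ ⟨_, ⟨x, rfl⟩, rfl⟩
    refine ⟨({f ∈ A | 0 ≤ f x}, {f ∈ A | f x ≤ 0}), ⟨Set.sep_subset _ _, Set.sep_subset _ _⟩, ?_⟩
    ext y
    constructor
    · rintro ⟨h1, h2⟩ f hf
      exact ⟨fun h => h1 f ⟨hf, h⟩, fun h => h2 f ⟨hf, h⟩⟩
    · intro h
      exact ⟨fun f hf => (h f hf.1).1 hf.2, fun f hf => (h f hf.1).2 hf.2⟩
  exact h1.of_finite_image SetLike.coe_injective.injOn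

/-- A piecewise linear function uses only finitely many linear functions. -/
theorem IsPLFor.exists_finite (hA : IsRatArr N A) (h : IsPLFor N A X φ) :
    ∃ C, IsRatArr N C ∧ ∀ x ∈ X, ∃ l ∈ C, ∀ y ∈ cell A x, φ y = l y := by
  choose! l hl h' using h
  have hfin : (cell A '' X).Finite := (finite_cells hA.1).subset (Set.image_subset_range _ _)
  choose! pt hpt hcell using fun (σ : PointedCone ℝ V) (hσ : σ ∈ cell A '' X) => hσ
  refine ⟨(fun σ => l (pt σ)) '' (cell A '' X), ⟨hfin.image _, ?_⟩, fun x hx => ?_⟩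
  · rintro _ ⟨σ, hσ, rfl⟩
    exact hl _ (hpt σ hσ)
  · have hσ : cell A x ∈ cell A '' X := ⟨x, hx, rfl⟩
    refine ⟨_, ⟨_, hσ, rfl⟩, fun y hy => h' _ (hpt _ hσ) y ?_⟩
    rwa [hcell _ hσ]

/-- The arrangement on `V × ℝ` adapted to the graphs of the functionals in `C`. -/
def graphArr (A C : Set (V →ₗ[ℝ] ℝ)) : Set (V × ℝ →ₗ[ℝ] ℝ) :=
  (fun f => f ∘ₗ LinearMap.fst ℝ V ℝ) '' A ∪
    (fun l => LinearMap.snd ℝ V ℝ - l ∘ₗ LinearMap.fst ℝ V ℝ) '' C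

theorem isRatArr_graphArr {C : Set (V →ₗ[ℝ] ℝ)} (hA : IsRatArr N A) (hC : IsRatArr N C) :
    IsRatArr (N.prod RealLattice.int) (graphArr A C) :=
  (hA.comp latMap_fst).union ⟨hC.1.image _, by
    rintro _ ⟨l, hl, rfl⟩
    exact latMap_snd.sub ((hC.2 l hl).comp latMap_fst)⟩

theorem modif_isCellular {C : Set (V →ₗ[ℝ] ℝ)} (hY : IsCellular A Y) (hE : IsCellular A E)
    (hEY : E ⊆ Y) (h : ∀ x ∈ Y, ∃ l ∈ C, ∀ y ∈ cell A x, φ y = l y) :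
    IsCellular (graphArr A C) (modif Y E φ) := by
  intro z hz w hw
  have h1 : w.1 ∈ cell A z.1 := (cell_comp _ A z w).1 (cell_anti Set.subset_union_left hw)
  have hzY : z.1 ∈ Y := hz.elim (fun h => h.1) (fun h => hEY h.1)
  obtain ⟨l, hl, hlφ⟩ := h z.1 hzY
  have h2 := hw _ (Or.inr ⟨l, hl, rfl⟩)
  simp only [LinearMap.sub_apply, LinearMap.comp_apply, LinearMap.snd_apply, LinearMap.fst_apply,
    ← hlφ z.1 self_mem_cell, ← hlφ w.1 h1, sub_nonneg, sub_nonpos] at h2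
  rcases hz with ⟨hz1, hz2⟩ | ⟨hz1, hz2⟩
  · exact Or.inl ⟨hY _ hz1 _ h1, le_antisymm (h2.2 hz2.le) (h2.1 hz2.ge)⟩
  · exact Or.inr ⟨hE _ hz1 _ h1, h2.1 hz2⟩

/-- The graph map of a linear functional. -/
def graphMap (l : V →ₗ[ℝ] ℝ) : V →ₗ[ℝ] V × ℝ := LinearMap.id.prod l

theorem graphMap_apply (l : V →ₗ[ℝ] ℝ) (x : V) : graphMap l x = (x, l x) := rfl

theorem latMap_graphMap {l : V →ₗ[ℝ] ℝ} (hl : LatMap N RealLattice.int l) :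
    LatMap N (N.prod RealLattice.int) (graphMap l) := latMap_id.prod hl

theorem mem_map_graphMap {l : V →ₗ[ℝ] ℝ} {L : Submodule ℝ V} {z : V × ℝ} :
    z ∈ L.map (graphMap l) ↔ z.1 ∈ L ∧ z.2 = l z.1 := by
  constructor
  · rintro ⟨x, hx, rfl⟩
    exact ⟨hx, rfl⟩
  · rintro ⟨h1, h2⟩
    exact ⟨z.1, h1, Prod.ext rfl h2.symm⟩

theorem finrank_map_graphMap (l : V →ₗ[ℝ] ℝ) (L : Submodule ℝ V) :
    finrank ℝ (L.map (graphMap l)) = finrank ℝ L :=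
  (Submodule.equivMapOfInjective _ (fun _ _ h => (Prod.ext_iff.1 h).1) L).finrank_eq.symm

open Classical in
/-- Normals of a modification: the graphs of the old normals and, along the divisor, the vertical
vector. -/
theorem IsNormals.modif {L : Submodule ℝ V} {s : Finset V} (hs : IsNormals N L Z s)
    {l : V →ₗ[ℝ] ℝ} (hl : LatMap N RealLattice.int l) (hφN : ∀ n ∈ s, φ n ∈ RealLattice.int.carrier)
    (hφL : ∀ u ∈ L, φ u = l u) (hφ : ∀ n ∈ s, ∀ u ∈ L, ∀ c : ℝ, 0 ≤ c → φ (u + c • n) = l u + c * φ n)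
    {T : Finset (V × ℝ)} (hT : (E = ∅ ∧ T = ∅) ∨ (E = (L : Set V) ∧ T = {(0, 1)})) :
    IsNormals (N.prod RealLattice.int) (L.map (graphMap l)) (modif Z E φ)
        (s.image (fun n => (n, φ n)) ∪ T) ∧
      ∑ m ∈ s.image (fun n => (n, φ n)) ∪ T, m = (∑ n ∈ s, n, ∑ n ∈ s, φ n) + ∑ m ∈ T, m := by
  have hTm : ∀ m ∈ T, m = (0, 1) ∧ E = (L : Set V) := by
    rcases hT with ⟨-, rfl⟩ | ⟨h, rfl⟩
    · simp
    · simp [h]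
  have hTE : ∀ u ∈ E, u ∈ L ∧ ((0, 1) : V × ℝ) ∈ T := by
    rcases hT with ⟨rfl, -⟩ | ⟨rfl, rfl⟩
    · simp
    · simp
  have hmem : ∀ m, m ∈ s.image (fun n => (n, φ n)) ∪ T ↔ (∃ n ∈ s, m = (n, φ n)) ∨ m ∈ T := by
    intro m
    rw [Finset.mem_union, Finset.mem_image]
    simp only [eq_comm]
  refine ⟨⟨?_, ?_, ?_, ?_, ?_⟩, ?_⟩
  · intro m hm
    rcases (hmem m).1 hm with ⟨n, hn, rfl⟩ | hm
    · exact ⟨hs.mem_lattice n hn, hφN n hn⟩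
    · rw [(hTm m hm).1]
      exact ⟨zero_mem _, RealLattice.one_mem_int⟩
  · intro m hm h
    rw [mem_map_graphMap] at h
    rcases (hmem m).1 hm with ⟨n, hn, rfl⟩ | hm
    · exact hs.notMem n hn h.1
    · rw [(hTm m hm).1] at h
      simpa using h.2
  · intro m hm x hx c hc
    rw [mem_map_graphMap] at hc
    rcases (hmem m).1 hm with ⟨n, hn, rfl⟩ | hm
    · exact hs.primitive n hn x.1 hx.1 c hc.1
    · rw [(hTm m hm).1] at hc
      have h1 : x.2 - c = l x.1 := by simpa using hc.2
      have h2 : x.2 - l x.1 ∈ RealLattice.int.carrier := sub_mem hx.2 (hl _ hx.1)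
      obtain ⟨k, hk⟩ := RealLattice.mem_int.1 h2
      exact ⟨k, by linarith⟩
  · rintro ⟨z, r⟩
    constructor
    · rintro (⟨h1, h2⟩ | ⟨h1, h2⟩)
      · obtain ⟨n, hn, c, hc, h3⟩ := (hs.cover z).1 h1
        refine ⟨(n, φ n), (hmem _).2 (Or.inl ⟨n, hn, rfl⟩), c, hc, mem_map_graphMap.2 ⟨h3, ?_⟩⟩
        have := hφ n hn _ h3 c hc
        rw [sub_add_cancel] at this
        dsimp only at h2 this ⊢
        simp [h2, this]
      · obtain ⟨h3, h4⟩ := hTE z h1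
        refine ⟨(0, 1), (hmem _).2 (Or.inr h4), r - l z, ?_, mem_map_graphMap.2 ⟨?_, ?_⟩⟩
        · rw [sub_nonneg, ← hφL z h3]; exact h2
        · simpa using h3
        · simp
    · rintro ⟨m, hm, c, hc, h1⟩
      rw [mem_map_graphMap] at h1
      rcases (hmem m).1 hm with ⟨n, hn, rfl⟩ | hm
      · have := hφ n hn _ h1.1 c hc
        simp only [Prod.fst_sub, Prod.smul_fst, sub_add_cancel, Prod.snd_sub, Prod.smul_snd,
          smul_eq_mul] at this h1
        exact Or.inl ⟨(hs.cover z).2 ⟨n, hn, c, hc, h1.1⟩, by dsimp only; linarith [h1.2]⟩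
      · obtain ⟨rfl, hEL⟩ := hTm m hm
        have h2 : z ∈ L := by simpa using h1.1
        have h3 : r - c = l z := by simpa using h1.2
        refine Or.inr ⟨by rw [hEL]; exact h2, ?_⟩
        dsimp only
        rw [hφL z h2]
        linarith
  · intro m hm m' hm' c hc h
    rw [mem_map_graphMap] at h
    rcases (hmem m).1 hm with ⟨n, hn, rfl⟩ | hm <;> rcases (hmem m').1 hm' with ⟨n', hn', rfl⟩ | hm'
    · rw [hs.distinct n hn n' hn' c hc h.1]
    · rw [(hTm m' hm').1] at h
      exact absurd (by simpa using h.1) (hs.notMem n hn)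
    · rw [(hTm m hm).1] at h
      have h1 : c • n' ∈ L := by simpa using h.1
      by_cases h0 : c = 0
      · subst h0
        simpa using h.2
      · exact absurd ((Submodule.smul_mem_iff _ h0).1 h1) (hs.notMem n' hn')
    · rw [(hTm m hm).1, (hTm m' hm').1]
  · rw [Finset.sum_union, Finset.sum_image (fun a _ b _ hab => (Prod.ext_iff.1 hab).1)]
    · congr 1
      ext
      · simp [Prod.fst_sum]
      · simp [Prod.snd_sum]
    · rw [Finset.disjoint_left]
      intro m hm hmT
      obtain ⟨n, hn, rfl⟩ := Finset.mem_image.1 hm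
      have := (Prod.ext_iff.1 (hTm _ hmT).1).1
      dsimp only at this
      exact hs.notMem n hn (this ▸ zero_mem L)

/-- The normals of the star of a modification along a subspace of a cell. -/
theorem modif_star_normals {L : Submodule ℝ V} {s : Finset V} (hA : A.Finite) (hY : IsCellular A Y)
    (hE : IsCellular A E) (hEY : E ⊆ Y) (hφ : IsPLFor N A Y φ) (hy : y ∈ Y)
    {l : V →ₗ[ℝ] ℝ} (hl : LatMap N RealLattice.int l) (hlφ : ∀ z ∈ cell A y, φ z = l z)
    (hL : L ≤ cellSpan A y) (hs : IsNormals N L (localStar Y y) s)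
    {T : Finset (V × ℝ)}
    (hT : (localStar E y = ∅ ∧ T = ∅) ∨ (localStar E y = (L : Set V) ∧ T = {(0, 1)})) :
    ∃ s' : Finset (V × ℝ), (∀ m, m ∈ s' ↔ (∃ n ∈ s, m = (n, der φ y n)) ∨ m ∈ T) ∧
      IsNormals (N.prod RealLattice.int) (L.map (graphMap l)) (localStar (modif Y E φ) (y, φ y)) s' ∧
      (∀ g : V × ℝ → ℝ, ∑ m ∈ s', g m = ∑ n ∈ s, g (n, der φ y n) + ∑ m ∈ T, g m) ∧
      ∑ m ∈ s', m = (∑ n ∈ s, n, ∑ n ∈ s, der φ y n) + ∑ m ∈ T, m := by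
  classical
  rw [modif_localStar hA hY hE hEY hφ]
  have := hs.modif (φ := der φ y) hl (fun n hn => ?_)
    (fun u hu => hφ.der_cellSpan hA hy hlφ (hL hu)) (fun n hn u hu c hc => ?_) hT
  · refine ⟨_, fun m => ?_, this.1, fun g => ?_, this.2⟩
    · rw [Finset.mem_union, Finset.mem_image]
      simp only [eq_comm]
    · rw [Finset.sum_union, Finset.sum_image (fun a _ b _ hab => (Prod.ext_iff.1 hab).1)]
      rw [Finset.disjoint_left]
      intro m hm hmT
      obtain ⟨n, hn, rfl⟩ := Finset.mem_image.1 hm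
      rcases hT with ⟨-, rfl⟩ | ⟨-, rfl⟩
      · simp at hmT
      · have := (Prod.ext_iff.1 (Finset.mem_singleton.1 hmT)).1
        dsimp only at this
        exact hs.notMem n hn (this ▸ zero_mem L)
  · exact (hφ.star hA y).map_lattice (hs.mem hn) (hs.mem_lattice n hn)
  · exact hφ.der_add hA hlφ (hs.mem hn) (hL hu) hc

/-- What balancing of a modification says in terms of normals below. -/
theorem modif_balance {L : Submodule ℝ V} {s : Finset V} {d : ℕ} (hA : A.Finite)
    (hM : IsBalanced (N.prod RealLattice.int) d (modif Y E φ)) (hY : IsCellular A Y)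
    (hE : IsCellular A E) (hEY : E ⊆ Y) (hφ : IsPLFor N A Y φ) (hy : y ∈ Y)
    {l : V →ₗ[ℝ] ℝ} (hl : LatMap N RealLattice.int l) (hlφ : ∀ z ∈ cell A y, φ z = l z)
    (hL : L ≤ cellSpan A y) (hLrat : IsRat N L) (hLd : finrank ℝ L + 1 = d)
    (hs : IsNormals N L (localStar Y y) s) {T : Finset (V × ℝ)}
    (hT : (localStar E y = ∅ ∧ T = ∅) ∨ (localStar E y = (L : Set V) ∧ T = {(0, 1)})) :
    ∑ n ∈ s, n ∈ L ∧ ∑ n ∈ s, der φ y n + ∑ m ∈ T, m.2 = l (∑ n ∈ s, n) := by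
  obtain ⟨s', -, hs', -, hsum⟩ := modif_star_normals hA hY hE hEY hφ hy hl hlφ hL hs hT
  have hinv : Invariant (localStar (modif Y E φ) (y, φ y)) (L.map (graphMap l)) := by
    rw [modif_localStar hA hY hE hEY hφ]
    rintro ⟨v, r⟩ hv _ ⟨u, hu, rfl⟩
    have key : v ∈ localStar Y y → der φ y (v + u) = der φ y v + l u := fun hv => by
      have := hφ.der_add hA hlφ hv (hL hu) zero_le_one
      rw [one_smul, one_mul, add_comm] at this
      rw [this, add_comm]
    rcases hv with ⟨h1, h2⟩ | ⟨h1, h2⟩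
    · refine Or.inl ⟨localStar_invariant hA hY y v h1 u (hL hu), ?_⟩
      dsimp only at h2 h1
      simp [graphMap_apply, h2, key h1]
    · refine Or.inr ⟨localStar_invariant hA hE y v h1 u (hL hu), ?_⟩
      dsimp only at h2 h1
      simp [graphMap_apply, h2, key (localStar_mono hEY h1)]
  obtain ⟨s'', hs'', hsum''⟩ := hM (y, φ y) (Or.inl ⟨hy, rfl⟩) (L.map (graphMap l))
    (hLrat.map (latMap_graphMap hl)) (by rw [finrank_map_graphMap, hLd]) hinv
  have h1 := add_mem (hs'.sum_sub_sum_mem hs'') hsum''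
  rw [sub_add_cancel, hsum, mem_map_graphMap] at h1
  have h0 : (∑ m ∈ T, m).1 = 0 := by
    rcases hT with ⟨-, rfl⟩ | ⟨-, rfl⟩ <;> simp
  obtain ⟨h2, h3⟩ := h1
  rw [Prod.fst_add, h0, add_zero] at h2 h3
  rw [Prod.snd_add, Prod.snd_sum] at h3
  exact ⟨h2, h3⟩

/-- Refine an arrangement so that the linear functions used by `φ` can be compared on each cell. -/
theorem IsPLFor.exists_nice (hA : IsRatArr N A) (h : IsPLFor N A X φ) :
    ∃ B C, A ⊆ B ∧ IsRatArr N B ∧ IsRatArr N C ∧ (∀ x ∈ X, ∃ l ∈ C, ∀ y ∈ cell B x, φ y = l y) ∧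
      ∀ l ∈ C, ∀ m ∈ C, l - m ∈ B := by
  obtain ⟨C, hC, h'⟩ := h.exists_finite hA
  refine ⟨A ∪ (fun p : (V →ₗ[ℝ] ℝ) × (V →ₗ[ℝ] ℝ) => p.1 - p.2) '' (C ×ˢ C), C,
    Set.subset_union_left, hA.union ⟨(hC.1.prod hC.1).image _, ?_⟩, hC, fun x hx => ?_,
    fun l hl m hm => Or.inr ⟨(l, m), ⟨hl, hm⟩, rfl⟩⟩
  · rintro _ ⟨⟨l, m⟩, ⟨hl, hm⟩, rfl⟩
    exact (hC.2 l hl).sub (hC.2 m hm)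
  · obtain ⟨l, hl, h1⟩ := h' x hx
    exact ⟨l, hl, fun y hy => h1 y (cell_anti Set.subset_union_left hy)⟩

/-- The graph of a harmonic piecewise linear function is tropical. -/
theorem isTropSet_graph {d : ℕ} (hX : IsTropSet N d X) (hA : IsRatArr N A) (hXA : IsCellular A X)
    (hφ : IsPLFor N A X φ)
    (hharm : ∀ B, A ⊆ B → IsRatArr N B → ∀ x ∈ X, finrank ℝ (cellSpan B x) + 1 = d →
      ∀ l : V →ₗ[ℝ] ℝ, LatMap N RealLattice.int l → (∀ y ∈ cell B x, φ y = l y) →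
      ∀ s, IsNormals N (cellSpan B x) (localStar X x) s → ∑ n ∈ s, n ∈ cellSpan B x →
        ∑ n ∈ s, der φ x n = l (∑ n ∈ s, n)) :
    IsTropSet (N.prod RealLattice.int) d (modif X ∅ φ) := by
  obtain ⟨B, C, hAB, hB, hC, hφC, hdiff⟩ := hφ.exists_nice hA
  have hXB := hXA.mono hAB
  have hφB := hφ.mono hAB
  have hemp : IsCellular B (∅ : Set V) := fun _ h => absurd h (Set.notMem_empty _)
  have hmem : ∀ z, z ∈ modif X ∅ φ ↔ z.1 ∈ X ∧ z.2 = φ z.1 := fun z => by simp [modif]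
  have hspan : ∀ x ∈ X, ∀ l ∈ C, (∀ y ∈ cell B x, φ y = l y) →
      cellSpan (graphArr B C) (x, φ x) = (cellSpan B x).map (graphMap l) := by
    intro x hx l hl hlx
    ext ⟨v, r⟩
    rw [mem_map_graphMap]
    constructor
    · intro h
      refine ⟨fun f hf h0 => h _ (Or.inl ⟨f, hf, rfl⟩) h0, ?_⟩
      have := h _ (Or.inr ⟨l, hl, rfl⟩) (by simp [hlx x self_mem_cell])
      simpa [sub_eq_zero] using this
    · rintro ⟨h1, h2⟩ _ (⟨f, hf, rfl⟩ | ⟨m, hm, rfl⟩) h0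
      · exact h1 f hf h0
      · have h3 := h1 _ (hdiff l hl m hm)
        simp only [LinearMap.sub_apply, LinearMap.comp_apply, LinearMap.snd_apply,
          LinearMap.fst_apply, hlx x self_mem_cell] at h0 h3 h2 ⊢
        rw [h2, h3 h0]
  have hle := fun x hx => hX.pure.finrank_cellSpan_le N hB.1 hXB (x := x) hx
  refine isTropSet_of_cells (isRatArr_graphArr hB hC)
    (modif_isCellular hXB hemp (Set.empty_subset _) hφC) ⟨(0, φ 0), (hmem _).2 ⟨hX.zero_mem, rfl⟩⟩
    ?_ ?_ ?_
  · rintro ⟨x, r⟩ hxr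
    obtain ⟨hx, h2⟩ := (hmem _).1 hxr
    obtain rfl : r = φ x := h2
    obtain ⟨z, hz, hxz, hd⟩ := hX.pure.exists_cell hB.1 hXB hx
    obtain ⟨l, hl, hlz⟩ := hφC z hz
    refine ⟨(z, φ z), (hmem _).2 ⟨hz, rfl⟩, ?_, by
      rw [hspan z hz l hl hlz, finrank_map_graphMap, hd]⟩
    rintro _ (⟨f, hf, rfl⟩ | ⟨m, hm, rfl⟩)
    · exact hxz f hf
    · have := hxz _ (hdiff l hl m hm)
      simpa [hlz z self_mem_cell, hlz x hxz] using this
  · rintro ⟨x, r⟩ hxr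
    obtain ⟨hx, h2⟩ := (hmem _).1 hxr
    obtain rfl : r = φ x := h2
    obtain ⟨l, hl, hlx⟩ := hφC x hx
    rw [hspan x hx l hl hlx, finrank_map_graphMap]
    exact hle x hx
  · rintro ⟨x, r⟩ hxr hd
    obtain ⟨hx, h2⟩ := (hmem _).1 hxr
    obtain rfl : r = φ x := h2
    obtain ⟨l, hl, hlx⟩ := hφC x hx
    rw [hspan x hx l hl hlx] at hd ⊢
    rw [finrank_map_graphMap] at hd
    obtain ⟨s, hs, hsum⟩ := hX.balanced x hx _ (isRat_cellSpan hB x) hd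
      (localStar_invariant hB.1 hXB x)
    obtain ⟨s', -, hs', -, hsum'⟩ := modif_star_normals hB.1 hXB hemp (Set.empty_subset _) hφB hx
      (hC.2 l hl) hlx le_rfl hs (T := ∅) (Or.inl ⟨localStar_empty, rfl⟩)
    refine ⟨s', hs', ?_⟩
    rw [hsum', Finset.sum_empty, add_zero, mem_map_graphMap]
    exact ⟨hsum, hharm B hAB hB x hx hd l (hC.2 l hl) hlx s hs hsum⟩

end Modifications

/-! ### Quasilinear sets and harmonic functions on them -/

/-- Quasilinear sets: the class of sets generated by full spaces under isomorphisms and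
modifications. -/
inductive QLSet : ∀ {V : Type u} [AddCommGroup V] [Module ℝ V], RealLattice V → ℕ → Set V → Prop
  | complete {V : Type u} [AddCommGroup V] [Module ℝ V] (N : RealLattice V) :
      QLSet N (finrank ℝ V) Set.univ
  | iso {V V' : Type u} [AddCommGroup V] [Module ℝ V] [AddCommGroup V'] [Module ℝ V']
      {N : RealLattice V} {N' : RealLattice V'} {d : ℕ} {X : Set V} {X' : Set V'} :
      QLSet N' d X' → SetIso N X N' X' → QLSet N d X
  | modif {V : Type u} [AddCommGroup V] [Module ℝ V] {N : RealLattice V} {d : ℕ} {Y E : Set V}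
      {φ : V → ℝ} : QLSet N (d + 1) Y → QLSet N d E → E ⊆ Y → IsPL N Y φ →
      IsTropSet (N.prod RealLattice.int) (d + 1) (modif Y E φ) →
      QLSet (N.prod RealLattice.int) (d + 1) (modif Y E φ)

section Harmonic

variable {V V' : Type u} [AddCommGroup V] [Module ℝ V] [AddCommGroup V'] [Module ℝ V']
variable {N : RealLattice V} {N' : RealLattice V'} {d : ℕ} {X Y E : Set V} {φ ψ : V → ℝ}

theorem QLSet.isTropSet (h : QLSet N d X) : IsTropSet N d X := by
  induction h with
  | complete N => exact isTropSet_univ N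
  | iso _ h ih => exact ih.of_setIso h.symm
  | modif _ _ _ _ h _ _ => exact h

theorem isCellular_empty (A : Set (V →ₗ[ℝ] ℝ)) : IsCellular A (∅ : Set V) :=
  fun _ h => absurd h (Set.notMem_empty _)

theorem IsPL.exists_common {e : ℕ} (hφ : IsPL N Y φ) (hE : IsTropSet N e E) :
    ∃ A, IsRatArr N A ∧ IsCellular A Y ∧ IsCellular A E ∧ IsPLFor N A Y φ := by
  obtain ⟨A, hA, hY, h⟩ := hφ
  obtain ⟨B, hB, hE⟩ := hE.poly
  exact ⟨A ∪ B, hA.union hB, hY.mono Set.subset_union_left, hE.mono Set.subset_union_right,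
    h.mono Set.subset_union_left⟩

/-- Isomorphic data give isomorphic modifications. -/
theorem IsSetIso.modif {X' E' : Set V'} {φ' : V' → ℝ} {p : V →ₗ[ℝ] V'} {q : V' →ₗ[ℝ] V}
    (h : IsSetIso N X N' X' p q) (hEX : E ⊆ X) (hE' : E' ⊆ X') (hE : ∀ x ∈ E, p x ∈ E')
    (hEs : ∀ x ∈ E', q x ∈ E) (hφ : ∀ x ∈ X, φ' (p x) = φ x) :
    IsSetIso (N.prod RealLattice.int) (modif X E φ) (N'.prod RealLattice.int) (modif X' E' φ')
      (p.prodMap LinearMap.id) (q.prodMap LinearMap.id) where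
  lat z hz := ⟨h.lat _ hz.1, hz.2⟩
  lat_symm z hz := ⟨h.lat_symm _ hz.1, hz.2⟩
  mem := by
    rintro ⟨x, r⟩ (⟨h1, h2⟩ | ⟨h1, h2⟩)
    · exact Or.inl ⟨h.mem x h1, h2.trans (hφ x h1).symm⟩
    · exact Or.inr ⟨hE x h1, (hφ x (hEX h1)).trans_le h2⟩
  mem_symm := by
    have hφ' : ∀ x ∈ X', φ (q x) = φ' x := fun x hx => by
      rw [← hφ _ (h.mem_symm x hx), h.right_inv x hx]
    rintro ⟨x, r⟩ (⟨h1, h2⟩ | ⟨h1, h2⟩)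
    · exact Or.inl ⟨h.mem_symm x h1, h2.trans (hφ' x h1).symm⟩
    · exact Or.inr ⟨hEs x h1, (hφ' x (hE' h1)).trans_le h2⟩
  left_inv := by
    rintro ⟨x, r⟩ hx
    have : x ∈ X := hx.elim (fun h => h.1) (fun h => hEX h.1)
    exact Prod.ext (h.left_inv x this) rfl
  right_inv := by
    rintro ⟨x, r⟩ hx
    have : x ∈ X' := hx.elim (fun h => h.1) (fun h => hE' h.1)
    exact Prod.ext (h.right_inv x this) rfl

/-- The shear `(x, r) ↦ (x, r - l x)` of a modification. -/
theorem isSetIso_shear {l : V →ₗ[ℝ] ℝ} (hl : LatMap N RealLattice.int l) (X E : Set V) (φ : V → ℝ) :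
    IsSetIso (N.prod RealLattice.int) (modif X E φ) (N.prod RealLattice.int)
      (modif X E fun x => φ x - l x)
      ((LinearMap.fst ℝ V ℝ).prod (LinearMap.snd ℝ V ℝ - l ∘ₗ LinearMap.fst ℝ V ℝ))
      ((LinearMap.fst ℝ V ℝ).prod (LinearMap.snd ℝ V ℝ + l ∘ₗ LinearMap.fst ℝ V ℝ)) where
  lat := latMap_fst.prod (latMap_snd.sub (hl.comp latMap_fst))
  lat_symm := latMap_fst.prod (latMap_snd.add (hl.comp latMap_fst))
  mem := by
    rintro ⟨x, r⟩ (⟨h1, h2⟩ | ⟨h1, h2⟩)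
    · exact Or.inl ⟨h1, by dsimp only at h2; simp [h2]⟩
    · exact Or.inr ⟨h1, by dsimp only at h2; simpa using h2⟩
  mem_symm := by
    rintro ⟨x, r⟩ (⟨h1, h2⟩ | ⟨h1, h2⟩)
    · exact Or.inl ⟨h1, by dsimp only at h2; simp [h2]⟩
    · exact Or.inr ⟨h1, by dsimp only at h2; simp; linarith⟩
  left_inv := by rintro ⟨x, r⟩ -; simp
  right_inv := by rintro ⟨x, r⟩ -; simp

theorem exists_of_eventually {P : ℝ → Prop} (h : ∀ᶠ t : ℝ in 𝓝[>] 0, P t) :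
    ∃ ε : ℝ, 0 < ε ∧ ∀ t, 0 < t → t ≤ ε → P t := by
  obtain ⟨ε, hε, h'⟩ := mem_nhdsGT_iff_exists_Ioc_subset.1 h
  exact ⟨ε, hε, fun t h1 h2 => h' ⟨h1, h2⟩⟩

theorem affine_eq {a b a' b' : ℝ} (h : ∀ᶠ t : ℝ in 𝓝[>] 0, a + t * b = a' + t * b') :
    a = a' ∧ b = b' := by
  obtain ⟨ε, hε, h'⟩ := exists_of_eventually h
  have h1 := h' ε hε le_rfl
  have h2 := h' (ε / 2) (by positivity) (by linarith)
  have h3 : ε * (b - b') = 0 := by linarith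
  have h4 := (mul_eq_zero.1 h3).resolve_left hε.ne'
  have h5 : b = b' := sub_eq_zero.1 h4
  subst h5
  exact ⟨by linarith, rfl⟩

/-- A function on a half-line that is locally affine, and equal to a given affine function far out,
is equal to it everywhere. -/
theorem eq_affine_of_locally {h : ℝ → ℝ} {a α β : ℝ}
    (hloc : ∀ s, a < s → ∃ c, ∀ᶠ t : ℝ in 𝓝[>] 0, h (s + t) = h s + t * c ∧ h (s - t) = h s - t * c)
    (hfar : ∃ S, ∀ s, S ≤ s → h s = α + β * s) : ∀ s, a < s → h s = α + β * s := by
  obtain ⟨S, hS⟩ := hfar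
  let T : Set ℝ := {s | a < s ∧ ∀ s', s ≤ s' → h s' = α + β * s'}
  have hT : T.Nonempty := ⟨max S (a + 1), lt_of_lt_of_le (by linarith) (le_max_right _ _),
    fun s' hs' => hS s' ((le_max_left _ _).trans hs')⟩
  have hbdd : BddBelow T := ⟨a, fun s hs => hs.1.le⟩
  have habove : ∀ s, sInf T < s → h s = α + β * s := fun s hs => by
    obtain ⟨s', hs', hlt⟩ := exists_lt_of_csInf_lt hT hs
    exact hs'.2 s hlt.le
  have ha : a ≤ sInf T := le_csInf hT fun s hs => hs.1.le
  rcases ha.eq_or_lt with heq | hlt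
  · intro s hs
    exact habove s (heq ▸ hs)
  · exfalso
    obtain ⟨c, hc⟩ := hloc _ hlt
    have h1 : ∀ᶠ t : ℝ in 𝓝[>] 0, h (sInf T) + t * c = (α + β * sInf T) + t * β := by
      filter_upwards [hc, eventually_pos] with t ht h0
      rw [← ht.1, habove _ (by linarith)]
      ring
    obtain ⟨h2, rfl⟩ := affine_eq h1
    obtain ⟨ε, hε, h3⟩ := exists_of_eventually (hc.and (eventually_small _ (sub_pos.2 hlt)))
    have hmem : sInf T - ε ∈ T := by
      refine ⟨by linarith [(h3 ε hε le_rfl).2], fun s' hs' => ?_⟩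
      rcases lt_trichotomy s' (sInf T) with h4 | h4 | h4
      · have := (h3 (sInf T - s') (by linarith) (by linarith)).1.2
        rw [sub_sub_cancel, h2] at this
        rw [this]
        ring
      · rw [h4, h2]
      · exact habove s' h4
    have := csInf_le hbdd hmem
    linarith

/-- A harmonic piecewise linear function on the whole space is linear: bends along the hyperplanes
of the arrangement can be removed one hyperplane at a time. -/
theorem linear_of_harmonic_univ {A : Set (V →ₗ[ℝ] ℝ)} (hA : IsRatArr N A)
    (hψ : IsPLFor N A Set.univ ψ)
    (hT : IsBalanced (N.prod RealLattice.int) (finrank ℝ V) (modif Set.univ ∅ ψ)) :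
    ∃ l : V →ₗ[ℝ] ℝ, LatMap N RealLattice.int l ∧ ∀ x, ψ x = l x := by
  obtain ⟨hAf, hAN⟩ := hA
  have := N.finite
  induction A, hAf using Set.Finite.induction_on with
  | empty =>
    obtain ⟨l, hl, h⟩ := hψ 0 trivial
    exact ⟨l, hl, fun x => h x fun f hf => absurd hf (Set.notMem_empty f)⟩
  | @insert f A _ hAf ih =>
    refine ih (fun x _ => ?_) fun g hg => hAN g (Set.mem_insert_of_mem _ hg)
    have hA' : (insert f A).Finite := hAf.insert f
    obtain ⟨u, -, hu⟩ := exists_generic hA' (⊤ : Submodule ℝ V)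
    obtain ⟨t, ht⟩ := (eventually_signs hA' x u).exists
    set z := x + t • u with hz
    have hxz : x ∈ cell (insert f A) z := mem_cell_of_lexSign ht
    have hz0 : ∀ g ∈ insert f A, g z = 0 → ∀ w, g w = 0 := fun g hg h0 w => by
      refine hu g hg ?_ w trivial
      have := ht g hg
      rw [h0] at this
      unfold LexSign at this
      grind
    obtain ⟨l, hl, hlz⟩ := hψ z trivial
    refine ⟨l, hl, fun y hy => ?_⟩
    replace hy : y ∈ cell A z := cell_trans (cell_anti (Set.subset_insert f A) hxz) hy
    by_cases hopp : ∃ w ∈ cell A z, f z * f w < 0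
    swap
    · push Not at hopp
      refine hlz y ?_
      rintro g (rfl | hg)
      · have h1 := hopp y hy
        by_cases h0 : g z = 0
        · have := hz0 g (Set.mem_insert _ _) h0 y
          simp [this]
        · refine ⟨fun h => ?_, fun h => ?_⟩
          · exact nonneg_of_mul_nonneg_right h1 (lt_of_le_of_ne h (Ne.symm h0))
          · exact nonpos_of_mul_nonneg_right h1 (lt_of_le_of_ne h h0)
      · exact hy g hg
    obtain ⟨w, hw, hfw⟩ := hopp
    set f' : V →ₗ[ℝ] ℝ := f z • f with hf'
    have hfz : f z ≠ 0 := fun h => by simp [h] at hfw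
    have hf'z : 0 < f' z := by simpa [hf'] using (mul_self_pos.2 hfz)
    have hf'w : f' w < 0 := by simpa [hf'] using hfw
    have hff' : ∀ v, f v = (f z)⁻¹ * f' v := fun v => by simp [hf', hfz]
    have hD : 0 < f' z - f' w := by linarith
    set s := f' z / (f' z - f' w) with hs
    have hs0 : 0 < s := div_pos hf'z hD
    have hs1 : s < 1 := by rw [hs, div_lt_one hD]; linarith
    set y0 := z + s • (w - z) with hy0
    have hf'y0 : f' y0 = 0 := by
      rw [hy0, map_add, map_smul, map_sub, smul_eq_mul, hs]
      field_simp
      ring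
    have hfy0 : f y0 = 0 := by rw [hff', hf'y0, mul_zero]
    have hsg : ∀ g ∈ A, SignEq (g z) (g y0) := fun g hg => by
      have h1 := hw g hg
      have e : g y0 = (1 - s) * g z + s * g w := by
        rw [hy0, map_add, map_smul, map_sub, smul_eq_mul]; ring
      have h2 := hz0 g (Set.mem_insert_of_mem _ hg)
      rw [e]
      rcases lt_trichotomy (g z) 0 with h | h | h
      · have := mul_neg_of_pos_of_neg (sub_pos.2 hs1) h
        have := mul_nonpos_of_nonneg_of_nonpos hs0.le (h1.2 h.le)
        constructor <;> constructor <;> intro <;> linarith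
      · simp [h, h2 h w, SignEq]
      · have := mul_pos (sub_pos.2 hs1) h
        have := mul_nonneg hs0.le (h1.1 h.le)
        constructor <;> constructor <;> intro <;> linarith
    obtain ⟨r, hr, hr0⟩ := ((eventually_signs hA' y0 (w - z)).and eventually_pos).exists
    set z' := y0 + r • (w - z) with hz'
    have hf'z' : f' z' < 0 := by
      rw [hz', map_add, hf'y0, map_smul, map_sub, smul_eq_mul, zero_add]
      exact mul_neg_of_pos_of_neg hr0 (by linarith)
    have hsg' : ∀ g ∈ A, SignEq (g z') (g y0) := fun g hg => by
      have h1 := hr g (Set.mem_insert_of_mem _ hg)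
      have h2 := hsg g hg
      have h3 := hz0 g (Set.mem_insert_of_mem _ hg)
      have h4 := h2.eq_zero_iff
      by_cases h0 : g z = 0
      · simp [h3 h0, SignEq]
      · have : g y0 ≠ 0 := fun h => h0 (h4.2 h)
        unfold LexSign SignEq at *
        grind
    obtain ⟨m, hm, hmz⟩ := hψ z' trivial
    have hcz : ∀ v, (∀ g ∈ A, (0 ≤ g z → 0 ≤ g v) ∧ (g z ≤ 0 → g v ≤ 0)) → 0 ≤ f' v → ψ v = l v := by
      intro v hv h0
      refine hlz v ?_
      rintro g (rfl | hg)
      · rw [hff' v]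
        exact ⟨fun h => mul_nonneg (inv_nonneg.2 h) h0,
          fun h => mul_nonpos_of_nonpos_of_nonneg (inv_nonpos.2 h) h0⟩
      · exact hv g hg
    have hcz' : ∀ v, (∀ g ∈ A, (0 ≤ g z → 0 ≤ g v) ∧ (g z ≤ 0 → g v ≤ 0)) → f' v ≤ 0 → ψ v = m v := by
      intro v hv h0
      refine hmz v ?_
      rintro g (rfl | hg)
      · rw [hff' v, hff' z']
        refine ⟨fun h => ?_, fun h => ?_⟩
        · have : (g z)⁻¹ ≤ 0 := by
            by_contra hc
            exact absurd (mul_neg_of_pos_of_neg (not_le.1 hc) hf'z') (not_lt.2 h)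
          exact mul_nonneg_of_nonpos_of_nonpos this h0
        · have : 0 ≤ (g z)⁻¹ := by
            by_contra hc
            exact absurd (mul_pos_of_neg_of_neg (not_le.1 hc) hf'z') (not_lt.2 h)
          exact mul_nonpos_of_nonneg_of_nonpos this h0
      · have h1 := hsg g hg
        have h2 := hsg' g hg
        have h3 := hv g hg
        unfold SignEq at h1 h2
        grind
    have hnear : ∀ v, ∀ᶠ t : ℝ in 𝓝[>] 0, ∀ g ∈ A,
        (0 ≤ g z → 0 ≤ g (y0 + t • v)) ∧ (g z ≤ 0 → g (y0 + t • v) ≤ 0) := fun v => by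
      refine (eventually_signs hAf y0 v).mono fun t ht g hg => ?_
      have h1 := ht g hg
      have h2 := hsg g hg
      have h4 := h2.eq_zero_iff
      by_cases h0 : g z = 0
      · have h3 := hz0 g (Set.mem_insert_of_mem _ hg) h0
        simp [h3]
      · have : g y0 ≠ 0 := fun h => h0 (h4.2 h)
        unfold LexSign SignEq at *
        grind
    have hy0l : ψ y0 = l y0 := by
      refine hcz y0 (fun g hg => ?_) hf'y0.ge
      have h2 := hsg g hg
      unfold SignEq at h2
      grind
    have hy0m : ψ y0 = m y0 := by
      refine hcz' y0 (fun g hg => ?_) hf'y0.le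
      have h2 := hsg g hg
      unfold SignEq at h2
      grind
    have hder1 : ∀ v, 0 ≤ f' v → der ψ y0 v = l v := fun v hv => by
      refine der_eq ?_
      filter_upwards [hnear v, eventually_pos] with t ht h0
      rw [hcz _ ht, hy0l, map_add, map_smul, smul_eq_mul]
      rw [map_add, hf'y0, map_smul, zero_add, smul_eq_mul]
      exact mul_nonneg h0.le hv
    have hder2 : ∀ v, f' v ≤ 0 → der ψ y0 v = m v := fun v hv => by
      refine der_eq ?_
      filter_upwards [hnear v, eventually_pos] with t ht h0
      rw [hcz' _ ht, hy0m, map_add, map_smul, smul_eq_mul]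
      rw [map_add, hf'y0, map_smul, zero_add, smul_eq_mul]
      exact mul_nonpos_of_nonneg_of_nonpos h0.le hv
    have hfN := hAN f (Set.mem_insert _ _)
    have hker : ∀ v, v ∈ LinearMap.ker f ↔ f' v = 0 := fun v => by
      rw [LinearMap.mem_ker, hff' v]; simp [hfz]
    have hLd : finrank ℝ (LinearMap.ker f) + 1 = finrank ℝ V := by
      have h1 := LinearMap.finrank_range_add_finrank_ker f
      have h2 : LinearMap.range f = ⊤ := LinearMap.range_eq_top.2
        (LinearMap.surjective_of_ne_zero fun h => hfz (by simp [h]))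
      rw [h2, finrank_top, finrank_self] at h1
      omega
    obtain ⟨ns, hns, hsum⟩ := exists_normals_of_hyperplane (isRat_ker hfN) (isRat_top (N := N)) le_top
      (by rw [hLd, finrank_top])
    have hbal := (modif_balance (E := ∅) (T := ∅) (y := y0) (l := l) hA' hT isCellular_univ
      (isCellular_empty _) (Set.empty_subset _) hψ trivial hl (fun v hv => ?_) (fun v hv g hg h0 => ?_)
      (isRat_ker hfN) hLd (by rw [localStar_univ]; simpa using hns)
      (Or.inl ⟨localStar_empty, rfl⟩)).2
    rotate_left
    · refine hlz v (cell_trans ?_ hv)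
      rintro g (rfl | hg)
      · simp [hfy0]
      · have h2 := hsg g hg
        unfold SignEq at h2
        grind
    · rcases hg with rfl | hg
      · exact hv
      · exact hz0 g (Set.mem_insert_of_mem _ hg) ((hsg g hg).eq_zero_iff.2 h0) v
    rw [Finset.sum_empty, add_zero, map_sum] at hbal
    have hml : ∀ v, m v - l v = (m z - l z) / f' z * f' v := fun v => by
      have h1 : f' (v - (f' v / f' z) • z) = 0 := by
        rw [map_sub, map_smul, smul_eq_mul]; field_simp; ring
      have h2 := hder1 _ h1.ge
      rw [hder2 _ h1.le, map_sub, map_sub, map_smul, map_smul, smul_eq_mul, smul_eq_mul] at h2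
      field_simp at h2 ⊢
      linarith
    have hzero : (m z - l z) / f' z * ∑ n ∈ ns, min (f' n) 0 = 0 := by
      rw [Finset.mul_sum]
      have : ∀ n ∈ ns, (m z - l z) / f' z * min (f' n) 0 = der ψ y0 n - l n := fun n _ => by
        rcases le_total (f' n) 0 with h | h
        · rw [min_eq_left h, hder2 n h, hml n]
        · rw [min_eq_right h, hder1 n h, mul_zero, sub_self]
      rw [Finset.sum_congr rfl this, Finset.sum_sub_distrib, hbal, sub_self]
    have hneg : ∑ n ∈ ns, min (f' n) 0 < 0 := by
      obtain ⟨n, hn, c, hc, h1⟩ := (hns.cover w).1 trivial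
      rw [hker, map_sub, map_smul, smul_eq_mul] at h1
      have hfn : f' n < 0 := by
        by_contra hcon
        have := mul_nonneg hc (not_lt.1 hcon)
        linarith
      refine Finset.sum_neg' (fun i _ => min_le_right _ _) ⟨n, hn, ?_⟩
      exact (min_le_left _ _).trans_lt hfn
    have hc0 : (m z - l z) / f' z = 0 := (mul_eq_zero.1 hzero).resolve_right hneg.ne
    rcases le_total 0 (f' y) with h | h
    · exact hcz y hy h
    · rw [hcz' y hy h]
      have := hml y
      rw [hc0, zero_mul] at this
      linarith

/-- Quasilinear sets on which harmonic functions are linear, closed under isomorphism. -/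
theorem linear_of_harmonic_iso {X' : Set V'} (h : SetIso N X N' X') (hX' : IsTropSet N' d X')
    (hlin : ∀ ψ : V' → ℝ, IsPL N' X' ψ → IsTropSet (N'.prod RealLattice.int) d (modif X' ∅ ψ) →
      ∃ l : V' →ₗ[ℝ] ℝ, LatMap N' RealLattice.int l ∧ ∀ x ∈ X', ψ x = l x)
    (hψ : IsPL N X ψ) (hT : IsTropSet (N.prod RealLattice.int) d (modif X ∅ ψ)) :
    ∃ l : V →ₗ[ℝ] ℝ, LatMap N RealLattice.int l ∧ ∀ x ∈ X, ψ x = l x := by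
  obtain ⟨p, q, h⟩ := h
  obtain ⟨A, hA, hX⟩ := hX'.poly
  obtain ⟨l, hl, h'⟩ := hlin (ψ ∘ q) (hψ.comp hA hX h.lat_symm h.mem_symm)
    (hT.of_iso (h.modif (Set.empty_subset _) (Set.empty_subset _) (by simp) (by simp)
      fun x hx => by simp [h.left_inv x hx]))
  refine ⟨l ∘ₗ p, hl.comp h.lat, fun x hx => ?_⟩
  have := h' (p x) (h.mem x hx)
  simpa [h.left_inv x hx] using this

theorem linear_of_harmonic_subspace {U : Submodule ℝ V} (hU : IsRat N U)
    (hψ : IsPL N (U : Set V) ψ)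
    (hT : IsTropSet (N.prod RealLattice.int) (finrank ℝ U) (modif (U : Set V) ∅ ψ)) :
    ∃ l : V →ₗ[ℝ] ℝ, LatMap N RealLattice.int l ∧ ∀ x ∈ U, ψ x = l x := by
  obtain ⟨NU, -, hiso⟩ := hU.setIso
  refine linear_of_harmonic_iso hiso (isTropSet_univ NU) (fun ψ hψ hT => ?_) hψ hT
  obtain ⟨A, hA, -, hψ⟩ := hψ
  obtain ⟨l, hl, h⟩ := linear_of_harmonic_univ hA hψ hT.balanced
  exact ⟨l, hl, fun x _ => h x⟩

end Harmonic

section HarmonicModif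

variable {V V' : Type u} [AddCommGroup V] [Module ℝ V] [AddCommGroup V'] [Module ℝ V']
variable {N : RealLattice V} {N' : RealLattice V'} {d : ℕ} {X Y E : Set V} {φ ψ : V → ℝ}

/-- The star of the graph of a function is the graph of its derivative. -/
theorem graph_localStar {A : Set (V →ₗ[ℝ] ℝ)} (hA : A.Finite) (hX : IsCellular A X)
    (hψ : IsPLFor N A X ψ) (x : V) :
    localStar (modif X ∅ ψ) (x, ψ x) = modif (localStar X x) ∅ (der ψ x) := by
  rw [modif_localStar hA hX (isCellular_empty _) (Set.empty_subset _) hψ, localStar_empty]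

theorem IsTropSet.graph_star {A : Set (V →ₗ[ℝ] ℝ)} (hA : A.Finite) (hX : IsCellular A X)
    (hψ : IsPLFor N A X ψ) (h : IsTropSet (N.prod RealLattice.int) d (modif X ∅ ψ)) {x : V}
    (hx : x ∈ X) :
    IsTropSet (N.prod RealLattice.int) d (modif (localStar X x) ∅ (der ψ x)) := by
  rw [← graph_localStar hA hX hψ]
  exact h.star (Or.inl ⟨hx, rfl⟩)

theorem isSetIso_graph_prod {X : Set V} {χ : V × ℝ → ℝ} {c : ℝ} (hc : c ∈ RealLattice.int.carrier)
    (hχ : ∀ y ∈ X, ∀ t, χ (y, t) = χ (y, 0) + t * c) :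
    SetIso ((N.prod RealLattice.int).prod RealLattice.int) (modif (X ×ˢ (Set.univ : Set ℝ)) ∅ χ)
      ((N.prod RealLattice.int).prod RealLattice.int)
      (modif X ∅ (fun y => χ (y, 0)) ×ˢ (Set.univ : Set ℝ)) := by
  have h1 : LatMap ((N.prod RealLattice.int).prod RealLattice.int) N
      (LinearMap.fst ℝ V ℝ ∘ₗ LinearMap.fst ℝ (V × ℝ) ℝ) := latMap_fst.comp latMap_fst
  have h2 : LatMap ((N.prod RealLattice.int).prod RealLattice.int) RealLattice.int
      (LinearMap.snd ℝ V ℝ ∘ₗ LinearMap.fst ℝ (V × ℝ) ℝ) := latMap_snd.comp latMap_fst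
  have h3 : LatMap ((N.prod RealLattice.int).prod RealLattice.int) RealLattice.int
      (LinearMap.snd ℝ (V × ℝ) ℝ) := latMap_snd
  refine ⟨((LinearMap.fst ℝ V ℝ ∘ₗ LinearMap.fst ℝ (V × ℝ) ℝ).prod
      (LinearMap.snd ℝ (V × ℝ) ℝ - c • (LinearMap.snd ℝ V ℝ ∘ₗ LinearMap.fst ℝ (V × ℝ) ℝ))).prod
      (LinearMap.snd ℝ V ℝ ∘ₗ LinearMap.fst ℝ (V × ℝ) ℝ),
    ((LinearMap.fst ℝ V ℝ ∘ₗ LinearMap.fst ℝ (V × ℝ) ℝ).prod (LinearMap.snd ℝ (V × ℝ) ℝ)).prod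
      (LinearMap.snd ℝ V ℝ ∘ₗ LinearMap.fst ℝ (V × ℝ) ℝ + c • LinearMap.snd ℝ (V × ℝ) ℝ),
    (h1.prod (h3.sub (h2.smul hc))).prod h2, (h1.prod h3).prod (h2.add (h3.smul hc)), ?_, ?_, ?_, ?_⟩
  · rintro ⟨⟨y, t⟩, r⟩ (⟨⟨hy, -⟩, hr⟩ | ⟨h, -⟩)
    · refine ⟨Or.inl ⟨hy, ?_⟩, trivial⟩
      have hr : r = χ (y, t) := hr
      rw [hχ y hy] at hr
      simp [hr]
      ring
    · exact absurd h (Set.notMem_empty _)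
  · rintro ⟨⟨y, s⟩, t⟩ ⟨(⟨hy, hr⟩ | ⟨h, -⟩), -⟩
    · refine Or.inl ⟨⟨hy, trivial⟩, ?_⟩
      have hr : s = χ (y, 0) := hr
      have := hχ y hy t
      simp [hr, this]
      ring
    · exact absurd h (Set.notMem_empty _)
  · rintro ⟨⟨y, t⟩, r⟩ -
    simp
  · rintro ⟨⟨y, t⟩, r⟩ -
    simp

/-- A harmonic function on a modification is linear on the part above the divisor, if harmonic
functions on the divisor are linear. -/
theorem linear_above_divisor {A : Set (V →ₗ[ℝ] ℝ)} {B : Set (V × ℝ →ₗ[ℝ] ℝ)} (hA : IsRatArr N A)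
    (hY : IsCellular A Y) (hE : IsCellular A E) (hφ : IsPLFor N A Y φ) (hEY : E ⊆ Y)
    (hEt : IsTropSet N d E)
    (hlin : ∀ ψ : V → ℝ, IsPL N E ψ → IsTropSet (N.prod RealLattice.int) d (modif E ∅ ψ) →
      ∃ l : V →ₗ[ℝ] ℝ, LatMap N RealLattice.int l ∧ ∀ x ∈ E, ψ x = l x)
    (hB : IsRatArr (N.prod RealLattice.int) B) (hM : IsCellular B (modif Y E φ)) {ψ : V × ℝ → ℝ}
    (hψ : IsPLFor (N.prod RealLattice.int) B (modif Y E φ) ψ)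
    (hT : IsTropSet ((N.prod RealLattice.int).prod RealLattice.int) (d + 1)
      (modif (modif Y E φ) ∅ ψ)) :
    ∃ l : V × ℝ →ₗ[ℝ] ℝ, LatMap (N.prod RealLattice.int) RealLattice.int l ∧
      ∀ y ∈ E, ∀ t, φ y ≤ t → ψ (y, t) = l (y, t) := by
  have h0E := hEt.zero_mem
  have hφ0 : φ 0 = 0 := hφ.map_zero (hEY h0E)
  have heM : ((0 : V), (1 : ℝ)) ∈ modif Y E φ := Or.inr ⟨h0E, by simp [hφ0]⟩
  have hstar : localStar (modif Y E φ) (0, 1) = E ×ˢ Set.univ := by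
    rw [modif_localStar_upper hA.1 hE hEY hφ hY (by simp [hφ0]), localStar_zero hA.1 hE]
  have heL : ((0 : V), (1 : ℝ)) ∈ (N.prod RealLattice.int).carrier :=
    ⟨zero_mem _, RealLattice.one_mem_int⟩
  set c := ψ (0, 1) with hc
  have hcint : c ∈ RealLattice.int.carrier := hψ.map_lattice heM heL
  obtain ⟨m, -, hm⟩ := hψ _ heM
  have hder : ∀ y ∈ E, ∀ t : ℝ, der ψ (0, 1) (y, t) = der ψ (0, 1) (y, 0) + t * c := by
    intro y hy t
    have hu : t • ((0 : V), (1 : ℝ)) ∈ cellSpan B ((0 : V), (1 : ℝ)) :=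
      Submodule.smul_mem _ _ fun f _ h => h
    have := hψ.der_add hB.1 hm (v := (y, 0)) (by rw [hstar]; exact ⟨hy, trivial⟩) hu zero_le_one
    rw [one_smul, one_mul, map_smul, ← hm _ self_mem_cell, ← hc] at this
    rw [add_comm, ← smul_eq_mul, ← this]
    simp
  have hT1 := hT.graph_star hB.1 hM hψ heM
  rw [hstar] at hT1
  obtain ⟨d', hd', hT2⟩ := (hT1.of_setIso (isSetIso_graph_prod hcint hder)).cancel
  rw [finrank_self] at hd'
  obtain rfl : d' = d := by omega
  have hPL : IsPL (N.prod RealLattice.int) (E ×ˢ (Set.univ : Set ℝ)) (der ψ (0, 1)) := by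
    rw [← hstar]
    exact ⟨B, hB, hM.star hB.1 _, hψ.star hB.1 _⟩
  obtain ⟨lE, hlE, hlE'⟩ := hlin _ (hPL.comp hA hE latMap_inl fun x hx => ⟨hx, trivial⟩) hT2
  simp only [Function.comp_apply, LinearMap.inl_apply] at hlE'
  let l : V × ℝ →ₗ[ℝ] ℝ := lE ∘ₗ LinearMap.fst ℝ V ℝ + c • LinearMap.snd ℝ V ℝ
  have hl : ∀ y t, l (y, t) = lE y + c * t := fun y t => by simp [l]
  have hupper : ∀ y ∈ E, ∀ t, φ y ≤ t → (y, t) ∈ modif Y E φ := fun y hy t ht => Or.inr ⟨hy, ht⟩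
  have hfar : ∀ y ∈ E, ∃ S, ∀ s, S ≤ s → ψ (y, s) = lE y + c * s := by
    intro y hy
    have hv : (y, (0 : ℝ)) ∈ localStar (modif Y E φ) (0, 1) := by rw [hstar]; exact ⟨hy, trivial⟩
    obtain ⟨ε, hε, h⟩ := exists_of_eventually ((hψ.eventually_der hB.1 hv).and (mem_localStar.1 hv))
    refine ⟨1 / ε, fun s hs => ?_⟩
    have hs0 : 0 < s := lt_of_lt_of_le (by positivity) hs
    have hst : 1 / s ≤ ε := by
      rw [div_le_iff₀ hs0]; rwa [div_le_iff₀ hε, mul_comm] at hs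
    obtain ⟨h1, h2⟩ := h (1 / s) (by positivity) hst
    have e : (y, s) = s • (((0 : V), (1 : ℝ)) + (1 / s) • (y, (0 : ℝ))) := by
      ext
      · simp [smul_smul, hs0.ne']
      · simp
    rw [e, hψ.map_smul h2 hs0.le, h1, hlE' y hy, ← hc]
    field_simp
    ring
  have htop : ∀ y ∈ E, finrank ℝ (cellSpan A y) = d' → ∀ t, φ y ≤ t → ψ (y, t) = l (y, t) := by
    intro y hy hd
    have hU : localStar E y = cellSpan A y := localStar_eq_cellSpan N hA.1 hE
      (fun x hx => hEt.pure.finrank_cellSpan_le N hA.1 hE hx) hy hd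
    have hopen : ∀ s, φ y < s → ψ (y, s) = lE y + c * s := by
      refine eq_affine_of_locally (h := fun s => ψ (y, s)) (fun s hs => ?_) (hfar y hy)
      have hstar' : localStar (modif Y E φ) (y, s) =
          ((cellSpan A y).prod ⊤ : Submodule ℝ (V × ℝ)) := by
        rw [modif_localStar_upper hA.1 hE hEY hφ hY hs, hU]
        rfl
      have hT3 := hT.graph_star hB.1 hM hψ (hupper y hy s hs.le)
      have hP3 := hψ.star hB.1 (y, s)
      have hC3 := hM.star hB.1 (y, s)
      rw [hstar'] at hT3 hP3 hC3
      have hfin : finrank ℝ ((cellSpan A y).prod ⊤ : Submodule ℝ (V × ℝ)) = d' + 1 := by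
        rw [finrank_prod_submodule N RealLattice.int, hd, finrank_top, finrank_self]
      obtain ⟨m, -, hm⟩ := linear_of_harmonic_subspace
        ((isRat_cellSpan hA y).prod isRat_top) ⟨B, hB, hC3, hP3⟩ (by rwa [hfin])
      have hv : ∀ r : ℝ, ((0 : V), r) ∈ ((cellSpan A y).prod ⊤ : Submodule ℝ (V × ℝ)) :=
        fun r => ⟨zero_mem _, trivial⟩
      have hev : ∀ r : ℝ, ∀ᶠ t : ℝ in 𝓝[>] 0, ψ (y, s + t * r) = ψ (y, s) + t * m (0, r) := by
        intro r
        have := hψ.eventually_der hB.1 (x := (y, s)) (v := (0, r)) (by rw [hstar']; exact hv r)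
        rw [hm _ (hv r)] at this
        simpa using this
      refine ⟨m (0, 1), ((hev 1).and (hev (-1))).mono fun t ht => ?_⟩
      have e : m ((0 : V), (-1 : ℝ)) = - m (0, 1) := by rw [← map_neg]; simp
      rw [e] at ht
      constructor
      · simpa using ht.1
      · have := ht.2
        rw [mul_neg_one, ← sub_eq_add_neg, mul_neg, ← sub_eq_add_neg] at this
        exact this
    intro t ht
    rw [hl]
    rcases ht.eq_or_lt with rfl | ht
    · have h1 := hψ.eventually_der hB.1 (x := (y, φ y)) (v := ((0 : V), (1 : ℝ)))
        (eventually_pos.mono fun t ht => by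
          simpa using hupper y hy (φ y + t) (by linarith))
      have h2 : ∀ᶠ t : ℝ in 𝓝[>] 0, ψ (y, φ y) + t * der ψ (y, φ y) (0, 1) =
          (lE y + c * φ y) + t * c := by
        filter_upwards [h1, eventually_pos] with t h1 ht
        rw [← h1]
        have := hopen (φ y + t) (by linarith)
        simp only [Prod.smul_mk, smul_zero, smul_eq_mul, mul_one, Prod.mk_add_mk, add_zero, this]
        ring
      exact (affine_eq h2).1
    · exact hopen t ht
  refine ⟨l, (hlE.comp latMap_fst).add (latMap_snd.smul hcint), fun y hy t ht => ?_⟩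
  obtain ⟨z, hz, hyz, hd⟩ := hEt.pure.exists_cell hA.1 hE hy
  obtain ⟨k, -, hk⟩ := hφ z (hEY hz)
  have hkey : ∀ᶠ τ : ℝ in 𝓝[>] 0, y + τ • (z - y) ∈ E ∧
      finrank ℝ (cellSpan A (y + τ • (z - y))) = d' ∧
      φ (y + τ • (z - y)) = φ y + τ * (φ z - φ y) := by
    refine (eventually_signs hA.1 y (z - y)).mono fun τ hτ => ?_
    have hs : ∀ f ∈ A, SignEq (f z) (f (y + τ • (z - y))) := fun f hf =>
      (lexSign_sub_of_mem_cell hyz f hf).signEq (hτ f hf)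
    have hcell := mem_of_signEq hs
    refine ⟨(hE.mem_iff hs).1 hz, ?_, ?_⟩
    · have e : cellSpan A (y + τ • (z - y)) = cellSpan A z := le_antisymm (cellSpan_mono hcell)
        (cellSpan_mono (mem_of_signEq fun f hf => (hs f hf).symm))
      rw [e, hd]
    · rw [hk _ hcell, hk _ hyz, hk _ self_mem_cell]
      simp
  have hp : ∀ᶠ τ : ℝ in 𝓝[>] 0, (y, t) + τ • (z - y, φ z - φ y) ∈ modif Y E φ ∧
      ψ ((y, t) + τ • (z - y, φ z - φ y)) = l (y, t) + τ * l (z - y, φ z - φ y) := by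
    refine hkey.mono fun τ ⟨h1, h2, h3⟩ => ?_
    have h4 : φ (y + τ • (z - y)) ≤ t + τ * (φ z - φ y) := by rw [h3]; linarith
    refine ⟨hupper _ h1 _ h4, ?_⟩
    have := htop _ h1 h2 _ h4
    rw [← smul_eq_mul (a := τ) (b := l _), ← map_smul, ← map_add]
    exact this
  have h2 := hψ.eventually_der hB.1 (x := (y, t)) (v := (z - y, φ z - φ y)) (hp.mono fun _ h => h.1)
  have h3 : ∀ᶠ τ : ℝ in 𝓝[>] 0, ψ (y, t) + τ * der ψ (y, t) (z - y, φ z - φ y) =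
      l (y, t) + τ * l (z - y, φ z - φ y) := (h2.and hp).mono fun τ h => by rw [← h.1, h.2.2]
  exact (affine_eq h3).1

/-- A harmonic function on a modification that vanishes above the divisor restricts to a harmonic
function on the graph. -/
theorem harmonic_base {A : Set (V →ₗ[ℝ] ℝ)} {B : Set (V × ℝ →ₗ[ℝ] ℝ)} (hA : IsRatArr N A)
    (hY : IsCellular A Y) (hE : IsCellular A E) (hφ : IsPLFor N A Y φ) (hEY : E ⊆ Y)
    (hYt : IsTropSet N (d + 1) Y) (hEt : IsTropSet N d E)
    (hMt : IsTropSet (N.prod RealLattice.int) (d + 1) (modif Y E φ))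
    (hB : IsRatArr (N.prod RealLattice.int) B) (hM : IsCellular B (modif Y E φ)) {ψ : V × ℝ → ℝ}
    (hψ : IsPLFor (N.prod RealLattice.int) B (modif Y E φ) ψ)
    (hT : IsTropSet ((N.prod RealLattice.int).prod RealLattice.int) (d + 1)
      (modif (modif Y E φ) ∅ ψ))
    (hzero : ∀ y ∈ E, ∀ t, φ y ≤ t → ψ (y, t) = 0) :
    IsPL N Y (fun y => ψ (y, φ y)) ∧
      IsTropSet (N.prod RealLattice.int) (d + 1) (modif Y ∅ fun y => ψ (y, φ y)) := by
  obtain ⟨C, hC, hφC⟩ := hφ.exists_finite hA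
  let A' : Set (V →ₗ[ℝ] ℝ) := A ∪ Set.image2 (fun b l => b ∘ₗ graphMap l) B C
  have hA' : IsRatArr N A' := hA.union ⟨hB.1.image2 _ hC.1, by
    rintro _ ⟨b, hb, l, hl, rfl⟩
    exact (hB.2 b hb).comp (latMap_graphMap (hC.2 l hl))⟩
  have hAA' : A ⊆ A' := Set.subset_union_left
  have hcell : ∀ y ∈ Y, ∀ w ∈ cell A' y, (w, φ w) ∈ cell B (y, φ y) := by
    intro y hy w hw b hb
    obtain ⟨l, hl, hlφ⟩ := hφC y hy
    have := hw _ (Or.inr ⟨b, hb, l, hl, rfl⟩)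
    rw [hlφ y self_mem_cell, hlφ w (cell_anti hAA' hw)]
    exact this
  have hmemM : ∀ y ∈ Y, (y, φ y) ∈ modif Y E φ := fun y hy => Or.inl ⟨hy, rfl⟩
  have hχ : IsPLFor N A' Y fun y => ψ (y, φ y) := by
    intro y hy
    obtain ⟨l, hl, hlφ⟩ := hφC y hy
    obtain ⟨m, hm, hmψ⟩ := hψ _ (hmemM y hy)
    refine ⟨m ∘ₗ graphMap l, hm.comp (latMap_graphMap (hC.2 l hl)), fun w hw => ?_⟩
    show ψ (w, φ w) = m (w, l w)
    rw [hmψ _ (hcell y hy w hw), hlφ w (cell_anti hAA' hw)]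
  refine ⟨⟨A', hA', hY.mono hAA', hχ⟩, isTropSet_graph hYt hA' (hY.mono hAA') hχ ?_⟩
  intro D hD hDr y hy hd l₀ hl₀ hl₀χ s hs hsum
  have hd' : finrank ℝ (cellSpan D y) = d := by omega
  have hAD := hAA'.trans hD
  have hYD := hY.mono hAD
  have hED := hE.mono hAD
  have hφD := hφ.mono hAD
  obtain ⟨l, hl, hlφ⟩ := hφC y hy
  obtain ⟨m, hm, hmψ⟩ := hψ _ (hmemM y hy)
  have hlφD : ∀ z ∈ cell D y, φ z = l z := fun z hz => hlφ z (cell_anti hAD hz)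
  obtain ⟨T, hT', hTder⟩ : ∃ T : Finset (V × ℝ),
      ((localStar E y = ∅ ∧ T = ∅) ∨ (localStar E y = (cellSpan D y : Set V) ∧ T = {(0, 1)})) ∧
      ∑ z ∈ T, der ψ (y, φ y) z = 0 := by
    by_cases hyE : y ∈ E
    · refine ⟨{(0, 1)}, Or.inr ⟨localStar_eq_cellSpan N hDr.1 hED
        (fun x hx => hEt.pure.finrank_cellSpan_le N hDr.1 hED hx) hyE hd', rfl⟩, ?_⟩
      rw [Finset.sum_singleton]
      refine der_eq (eventually_pos.mono fun t ht => ?_)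
      rw [hzero y hyE _ le_rfl]
      simpa using hzero y hyE (φ y + t) (by linarith)
    · refine ⟨∅, Or.inl ⟨?_, rfl⟩, by simp⟩
      exact Set.eq_empty_of_forall_notMem fun v hv => hyE (mem_of_mem_localStar hED hDr.1 hv)
  obtain ⟨s', hs'mem, hs', hs'sum, hs'tot⟩ := modif_star_normals hDr.1 hYD hED hEY hφD hy (hC.2 l hl)
    hlφD le_rfl hs hT'
  have hbal := (modif_balance hDr.1 hMt.balanced hYD hED hEY hφD hy (hC.2 l hl)
    hlφD le_rfl (isRat_cellSpan hDr y) hd hs hT').2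
  have hle : (cellSpan D y).map (graphMap l) ≤ cellSpan B (y, φ y) := by
    rintro _ ⟨v, hv, rfl⟩ b hb h0
    refine hv _ (hD (Or.inr ⟨b, hb, l, hl, rfl⟩)) ?_
    rwa [hlφ y self_mem_cell] at h0
  have hbal2 := (modif_balance (T := ∅) hB.1 hT.balanced hM (isCellular_empty _) (Set.empty_subset _)
    hψ (hmemM y hy) hm hmψ hle ((isRat_cellSpan hDr y).map (latMap_graphMap (hC.2 l hl)))
    (by rw [finrank_map_graphMap, hd]) hs' (Or.inl ⟨localStar_empty, rfl⟩)).2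
  rw [Finset.sum_empty, add_zero, hs'sum, hTder, add_zero, hs'tot] at hbal2
  have hchain : ∀ n ∈ s, der ψ (y, φ y) (n, der φ y n) = der (fun y => ψ (y, φ y)) y n := by
    intro n hn
    refine (der_eq ?_).symm
    have h1 := hφ.eventually_der hA.1 (hs.mem hn)
    have h2 := hψ.eventually_der hB.1 (hs'.mem ((hs'mem _).2 (Or.inl ⟨n, hn, rfl⟩)))
    filter_upwards [h1, h2] with t h1 h2
    rw [h1, ← h2]
    rfl
  rw [Finset.sum_congr rfl hchain] at hbal2
  rw [hbal2]
  have e : (∑ n ∈ s, n, ∑ n ∈ s, der φ y n) + ∑ z ∈ T, z = graphMap l (∑ n ∈ s, n) := by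
    rw [graphMap_apply, ← hbal]
    rcases hT' with ⟨-, rfl⟩ | ⟨-, rfl⟩ <;> simp
  rw [e]
  refine eqOn_cellSpan (l := m ∘ₗ graphMap l) hDr.1 (fun z hz => ?_) hsum
  rw [← hl₀χ z hz, LinearMap.comp_apply, graphMap_apply, ← hlφD z hz,
    hmψ _ (hcell y hy z (cell_anti hD hz))]

/-- Harmonic piecewise integral linear functions on quasilinear sets are linear. -/
theorem QLSet.linear_of_harmonic (h : QLSet N d X) (hψ : IsPL N X ψ)
    (hT : IsTropSet (N.prod RealLattice.int) d (_root_.modif X ∅ ψ)) :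
    ∃ l : V →ₗ[ℝ] ℝ, LatMap N RealLattice.int l ∧ ∀ x ∈ X, ψ x = l x := by
  induction h with
  | complete N =>
    obtain ⟨A, hA, -, hψ⟩ := hψ
    obtain ⟨l, hl, h⟩ := linear_of_harmonic_univ hA hψ hT.balanced
    exact ⟨l, hl, fun x _ => h x⟩
  | iso h hiso ih => exact linear_of_harmonic_iso hiso h.isTropSet (fun _ h1 h2 => ih h1 h2) hψ hT
  | @modif V _ _ N d Y E φ hY hE hEY hφ hM ihY ihE =>
    obtain ⟨A, hA, hYA, hEA, hφ⟩ := hφ.exists_common hE.isTropSet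
    obtain ⟨B, hB, hMB, hψ⟩ := hψ
    obtain ⟨l, hl, h⟩ := linear_above_divisor hA hYA hEA hφ hEY hE.isTropSet
      (fun _ h1 h2 => ihE h1 h2) hB hMB hψ hT
    have h1 := harmonic_base hA hYA hEA hφ hEY hY.isTropSet hE.isTropSet hM hB hMB (hψ.sub_linear hl)
      (hT.of_iso (isSetIso_shear hl _ _ _)) fun y hy t ht => sub_eq_zero.2 (h y hy t ht)
    obtain ⟨l', hl', h'⟩ := ihY h1.1 h1.2
    refine ⟨l + l' ∘ₗ LinearMap.fst ℝ V ℝ, hl.add (hl'.comp latMap_fst), ?_⟩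
    rintro ⟨y, t⟩ hz
    have hbase : ∀ y ∈ Y, ψ (y, φ y) - l (y, φ y) = l' y := h'
    rw [LinearMap.add_apply, LinearMap.comp_apply, LinearMap.fst_apply]
    rcases hz with ⟨hy, ht⟩ | ⟨hy, ht⟩
    · have ht : t = φ y := ht
      rw [ht, ← hbase y hy]
      ring
    · rw [← hbase y (hEY hy), h y hy t ht, h y hy _ le_rfl]
      ring

end HarmonicModif

/-! ### Products, stars and factors of quasilinear sets -/

section IsoProd

variable {V V' W W' : Type*} [AddCommGroup V] [Module ℝ V] [AddCommGroup V'] [Module ℝ V']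
  [AddCommGroup W] [Module ℝ W] [AddCommGroup W'] [Module ℝ W']
variable {N : RealLattice V} {N' : RealLattice V'} {M : RealLattice W} {M' : RealLattice W'}

theorem SetIso.prod {X : Set V} {X' : Set V'} {Z : Set W} {Z' : Set W'} (h : SetIso N X N' X')
    (h' : SetIso M Z M' Z') : SetIso (N.prod M) (X ×ˢ Z) (N'.prod M') (X' ×ˢ Z') := by
  obtain ⟨p, q, h⟩ := h
  obtain ⟨p', q', h'⟩ := h'
  exact ⟨p.prodMap p', q.prodMap q', fun z hz => ⟨h.lat _ hz.1, h'.lat _ hz.2⟩,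
    fun z hz => ⟨h.lat_symm _ hz.1, h'.lat_symm _ hz.2⟩,
    fun z hz => ⟨h.mem _ hz.1, h'.mem _ hz.2⟩, fun z hz => ⟨h.mem_symm _ hz.1, h'.mem_symm _ hz.2⟩,
    fun z hz => Prod.ext (h.left_inv _ hz.1) (h'.left_inv _ hz.2),
    fun z hz => Prod.ext (h.right_inv _ hz.1) (h'.right_inv _ hz.2)⟩

theorem setIso_swap (N : RealLattice V) (M : RealLattice W) (X : Set V) (Z : Set W) :
    SetIso (N.prod M) (X ×ˢ Z) (M.prod N) (Z ×ˢ X) :=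
  ⟨(LinearMap.snd ℝ V W).prod (LinearMap.fst ℝ V W), (LinearMap.snd ℝ W V).prod (LinearMap.fst ℝ W V),
    fun _ h => ⟨h.2, h.1⟩, fun _ h => ⟨h.2, h.1⟩, fun _ h => ⟨h.2, h.1⟩, fun _ h => ⟨h.2, h.1⟩,
    fun _ _ => rfl, fun _ _ => rfl⟩

theorem setIso_modif_prod (N : RealLattice V) (M : RealLattice W) (Y E : Set V) (φ : V → ℝ)
    (Z : Set W) :
    SetIso ((N.prod RealLattice.int).prod M) (modif Y E φ ×ˢ Z) ((N.prod M).prod RealLattice.int)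
      (modif (Y ×ˢ Z) (E ×ˢ Z) (φ ∘ LinearMap.fst ℝ V W)) := by
  refine ⟨((LinearMap.fst ℝ V ℝ ∘ₗ LinearMap.fst ℝ (V × ℝ) W).prod (LinearMap.snd ℝ (V × ℝ) W)).prod
      (LinearMap.snd ℝ V ℝ ∘ₗ LinearMap.fst ℝ (V × ℝ) W),
    ((LinearMap.fst ℝ V W ∘ₗ LinearMap.fst ℝ (V × W) ℝ).prod (LinearMap.snd ℝ (V × W) ℝ)).prod
      (LinearMap.snd ℝ V W ∘ₗ LinearMap.fst ℝ (V × W) ℝ),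
    fun _ h => ⟨⟨h.1.1, h.2⟩, h.1.2⟩, fun _ h => ⟨⟨h.1.1, h.2⟩, h.1.2⟩, ?_, ?_,
    fun _ _ => rfl, fun _ _ => rfl⟩
  · rintro z ⟨h1 | h1, h2⟩
    · exact Or.inl ⟨⟨h1.1, h2⟩, h1.2⟩
    · exact Or.inr ⟨⟨h1.1, h2⟩, h1.2⟩
  · rintro z (⟨h1, h2⟩ | ⟨h1, h2⟩)
    · exact ⟨Or.inl ⟨h1.1, h2⟩, h1.2⟩
    · exact ⟨Or.inr ⟨h1.1, h2⟩, h1.2⟩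

end IsoProd

section Quasilinear

theorem QLSet.prod_of_univ_prod {V : Type u} [AddCommGroup V] [Module ℝ V] {N : RealLattice V}
    {X : Set V} {d : ℕ} (hX : QLSet N d X) {W : Type v} [AddCommGroup W] [Module ℝ W]
    {M : RealLattice W} {Z : Set W} {e : ℕ} (hZ : IsTropSet M e Z)
    (huniv : ∀ {V' : Type u} [AddCommGroup V'] [Module ℝ V'] (N' : RealLattice V'),
      QLSet (N'.prod M) (finrank ℝ V' + e) ((Set.univ : Set V') ×ˢ Z)) :
    QLSet (N.prod M) (d + e) (X ×ˢ Z) := by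
  induction hX with
  | complete N => exact huniv N
  | iso _ h ih => exact ih.iso (h.prod (SetIso.refl _ _))
  | @modif V _ _ N d Y E φ hY hE hEY hφ hM ihY ihE =>
    have hiso := setIso_modif_prod N M Y E φ Z
    have e1 : d + 1 + e = d + e + 1 := by omega
    rw [e1] at ihY ⊢
    obtain ⟨A, hA, hYA, -⟩ := hφ.exists_common hE.isTropSet
    obtain ⟨B, hB, hZB⟩ := hZ.poly
    have hT := (hM.prod hZ).of_setIso hiso
    rw [e1] at hT
    exact (QLSet.modif ihY ihE (fun z hz => ⟨hEY hz.1, hz.2⟩)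
      (hφ.comp (hA.prod hB) (hYA.prod hZB) latMap_fst fun x hx => hx.1) hT).iso hiso

variable {V V' W : Type u} [AddCommGroup V] [Module ℝ V] [AddCommGroup V'] [Module ℝ V']
  [AddCommGroup W] [Module ℝ W]
variable {N : RealLattice V} {N' : RealLattice V'} {M : RealLattice W} {d e : ℕ}
  {X Y E : Set V} {Z : Set W} {φ : V → ℝ} {x : V}

theorem QLSet.prod_univ {V : Type u} [AddCommGroup V] [Module ℝ V] {N : RealLattice V}
    {X : Set V} {d : ℕ} (hX : QLSet N d X) {W : Type v} [AddCommGroup W] [Module ℝ W]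
    (M : RealLattice W) : QLSet (N.prod M) (d + finrank ℝ W) (X ×ˢ (Set.univ : Set W)) := by
  refine hX.prod_of_univ_prod (isTropSet_univ M) fun {V'} _ _ N' => ?_
  have := N'.finite
  have := M.finite
  rw [Set.univ_prod_univ, ← finrank_prod]
  exact QLSet.complete _

theorem QLSet.prod (hX : QLSet N d X) (hZ : QLSet M e Z) : QLSet (N.prod M) (d + e) (X ×ˢ Z) := by
  refine hX.prod_of_univ_prod hZ.isTropSet fun {V'} _ _ N' => ?_
  rw [add_comm]
  exact (hZ.prod_univ N').iso (setIso_swap _ _ _ _)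

theorem qlSet_subspace {U : Submodule ℝ V} (hU : IsRat N U) : QLSet N (finrank ℝ U) (U : Set V) := by
  obtain ⟨NU, -, h⟩ := hU.setIso
  exact (QLSet.complete NU).iso h

theorem QLSet.star (hX : QLSet N d X) (hx : x ∈ X) : QLSet N d (localStar X x) := by
  induction hX with
  | complete N =>
    rw [localStar_univ]
    exact QLSet.complete N
  | iso _ h ih =>
    obtain ⟨p, q, h⟩ := h
    exact (ih (h.mem _ hx)).iso ⟨p, q, h.star hx⟩
  | @modif V _ _ N d Y E φ hY hE hEY hφ hM ihY ihE =>
    obtain ⟨A, hA, hYA, hEA, hφA⟩ := hφ.exists_common hE.isTropSet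
    have hMs := hM.star hx
    obtain ⟨y, s⟩ := x
    have hyY : y ∈ Y := hx.elim (fun h => h.1) fun h => hEY h.1
    have hle : φ y ≤ s := hx.elim (fun h => h.2.ge) fun h => h.2
    rcases hle.eq_or_lt with rfl | hlt
    · have hPL : IsPL N (localStar Y y) (der φ y) := ⟨A, hA, hYA.star hA.1 y, hφA.star hA.1 y⟩
      rw [modif_localStar hA.1 hYA hEA hEY hφA] at hMs ⊢
      by_cases hyE : y ∈ E
      · exact QLSet.modif (ihY hyY) (ihE hyE) (localStar_mono hEY) hPL hMs
      · have he : localStar E y = ∅ :=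
          Set.eq_empty_of_forall_notMem fun v hv => hyE (mem_of_mem_localStar hEA hA.1 hv)
        rw [he] at hMs ⊢
        obtain ⟨l, hl, hlφ⟩ := (ihY hyY).linear_of_harmonic hPL hMs
        refine (ihY hyY).iso ⟨LinearMap.fst ℝ V ℝ, graphMap l, latMap_fst, latMap_graphMap hl, ?_, ?_, ?_,
          fun _ _ => rfl⟩
        · rintro z (h | h)
          · exact h.1
          · exact absurd h.1 (Set.notMem_empty _)
        · exact fun v hv => Or.inl ⟨hv, (hlφ v hv).symm⟩
        · rintro z (h | h)
          · exact Prod.ext rfl (((hlφ _ h.1).symm).trans h.2.symm)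
          · exact absurd h.1 (Set.notMem_empty _)
    · rw [modif_localStar_upper hA.1 hEA hEY hφA hYA hlt]
      have hyE : y ∈ E := hx.elim (fun h => absurd h.2 hlt.ne') fun h => h.1
      have := (ihE hyE).prod_univ RealLattice.int
      rwa [finrank_self] at this

/-- If the graph-like set `modif Y E φ` is invariant under the translations by a lattice splitting
off `W`, then so are the base, the divisor and the function. -/
theorem exists_splitting (hφ : IsPL N Y φ) (h0 : (0 : V) ∈ Y) (hEY : E ⊆ Y) (X : Set V')
    (h0X : (0 : V') ∈ X) {p : V × ℝ →ₗ[ℝ] V' × W} {q : V' × W →ₗ[ℝ] V × ℝ}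
    (h : IsSetIso (N.prod RealLattice.int) (modif Y E φ) (N'.prod M) (X ×ˢ (Set.univ : Set W)) p q) :
    ∃ (k : W →ₗ[ℝ] V) (c : W →ₗ[ℝ] ℝ) (g : V →ₗ[ℝ] W), LatMap M N k ∧ LatMap M RealLattice.int c ∧
      LatMap N M g ∧ (∀ w, g (k w) = w) ∧ (∀ w, q (0, w) = (k w, c w)) ∧
      (∀ y ∈ Y, ∀ w, y + k w ∈ Y ∧ φ (y + k w) = φ y + c w) ∧ ∀ y ∈ E, ∀ w, y + k w ∈ E := by
  obtain ⟨A, hA, hYA, hφA⟩ := hφ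
  have hφ0 := hφA.map_zero h0
  let k : W →ₗ[ℝ] V := LinearMap.fst ℝ V ℝ ∘ₗ q ∘ₗ LinearMap.inr ℝ V' W
  let c : W →ₗ[ℝ] ℝ := LinearMap.snd ℝ V ℝ ∘ₗ q ∘ₗ LinearMap.inr ℝ V' W
  have hk : LatMap M N k := latMap_fst.comp (h.lat_symm.comp latMap_inr)
  have hc : LatMap M RealLattice.int c := latMap_snd.comp (h.lat_symm.comp latMap_inr)
  have hq : ∀ w, q (0, w) = (k w, c w) := fun w => rfl
  have hp : ∀ w, p (k w, c w) = (0, w) := fun w => by rw [← hq, h.right_inv _ ⟨h0X, trivial⟩]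
  have htrans : ∀ z ∈ modif Y E φ, ∀ w, z + (k w, c w) ∈ modif Y E φ := by
    intro z hz w
    have := h.mem_symm ((p z).1, (p z).2 + w) ⟨(h.mem z hz).1, trivial⟩
    have e : ((p z).1, (p z).2 + w) = p z + (0, w) := by ext <;> simp
    rwa [e, map_add, h.left_inv z hz, hq] at this
  have hfst : ∀ z ∈ modif Y E φ, z.1 ∈ Y ∧ φ z.1 ≤ z.2 := fun z hz =>
    hz.elim (fun h => ⟨h.1, h.2.ge⟩) fun h => ⟨hEY h.1, h.2⟩
  have hYinv : ∀ y ∈ Y, ∀ w, y + k w ∈ Y ∧ φ (y + k w) = φ y + c w := by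
    intro y hy w
    have h1 := hfst _ (htrans (y, φ y) (Or.inl ⟨hy, rfl⟩) w)
    have h2 := hfst _ (htrans (y + k w, φ (y + k w)) (Or.inl ⟨h1.1, rfl⟩) (-w))
    simp only [Prod.mk_add_mk, map_neg, add_neg_cancel_right] at h1 h2
    exact ⟨h1.1, by linarith [h1.2, h2.2]⟩
  have hcφ : ∀ w, k w ∈ Y ∧ φ (k w) = c w := fun w => by
    have := hYinv 0 h0 w
    rwa [zero_add, hφ0, zero_add] at this
  have hinj : ∀ w, k w = 0 → w = 0 := by
    intro w hw
    have h1 := hp w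
    rw [← (hcφ w).2, hw, hφ0] at h1
    have h2 : p (0, 0) = 0 := _root_.map_zero p
    exact (Prod.ext_iff.1 (h1.symm.trans h2)).2
  have hlat : ∀ w, k w ∈ N.carrier → w ∈ M.carrier := by
    intro w hw
    have h1 : c w ∈ RealLattice.int.carrier := by
      rw [← (hcφ w).2]
      exact hφA.map_lattice (hcφ w).1 hw
    have h2 := h.lat (k w, c w) ⟨hw, h1⟩
    rw [hp] at h2
    exact h2.2
  obtain ⟨j, hj⟩ := LinearMap.exists_leftInverse_of_injective k (LinearMap.ker_eq_bot'.2 hinj)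
  have hj' : ∀ w, j (k w) = w := fun w => LinearMap.congr_fun hj w
  obtain ⟨r, hr, hrK, hrid⟩ := ((isRat_top (N := M)).map hk).exists_retraction
  refine ⟨k, c, j ∘ₗ r, hk, hc, fun x hx => ?_, fun w => ?_, hq, hYinv, fun y hy w => ?_⟩
  · obtain ⟨w, -, hw⟩ := hrK x
    rw [LinearMap.comp_apply, ← hw, hj']
    exact hlat w (hw ▸ hr x hx)
  · rw [LinearMap.comp_apply, hrid (k w) ⟨w, trivial, rfl⟩, hj']
  · have h1 := htrans (y, φ y + 1) (Or.inr ⟨hy, by simp⟩) w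
    rcases h1 with ⟨-, h2⟩ | h2
    · have h2 : φ y + 1 + c w = φ (y + k w) := h2
      rw [(hYinv y (hEY hy) w).2] at h2
      linarith
    · exact h2.1

theorem setIso_split {k : W →ₗ[ℝ] V} {g : V →ₗ[ℝ] W} (hk : LatMap M N k) (hg : LatMap N M g)
    (hgk : ∀ w, g (k w) = w) (hY : ∀ y ∈ Y, ∀ w, y + k w ∈ Y) :
    SetIso N Y (N.prod M) ((Y ∩ {y | g y = 0}) ×ˢ (Set.univ : Set W)) := by
  refine ⟨(LinearMap.id - k ∘ₗ g).prod g, LinearMap.fst ℝ V W + k ∘ₗ LinearMap.snd ℝ V W,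
    (latMap_id.sub (hk.comp hg)).prod hg, latMap_fst.add (hk.comp latMap_snd), ?_, ?_, ?_, ?_⟩
  · intro y hy
    refine ⟨⟨?_, ?_⟩, trivial⟩
    · simpa [sub_eq_add_neg] using hY y hy (-(g y))
    · simp [hgk]
  · rintro ⟨y, w⟩ ⟨⟨hy, -⟩, -⟩
    simpa using hY y hy w
  · intro y hy
    simp
  · rintro ⟨y, w⟩ ⟨⟨-, hy⟩, -⟩
    have hy : g y = 0 := hy
    simp [hgk, hy]

theorem QLSet.cancel {Z : Set V'} {D : ℕ} (hZ : QLSet N' D Z)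
    (h : SetIso N' Z (N.prod M) (X ×ˢ (Set.univ : Set W))) :
    ∃ d, d + finrank ℝ W = D ∧ QLSet N d X := by
  induction hZ generalizing V with
  | complete N' =>
    obtain ⟨p, q, h⟩ := h
    rw [← Submodule.top_coe (R := ℝ)] at h
    obtain ⟨h1, h2⟩ := h.exists_subspace
    set U := Submodule.map p ⊤ with hU
    have hX : X = (U.map (LinearMap.fst ℝ V W) : Submodule ℝ V) := by
      ext x
      constructor
      · intro hx
        have : (x, (0 : W)) ∈ (U : Set (V × W)) := h2 ▸ ⟨hx, trivial⟩
        exact ⟨_, this, rfl⟩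
      · rintro ⟨z, hz, rfl⟩
        have hz : z ∈ (U : Set (V × W)) := hz
        rw [← h2] at hz
        exact hz.1
    have hrat : IsRat N (U.map (LinearMap.fst ℝ V W)) := (isRat_top.map h.lat).map latMap_fst
    have hprod : U = (U.map (LinearMap.fst ℝ V W)).prod ⊤ := by
      apply SetLike.coe_injective
      rw [← h2, Submodule.prod_coe, ← hX]
      rfl
    refine ⟨finrank ℝ (U.map (LinearMap.fst ℝ V W)), ?_, hX ▸ qlSet_subspace hrat⟩
    rw [hprod, finrank_prod_submodule N M, finrank_top, finrank_top] at h1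
    exact h1
  | iso _ h' ih => exact ih (h'.symm.trans h)
  | @modif V' _ _ N' d Y E φ hY hE hEY hφ hM ihY ihE =>
    have h0X : (0 : V) ∈ X := ((hM.of_setIso h).zero_mem).1
    obtain ⟨p, q, h⟩ := h
    obtain ⟨k, c, g, hk, hc, hg, hgk, hq, hYinv, hEinv⟩ :=
      exists_splitting hφ hY.isTropSet.zero_mem hEY X h0X h
    obtain ⟨d₁, hd₁, hY''⟩ := ihY (setIso_split hk hg hgk fun y hy w => (hYinv y hy w).1)
    obtain ⟨d₂, hd₂, hE''⟩ := ihE (setIso_split hk hg hgk hEinv)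
    obtain rfl : d₁ = d₂ + 1 := by omega
    obtain ⟨A, hA, hYA⟩ := hY''.isTropSet.poly
    have hPL : IsPL N' (Y ∩ {y | g y = 0}) φ :=
      hφ.comp hA hYA latMap_id fun x hx => hx.1
    have hmod : ∀ z w, z ∈ _root_.modif Y E φ → z + (k w, c w) ∈ _root_.modif Y E φ := by
      rintro ⟨y, t⟩ w (⟨hy, ht⟩ | ⟨hy, ht⟩)
      · have ht : t = φ y := ht
        refine Or.inl ⟨(hYinv y hy w).1, ?_⟩
        show t + c w = φ (y + k w)
        rw [(hYinv y hy w).2, ht]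
      · have ht : φ y ≤ t := ht
        refine Or.inr ⟨hEinv y hy w, ?_⟩
        show φ (y + k w) ≤ t + c w
        rw [(hYinv y (hEY hy) w).2]
        linarith
    have hsub : ∀ z, z ∈ _root_.modif (Y ∩ {y | g y = 0}) (E ∩ {y | g y = 0}) φ ↔
        z ∈ _root_.modif Y E φ ∧ g z.1 = 0 := by
      intro z
      constructor
      · rintro (⟨⟨h1, h2⟩, h3⟩ | ⟨⟨h1, h2⟩, h3⟩)
        · exact ⟨Or.inl ⟨h1, h3⟩, h2⟩
        · exact ⟨Or.inr ⟨h1, h3⟩, h2⟩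
      · rintro ⟨⟨h1, h3⟩ | ⟨h1, h3⟩, h2⟩
        · exact Or.inl ⟨⟨h1, h2⟩, h3⟩
        · exact Or.inr ⟨⟨h1, h2⟩, h3⟩
    let π : V' × ℝ →ₗ[ℝ] V' × ℝ := LinearMap.id - (k.prod c) ∘ₗ g ∘ₗ LinearMap.fst ℝ V' ℝ
    have hπ : ∀ z, π z = z - (k (g z.1), c (g z.1)) := fun z => rfl
    have hπL : LatMap (N'.prod RealLattice.int) (N'.prod RealLattice.int) π :=
      latMap_id.sub ((hk.prod hc).comp (hg.comp latMap_fst))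
    have hπmem : ∀ z ∈ _root_.modif Y E φ,
        π z ∈ _root_.modif (Y ∩ {y | g y = 0}) (E ∩ {y | g y = 0}) φ := by
      intro z hz
      rw [hsub, hπ]
      refine ⟨?_, by simp [hgk]⟩
      have := hmod z (-(g z.1)) hz
      rwa [map_neg, map_neg, ← Prod.neg_mk, ← sub_eq_add_neg] at this
    have hT : IsTropSet (N'.prod RealLattice.int) (d₂ + 1)
        (_root_.modif (Y ∩ {y | g y = 0}) (E ∩ {y | g y = 0}) φ) := by
      have hiso : SetIso (N'.prod RealLattice.int) (_root_.modif Y E φ)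
          ((N'.prod RealLattice.int).prod M)
          (_root_.modif (Y ∩ {y | g y = 0}) (E ∩ {y | g y = 0}) φ ×ˢ (Set.univ : Set W)) := by
        refine ⟨π.prod (g ∘ₗ LinearMap.fst ℝ V' ℝ), LinearMap.fst ℝ (V' × ℝ) W +
            (k.prod c) ∘ₗ LinearMap.snd ℝ (V' × ℝ) W, hπL.prod (hg.comp latMap_fst),
          latMap_fst.add ((hk.prod hc).comp latMap_snd), ?_, ?_, ?_, ?_⟩
        · exact fun z hz => ⟨hπmem z hz, trivial⟩
        · exact fun z hz => hmod _ _ ((hsub _).1 hz.1).1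
        · intro z hz
          exact sub_add_cancel z _
        · rintro ⟨z, w⟩ ⟨hz, -⟩
          have h0 : g z.1 = 0 := ((hsub _).1 hz).2
          have e : g (z.1 + k w) = w := by rw [map_add, h0, hgk, zero_add]
          refine Prod.ext ?_ e
          show z + (k w, c w) - (k (g (z.1 + k w)), c (g (z.1 + k w))) = z
          rw [e, add_sub_cancel_right]
      obtain ⟨e', he', hT⟩ := (hM.of_setIso hiso).cancel
      obtain rfl : e' = d₂ + 1 := by omega
      exact hT
    refine ⟨d₂ + 1, hd₁, (QLSet.modif hY'' hE'' (fun z hz => ⟨hEY hz.1, hz.2⟩) hPL hT).iso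
      ⟨π ∘ₗ q ∘ₗ LinearMap.inl ℝ V W, LinearMap.fst ℝ V W ∘ₗ p, hπL.comp (h.lat_symm.comp latMap_inl),
        latMap_fst.comp h.lat, ?_, ?_, ?_, ?_⟩⟩
    · exact fun x hx => hπmem _ (h.mem_symm _ ⟨hx, trivial⟩)
    · exact fun z hz => (h.mem _ ((hsub z).1 hz).1).1
    · intro x hx
      show (p (π (q (x, 0)))).1 = x
      rw [hπ, map_sub, ← hq, h.right_inv _ ⟨hx, trivial⟩, h.right_inv _ ⟨h0X, trivial⟩]
      simp
    · intro z hz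
      obtain ⟨hz1, hz2⟩ := (hsub z).1 hz
      show π (q ((p z).1, 0)) = z
      have e : ((p z).1, (0 : W)) = p z - (0, (p z).2) := by ext <;> simp
      rw [e, map_sub, h.left_inv z hz1, hq, hπ]
      simp [hz2, hgk, sub_sub]

/-- The first factor of a quasilinear product is quasilinear. -/
theorem QLSet.of_prod {D : ℕ} (h : QLSet (N.prod M) D (X ×ˢ Z)) (hX : IsTropSet N d X)
    (hZ : IsTropSet M e Z) : ∃ d, QLSet N d X := by
  obtain ⟨A, hA, hXA⟩ := hX.poly
  obtain ⟨B, hB, hZB⟩ := hZ.poly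
  obtain ⟨z, hz, -, hd⟩ := hZ.pure.exists_cell hB.1 hZB hZ.zero_mem
  have h1 := h.star (x := (0, z)) ⟨hX.zero_mem, hz⟩
  rw [localStar_prod, localStar_zero hA.1 hXA, localStar_eq_cellSpan M hB.1 hZB
    (fun x hx => hZ.pure.finrank_cellSpan_le M hB.1 hZB hx) hz hd] at h1
  obtain ⟨NU, -, hU⟩ := (isRat_cellSpan hB z).setIso
  obtain ⟨d', -, h2⟩ := h1.cancel ((SetIso.refl N X).prod hU)
  exact ⟨d', h2⟩

end Quasilinear

/-! ### Geometry of rational fans -/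

section Cones

variable {V : Type*} [AddCommGroup V] [Module ℝ V] {N : RealLattice V}
variable {σ τ F : PointedCone ℝ V} {x y v w : V}

theorem isFaceOf_of_add (hle : F ≤ σ) (h : ∀ a ∈ σ, ∀ b ∈ σ, a + b ∈ F → a ∈ F) : F.IsFaceOf σ where
  le := hle
  mem_of_smul_add_mem {x y a} hx hy ha hxy := by
    have := F.smul_mem (inv_nonneg.2 ha.le) (h _ (σ.smul_mem ha.le hx) _ hy hxy)
    rwa [smul_smul, inv_mul_cancel₀ ha.ne', one_smul] at this

theorem PointedCone.IsFaceOf.eq_of_relInt (h : F.IsFaceOf σ) (hx : x ∈ coneRelInt σ) (hxF : x ∈ F) :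
    F = σ := by
  refine le_antisymm h.le fun y hy => ?_
  obtain ⟨ε, hε, h'⟩ := hx.2 y hy
  exact h.mem_of_smul_add_mem hy h' hε (by simpa using hxF)

theorem mem_localStar_cone_of_mem (hx : x ∈ σ) (hv : v ∈ σ) : v ∈ localStar (σ : Set V) x :=
  eventually_pos.mono fun _ ht => add_mem hx (σ.smul_mem ht.le hv)

theorem add_mem_localStar_cone (hv : v ∈ localStar (σ : Set V) x) (hw : w ∈ localStar (σ : Set V) x) :
    v + w ∈ localStar (σ : Set V) x := by
  have h1 := smul_mem_localStar hv two_pos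
  have h2 := smul_mem_localStar hw two_pos
  rw [mem_localStar] at h1 h2 ⊢
  filter_upwards [h1, h2] with t h1 h2
  have := add_mem (σ.smul_mem (by norm_num : (0 : ℝ) ≤ 1 / 2) h1)
    (σ.smul_mem (by norm_num : (0 : ℝ) ≤ 1 / 2) h2)
  refine Eq.subst (motive := fun z => z ∈ (σ : Set V)) ?_ this
  module

theorem mem_span_of_mem_localStar (hx : x ∈ σ) (hv : v ∈ localStar (σ : Set V) x) :
    v ∈ Submodule.span ℝ (σ : Set V) := by
  obtain ⟨t, ht, h0⟩ := ((mem_localStar.1 hv).and eventually_pos).exists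
  have h2 := Submodule.sub_mem _ (Submodule.subset_span (R := ℝ) ht)
    (Submodule.subset_span (R := ℝ) (show x ∈ (σ : Set V) from hx))
  rw [add_sub_cancel_left] at h2
  simpa [smul_smul, h0.ne'] using Submodule.smul_mem _ t⁻¹ h2

theorem localStar_of_relInt (hx : x ∈ coneRelInt σ) :
    localStar (σ : Set V) x = Submodule.span ℝ (σ : Set V) :=
  Set.Subset.antisymm (fun _ hv => mem_span_of_mem_localStar hx.1 hv)
    fun _ hv => coneRelInt_eventually hx hv

theorem sub_mem_cone_of_le {ε t : ℝ} (hε : 0 < ε) (hx : x ∈ σ) (h : x - ε • y ∈ σ) (ht : 0 ≤ t)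
    (hte : t ≤ ε) : x - t • y ∈ σ := by
  have e : x - t • y = (1 - t / ε) • x + (t / ε) • (x - ε • y) := by
    match_scalars <;> field_simp <;> ring
  rw [e]
  refine add_mem (σ.smul_mem ?_ hx) (σ.smul_mem (by positivity) h)
  rw [sub_nonneg, div_le_one hε]
  exact hte

theorem neg_mem_localStar_cone {ε : ℝ} (hε : 0 < ε) (hx : x ∈ σ) (h : x - ε • y ∈ σ) :
    -y ∈ localStar (σ : Set V) x := by
  filter_upwards [eventually_pos, eventually_small ε hε] with t h1 h2
  rw [smul_neg, ← sub_eq_add_neg]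
  exact sub_mem_cone_of_le hε hx h h1.le h2.le

theorem coneRelInt_add (hx : x ∈ coneRelInt σ) (hy : y ∈ σ) : x + y ∈ coneRelInt σ := by
  refine ⟨add_mem hx.1 hy, fun z hz => ?_⟩
  obtain ⟨ε, hε, h⟩ := hx.2 z hz
  exact ⟨ε, hε, by rw [add_sub_right_comm]; exact add_mem h hy⟩

theorem coneRelInt_smul (hx : x ∈ coneRelInt σ) {c : ℝ} (hc : 0 < c) : c • x ∈ coneRelInt σ := by
  refine ⟨σ.smul_mem hc.le hx.1, fun z hz => ?_⟩
  obtain ⟨ε, hε, h⟩ := hx.2 z hz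
  exact ⟨c * ε, by positivity, by rw [mul_smul, ← smul_sub]; exact σ.smul_mem hc.le h⟩

/-- Every point of a cone lies in the relative interior of a face. -/
theorem exists_face_relInt (hx : x ∈ σ) : ∃ F : PointedCone ℝ V, F.IsFaceOf σ ∧ x ∈ coneRelInt F := by
  let F : PointedCone ℝ V :=
    { carrier := {y | y ∈ σ ∧ -y ∈ localStar (σ : Set V) x}
      add_mem' := fun {a b} ha hb => ⟨add_mem ha.1 hb.1, by
        rw [neg_add]; exact add_mem_localStar_cone ha.2 hb.2⟩
      zero_mem' := ⟨zero_mem _, by rw [neg_zero]; exact zero_mem_localStar hx⟩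
      smul_mem' := fun c y hy => by
        refine ⟨σ.smul_mem c.2 hy.1, ?_⟩
        rcases c.2.eq_or_lt with h0 | h0
        · have e : c • y = 0 := by
            rw [show c • y = (c : ℝ) • y from rfl, ← h0, zero_smul]
          rw [e, neg_zero]
          exact zero_mem_localStar hx
        · rw [← smul_neg]
          exact smul_mem_localStar hy.2 h0 }
  have hmem : ∀ y, y ∈ F ↔ y ∈ σ ∧ -y ∈ localStar (σ : Set V) x := fun y => Iff.rfl
  refine ⟨F, isFaceOf_of_add (fun y hy => ((hmem y).1 hy).1) fun a ha b hb hab => ?_, ?_, ?_⟩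
  · refine (hmem a).2 ⟨ha, ?_⟩
    have := add_mem_localStar_cone ((hmem _).1 hab).2 (mem_localStar_cone_of_mem hx hb)
    rwa [neg_add_rev, add_comm (-b), neg_add_cancel_right] at this
  · exact (hmem x).2 ⟨hx, neg_mem_localStar_cone one_pos hx (by simp)⟩
  · intro y hy
    obtain ⟨hyσ, hy'⟩ := (hmem y).1 hy
    obtain ⟨t, ht, h0⟩ := ((mem_localStar.1 hy').and eventually_pos).exists
    rw [smul_neg, ← sub_eq_add_neg] at ht
    refine ⟨t, h0, (hmem _).2 ⟨ht, neg_mem_localStar_cone one_pos hx ?_⟩⟩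
    rw [one_smul, sub_sub_cancel]
    exact σ.smul_mem h0.le hyσ

theorem face_span_inter (h : F.IsFaceOf σ) (hx : x ∈ σ) (hx' : x ∈ Submodule.span ℝ (F : Set V)) :
    x ∈ F := by
  obtain ⟨a, ha, b, hb, rfl⟩ := TropicalFan.exists_sub_of_mem_span hx'
  exact h.mem_of_add_mem_left hx (h.le hb) (by simpa using ha)

/-- Lattice normals exist for facets of rational cones. -/
theorem exists_isLatticeNormal (hσ : IsRatCone N σ) (hτ : IsRatCone N τ) (h : τ.IsFaceOf σ)
    (hd : coneDim τ + 1 = coneDim σ) : ∃ n, IsLatticeNormal N σ τ n := by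
  obtain ⟨g, hgN, hgσ, hgτ, -, hgen⟩ := hτ.isRat_span.exists_generator hσ.isRat_span
    (Submodule.span_mono h.le) hd
  obtain ⟨p, hpN, hp⟩ := hσ.exists_interior
  obtain ⟨q, hqN, hq⟩ := hτ.exists_interior
  obtain ⟨k, hk⟩ := hgen p hpN (Submodule.subset_span hp.1)
  have hk0 : k ≠ 0 := by
    rintro rfl
    rw [Int.cast_zero, zero_smul, sub_zero] at hk
    have := h.eq_of_relInt hp (face_span_inter h hp.1 hk)
    rw [this] at hd
    omega
  obtain ⟨s, hs1, hs2⟩ : ∃ s : ℤ, (s = 1 ∨ s = -1) ∧ 0 < s * k := by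
    rcases hk0.lt_or_gt with h0 | h0
    · exact ⟨-1, Or.inr rfl, by linarith⟩
    · exact ⟨1, Or.inl rfl, by linarith⟩
  have hss : s * s = 1 := by rcases hs1 with rfl | rfl <;> rfl
  have hc : (0 : ℝ) < s * k := by exact_mod_cast hs2
  have hss' : (s : ℝ) * s = 1 := by exact_mod_cast hss
  set u := p - (k : ℝ) • g with hu
  obtain ⟨ε, hε, h1⟩ := coneRelInt_add_mem hq (Submodule.neg_mem _ hk)
  obtain ⟨m, hm⟩ := exists_nat_gt (1 / (ε * (s * k)))
  have hm0 : (0 : ℝ) < m := lt_trans (by positivity) hm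
  have h2 := h1 (1 / (m * (s * k))) (by positivity) (by
    rw [div_lt_iff₀ (by positivity)] at hm
    rw [div_le_iff₀ (by positivity)]
    nlinarith)
  refine ⟨s • g + m • q, add_mem (zsmul_mem hgN s) (nsmul_mem hqN m), ?_, ?_⟩
  · have h3 := coneRelInt_add (coneRelInt_smul hp (c := 1 / (s * k)) (by positivity))
      (h.le (τ.smul_mem hm0.le h2))
    have hks : (k : ℝ) = s * (s * k) := by rw [← mul_assoc, hss', one_mul]
    have e : (1 / ((s : ℝ) * k)) • p + (m : ℝ) • (q + (1 / ((m : ℝ) * (s * k))) • -u) =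
        s • g + m • q := by
      rw [hu, ← Int.cast_smul_eq_zsmul ℝ, ← Nat.cast_smul_eq_nsmul ℝ m]
      generalize (s : ℝ) * k = c at hc hks
      rw [hks]
      match_scalars <;> field_simp
      ring
    rwa [e] at h3
  · apply le_antisymm
    · intro x hx
      obtain ⟨hxN, hxσ⟩ := hσ.mem_coneLattice.1 hx
      obtain ⟨j, hj⟩ := hgen x hxN hxσ
      rw [Submodule.mem_sup]
      have hq' : q ∈ coneLattice N τ := Submodule.subset_span ⟨hq.1, hqN⟩
      have hj' : x - j • g ∈ coneLattice N τ := hτ.mem_coneLattice.2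
        ⟨sub_mem hxN (zsmul_mem hgN j), by rwa [← Int.cast_smul_eq_zsmul ℝ]⟩
      refine ⟨x - j • g - (j * s) • (m • q), sub_mem hj' (zsmul_mem (nsmul_mem hq' m) _),
        (j * s) • (s • g + m • q), Submodule.smul_mem _ _ (Submodule.mem_span_singleton_self _), ?_⟩
      rw [smul_add, smul_smul, mul_assoc, hss, mul_one]
      abel
    · refine sup_le (Submodule.span_mono fun x hx => ⟨h.le hx.1, hx.2⟩) ?_
      rw [Submodule.span_singleton_le_iff_mem]
      refine hσ.mem_coneLattice.2 ⟨add_mem (zsmul_mem hgN s) (nsmul_mem hqN m), ?_⟩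
      refine add_mem (zsmul_mem hgσ s) (nsmul_mem (Submodule.subset_span (h.le hq.1)) m)

theorem localStar_cone_normal
    (hd : coneDim τ + 1 = coneDim σ) (h : τ.IsFaceOf σ) (hx : x ∈ coneRelInt τ) {n : V}
    (hn : IsLatticeNormal N σ τ n) :
    n ∉ Submodule.span ℝ (τ : Set V) ∧
    ∀ v, v ∈ localStar (σ : Set V) x ↔ ∃ c : ℝ, 0 ≤ c ∧ v - c • n ∈ Submodule.span ℝ (τ : Set V) := by
  have := N.finite
  have hnτ : n ∉ Submodule.span ℝ (τ : Set V) := fun h' => by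
    have := h.eq_of_relInt hn.2.1 (face_span_inter h hn.2.1.1 h')
    rw [this] at hd
    omega
  refine ⟨hnτ, fun v => ⟨fun hv => ?_, ?_⟩⟩
  · have hvσ := mem_span_of_mem_localStar (h.le hx.1) hv
    have hspan : Submodule.span ℝ (τ : Set V) ⊔ Submodule.span ℝ {n} =
        Submodule.span ℝ (σ : Set V) := by
      refine Submodule.eq_of_le_of_finrank_le (sup_le (Submodule.span_mono h.le) ?_) ?_
      · exact Submodule.span_mono (by simpa using hn.2.1.1)
      · show coneDim σ ≤ _
        rw [← hd]
        exact Submodule.finrank_lt_finrank_of_lt (lt_of_le_of_ne le_sup_left fun h' =>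
          hnτ (h' ▸ Submodule.mem_sup_right (Submodule.mem_span_singleton_self n)))
    rw [← hspan, Submodule.mem_sup] at hvσ
    obtain ⟨u, hu, m, hm, rfl⟩ := hvσ
    obtain ⟨c, rfl⟩ := Submodule.mem_span_singleton.1 hm
    refine ⟨c, ?_, by simpa using hu⟩
    by_contra hc
    push Not at hc
    obtain ⟨t, ⟨h1, h2⟩, h0⟩ :=
      (((mem_localStar.1 hv).and (coneRelInt_eventually hx hu)).and eventually_pos).exists
    have h3 : x + t • u = (t * -c) • n + (x + t • (u + c • n)) := by module
    rw [h3] at h2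
    exact hnτ (Submodule.subset_span
      (h.mem_of_smul_add_mem hn.2.1.1 h1 (mul_pos h0 (neg_pos.2 hc)) h2))
  · rintro ⟨c, hc, hv⟩
    have h1 : v - c • n ∈ localStar (σ : Set V) x :=
      (coneRelInt_eventually hx hv).mono fun t ht => h.le ht
    have := add_mem_localStar_cone h1 (mem_localStar_cone_of_mem (h.le hx.1) (σ.smul_mem hc hn.2.1.1))
    rwa [sub_add_cancel] at this

end Cones

section Fans

variable {V : Type*} [AddCommGroup V] [Module ℝ V] {N : RealLattice V} (S : RatFan N)
variable {σ τ ρ : PointedCone ℝ V} {x y v w : V} {d : ℕ}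

namespace RatFan

theorem exists_relInt (hx : x ∈ S.support) : ∃ τ ∈ S.cones, x ∈ coneRelInt τ := by
  obtain ⟨σ, hσ, hx⟩ := hx
  obtain ⟨F, hF, hxF⟩ := exists_face_relInt hx
  exact ⟨F, S.face_mem σ hσ F hF, hxF⟩

theorem isFaceOf_of_relInt (hτ : τ ∈ S.cones) (hσ : σ ∈ S.cones) (hx : x ∈ coneRelInt τ)
    (hxσ : x ∈ σ) : τ.IsFaceOf σ := by
  have h1 := (S.inter_face τ hτ σ hσ).eq_of_relInt hx ⟨hx.1, hxσ⟩
  have h2 := S.inter_face σ hσ τ hτ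
  rwa [inf_comm, h1] at h2

theorem isFaceOf_of_le (hτ : τ ∈ S.cones) (hσ : σ ∈ S.cones) (h : τ ≤ σ) : τ.IsFaceOf σ := by
  have := S.inter_face σ hσ τ hτ
  rwa [inf_eq_right.2 h] at this

/-- An arrangement subdividing all cones of a fan. -/
theorem exists_arrangement : ∃ A, IsRatArr N A ∧ (∀ σ ∈ S.cones, IsCellular A (σ : Set V)) ∧
    (∀ σ ∈ S.cones, ∀ x ∈ σ, cellSpan A x ≤ Submodule.span ℝ (σ : Set V)) ∧
    IsCellular A S.support := by
  choose! B hB hB' using fun σ (hσ : σ ∈ S.cones) => IsRatCone.exists_inequalities (S.rational σ hσ)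
  let A := ⋃ σ ∈ S.cones, B σ
  have hA : IsRatArr N A := by
    refine ⟨S.cones.finite_toSet.biUnion fun σ hσ => (hB σ hσ).1, fun f hf => ?_⟩
    simp only [A, Set.mem_iUnion] at hf
    obtain ⟨σ, hσ, hf⟩ := hf
    exact (hB σ hσ).2 f hf
  have hmem : ∀ σ ∈ S.cones, ∀ f ∈ B σ, f ∈ A := fun σ hσ f hf => Set.mem_biUnion hσ hf
  have hcell : ∀ σ ∈ S.cones, IsCellular A (σ : Set V) := fun σ hσ x hx y hy =>
    (hB' σ hσ y).2 fun f hf => (hy f (hmem σ hσ f hf)).1 ((hB' σ hσ x).1 hx f hf)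
  refine ⟨A, hA, hcell, fun σ hσ x hx v hv => mem_span_of_mem_localStar hx ?_, ?_⟩
  · refine (eventually_signs hA.1 x v).mono fun t ht => (hB' σ hσ _).2 fun f hf => ?_
    have h1 := ht f (hmem σ hσ f hf)
    have h2 := hv f (hmem σ hσ f hf)
    have h3 := (hB' σ hσ x).1 hx f hf
    unfold LexSign at h1
    grind
  · rintro x ⟨σ, hσ, hx⟩ y hy
    exact ⟨σ, hσ, hcell σ hσ x hx y hy⟩

theorem mem_localStar_support (hτ : τ ∈ S.cones) (hx : x ∈ coneRelInt τ) :
    v ∈ localStar S.support x ↔ ∃ σ ∈ S.cones, τ.IsFaceOf σ ∧ v ∈ localStar (σ : Set V) x := by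
  obtain ⟨A, hA, hAσ, -, -⟩ := S.exists_arrangement
  constructor
  · intro hv
    by_contra hcon
    push Not at hcon
    have h1 : ∀ σ ∈ S.cones, ∀ᶠ t : ℝ in 𝓝[>] 0, x + t • v ∉ (σ : Set V) := by
      intro σ hσ
      refine notMem_localStar hA.1 (hAσ σ hσ) fun h => ?_
      have hxσ : x ∈ σ := mem_of_mem_localStar (hAσ σ hσ) hA.1 h
      exact hcon σ hσ (S.isFaceOf_of_relInt hτ hσ hx hxσ) h
    obtain ⟨t, ht, σ, hσ, h2⟩ := (((Finset.eventually_all S.cones).2 h1).and hv).exists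
    exact ht σ hσ h2
  · rintro ⟨σ, hσ, -, h⟩
    exact (mem_localStar.1 h).mono fun t ht => ⟨σ, hσ, ht⟩

theorem localStar_support_of_maximal (hτ : τ ∈ S.cones) (hx : x ∈ coneRelInt τ)
    (hmax : ∀ σ ∈ S.cones, τ ≤ σ → σ = τ) :
    localStar S.support x = Submodule.span ℝ (τ : Set V) := by
  ext v
  rw [S.mem_localStar_support hτ hx, ← localStar_of_relInt hx]
  constructor
  · rintro ⟨σ, hσ, h, hv⟩
    rwa [hmax σ hσ h.le] at hv
  · exact fun hv => ⟨τ, hτ, PointedCone.IsFaceOf.refl _, hv⟩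

/-- All maximal cones of the fan have dimension `d`. -/
def IsPure (d : ℕ) : Prop := ∀ σ ∈ S.cones, ∃ σ' ∈ S.cones, coneDim σ' = d ∧ σ ≤ σ'

variable {S}

theorem IsPure.coneDim_le (h : S.IsPure d) (hσ : σ ∈ S.cones) : coneDim σ ≤ d := by
  obtain ⟨σ', -, hd, hle⟩ := h σ hσ
  exact hd ▸ TropicalFan.coneDim_mono N hle

theorem IsPure.eq_of_le (h : S.IsPure d) (hτ : τ ∈ S.cones) (hd : coneDim τ = d) (hσ : σ ∈ S.cones)
    (hle : τ ≤ σ) : σ = τ := by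
  refine (TropicalFan.eq_of_isFaceOf_of_coneDim_eq N (S.isFaceOf_of_le hτ hσ hle) ?_).symm
  exact le_antisymm (TropicalFan.coneDim_mono N hle) (hd ▸ h.coneDim_le hσ)

theorem IsPure.isPureSet (h : S.IsPure d) : IsPureSet d S.support := by
  rintro x ⟨σ₀, hσ₀, hx⟩
  obtain ⟨σ, hσ, hd, hle⟩ := h σ₀ hσ₀
  obtain ⟨p, -, hp⟩ := IsRatCone.exists_interior (S.rational σ hσ)
  obtain ⟨A, hA, -, -, hSA⟩ := S.exists_arrangement
  refine ⟨p, eventually_pos.mono fun t ht => ⟨σ, hσ, add_mem (hle hx) (σ.smul_mem ht.le hp.1)⟩,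
    Submodule.span ℝ (σ : Set V), hd, ?_⟩
  obtain ⟨t, ht, h0⟩ := ((eventually_localStar_localStar hA.1 hSA x p).and eventually_pos).exists
  rw [ht]
  refine S.localStar_support_of_maximal hσ ?_ fun σ' hσ' => h.eq_of_le hσ hd hσ'
  rw [add_comm]
  exact coneRelInt_add (coneRelInt_smul hp h0) (hle hx)

theorem isPure_of_isPureSet (h : IsPureSet d S.support) : S.IsPure d := by
  intro σ hσ
  obtain ⟨ρ, hle, hρ⟩ := S.cones.exists_le_maximal hσ
  obtain ⟨p, -, hp⟩ := IsRatCone.exists_interior (S.rational ρ hρ.1)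
  have e := S.localStar_support_of_maximal hρ.1 hp fun σ' hσ' hle' =>
    le_antisymm (hρ.2 hσ' hle') hle'
  obtain ⟨v, hv, U, hU, h'⟩ := h p ⟨ρ, hρ.1, hp.1⟩
  rw [e] at hv h'
  rw [localStar_subspace _ hv] at h'
  exact ⟨ρ, hρ.1, by rw [← hU, ← SetLike.coe_injective h']; rfl, hle⟩

open Classical in
/-- The lattice normals at a cone of codimension one are normals of the star of the support. -/
theorem IsPure.isNormals (h : S.IsPure d) (hτ : τ ∈ S.cones) (hd : coneDim τ + 1 = d)
    (hx : x ∈ coneRelInt τ) {n : PointedCone ℝ V → V}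
    (hn : ∀ σ ∈ S.conesAbove d τ, IsLatticeNormal N σ τ (n σ)) :
    IsNormals N (Submodule.span ℝ (τ : Set V)) (localStar S.support x) ((S.conesAbove d τ).image n) ∧
      Set.InjOn n (S.conesAbove d τ) := by
  have key : ∀ σ ∈ S.conesAbove d τ, ∀ σ' ∈ S.conesAbove d τ, ∀ c : ℝ, 0 ≤ c →
      n σ - c • n σ' ∈ Submodule.span ℝ (τ : Set V) → σ = σ' := by
    intro σ hσ σ' hσ' c hc hcn
    obtain ⟨h1, h1d, h1f⟩ := TropicalFan.mem_conesAbove.1 hσ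
    obtain ⟨h2, h2d, h2f⟩ := TropicalFan.mem_conesAbove.1 hσ'
    have hnσ := (localStar_cone_normal (hd.trans h1d.symm) h1f hx (hn σ hσ)).1
    have hc0 : 0 < c := hc.lt_of_ne fun h0 => by
      rw [← h0, zero_smul, sub_zero] at hcn
      exact hnσ hcn
    obtain ⟨t, ht, h0⟩ := ((coneRelInt_eventually hx hcn).and eventually_pos).exists
    have e : x + t • n σ = (x + t • (n σ - c • n σ')) + (t * c) • n σ' := by module
    have hr1 : x + t • n σ ∈ coneRelInt σ := by
      rw [add_comm]
      exact coneRelInt_add (coneRelInt_smul (hn σ hσ).2.1 h0) (h1f.le hx.1)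
    have hr2 : x + t • n σ ∈ coneRelInt σ' := by
      rw [e, add_comm]
      exact coneRelInt_add (coneRelInt_smul (hn σ' hσ').2.1 (mul_pos h0 hc0)) (h2f.le ht)
    exact le_antisymm (S.isFaceOf_of_relInt h1 h2 hr1 hr2.1).le
      (S.isFaceOf_of_relInt h2 h1 hr2 hr1.1).le
  have hspec : ∀ σ ∈ S.conesAbove d τ, n σ ∉ Submodule.span ℝ (τ : Set V) ∧
      ∀ v, v ∈ localStar (σ : Set V) x ↔
        ∃ c : ℝ, 0 ≤ c ∧ v - c • n σ ∈ Submodule.span ℝ (τ : Set V) := fun σ hσ => by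
    obtain ⟨h1, h1d, h1f⟩ := TropicalFan.mem_conesAbove.1 hσ
    exact localStar_cone_normal (hd.trans h1d.symm) h1f hx (hn σ hσ)
  refine ⟨⟨?_, ?_, ?_, ?_, ?_⟩, fun σ hσ σ' hσ' he => key σ hσ σ' hσ' 1 zero_le_one ?_⟩
  · simp only [Finset.forall_mem_image]
    exact fun σ hσ => (hn σ hσ).1
  · simp only [Finset.forall_mem_image]
    exact fun σ hσ => (hspec σ hσ).1
  · simp only [Finset.forall_mem_image]
    intro σ hσ y hy c hc
    obtain ⟨h1, h1d, h1f⟩ := TropicalFan.mem_conesAbove.1 hσ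
    have hyσ : y ∈ coneLattice N σ := by
      refine (IsRatCone.mem_coneLattice (S.rational σ h1)).2 ⟨hy, ?_⟩
      have := add_mem (Submodule.span_mono (R := ℝ) h1f.le hc)
        (Submodule.smul_mem _ c (Submodule.subset_span (R := ℝ) (hn σ hσ).2.1.1))
      rwa [sub_add_cancel] at this
    rw [(hn σ hσ).2.2, Submodule.mem_sup] at hyσ
    obtain ⟨a, ha, m, hm, rfl⟩ := hyσ
    obtain ⟨k, rfl⟩ := Submodule.mem_span_singleton.1 hm
    refine ⟨k, ?_⟩
    have ha' := ((IsRatCone.mem_coneLattice (S.rational τ hτ)).1 ha).2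
    have h3 := sub_mem hc ha'
    have e : a + k • n σ - c • n σ - a = ((k : ℝ) - c) • n σ := by
      rw [← Int.cast_smul_eq_zsmul ℝ]; module
    rw [e] at h3
    by_contra hne
    exact (hspec σ hσ).1 ((Submodule.smul_mem_iff _ (sub_ne_zero.2 hne)).1 h3)
  · intro z
    rw [S.mem_localStar_support hτ hx]
    simp only [Finset.exists_mem_image]
    constructor
    · rintro ⟨σ, hσ, hf, hz⟩
      obtain ⟨σ', hσ', hd', hle⟩ := h σ hσ
      have hmem : σ' ∈ S.conesAbove d τ := TropicalFan.mem_conesAbove.2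
        ⟨hσ', hd', hf.trans (S.isFaceOf_of_le hσ hσ' hle)⟩
      exact ⟨σ', hmem, ((hspec σ' hmem).2 z).1 (localStar_mono hle hz)⟩
    · rintro ⟨σ, hσ, hz⟩
      obtain ⟨h1, -, h1f⟩ := TropicalFan.mem_conesAbove.1 hσ
      exact ⟨σ, h1, h1f, ((hspec σ hσ).2 z).2 hz⟩
  · simp only [Finset.forall_mem_image]
    exact fun σ hσ σ' hσ' c hc hcn => by rw [key σ hσ σ' hσ' c hc hcn]
  · rw [he, one_smul, sub_self]
    exact zero_mem _

theorem exists_latticeNormal (hτ : τ ∈ S.cones) (hd : coneDim τ + 1 = d)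
    (hσ : σ ∈ S.conesAbove d τ) : ∃ n, IsLatticeNormal N σ τ n := by
  obtain ⟨h1, h1d, h1f⟩ := TropicalFan.mem_conesAbove.1 hσ
  exact exists_isLatticeNormal (S.rational σ h1) (S.rational τ hτ) h1f (hd.trans h1d.symm)

theorem latticeNormal_spec (hτ : τ ∈ S.cones) (hd : coneDim τ + 1 = d)
    (hσ : σ ∈ S.conesAbove d τ) : IsLatticeNormal N σ τ (latticeNormal N σ τ) :=
  Classical.epsilon_spec (exists_latticeNormal hτ hd hσ)

end RatFan

theorem TropicalFan.isPureSet (S : TropicalFan N) : IsPureSet S.dim S.support :=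
  RatFan.IsPure.isPureSet (S := S.toRatFan) S.pure

/-- The support of a reduced tropical fan is a tropical set. -/
theorem TropicalFan.IsReduced.isTropSet {S : TropicalFan N} (hS : S.IsReduced) :
    IsTropSet N S.dim S.support := by
  classical
  have := N.finite
  have hp : S.toRatFan.IsPure S.dim := S.pure
  obtain ⟨A, hA, hAσ, hspan, hSA⟩ := S.toRatFan.exists_arrangement
  have hle : ∀ x ∈ S.support, finrank ℝ (cellSpan A x) ≤ S.dim := by
    rintro x ⟨σ, hσ, hx⟩
    exact (Submodule.finrank_mono (hspan σ hσ x hx)).trans (S.coneDim_le hσ)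
  refine isTropSet_of_cells hA hSA ?_ (fun x hx => S.isPureSet.exists_cell hA.1 hSA hx) hle ?_
  · obtain ⟨σ, hσ⟩ := S.nonempty
    exact ⟨0, σ, hσ, zero_mem σ⟩
  intro x hx hd
  obtain ⟨τ, hτ, hxτ⟩ := S.toRatFan.exists_relInt hx
  have h1 := hspan τ hτ x hxτ.1
  have h2 := Submodule.finrank_mono h1
  have h3 := S.coneDim_le hτ
  have h4 : finrank ℝ (Submodule.span ℝ (τ : Set V)) = coneDim τ := rfl
  rcases h3.eq_or_lt with h5 | h5
  · rw [S.toRatFan.localStar_support_of_maximal hτ hxτ fun σ hσ => hp.eq_of_le hτ h5 hσ]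
    exact exists_normals_of_hyperplane (isRat_cellSpan hA x)
      (IsRatCone.isRat_span (S.rational τ hτ)) h1 (by omega)
  · have h6 : coneDim τ + 1 = S.dim := by omega
    have h7 : cellSpan A x = Submodule.span ℝ (τ : Set V) :=
      Submodule.eq_of_le_of_finrank_eq h1 (by omega)
    rw [h7]
    have hn := fun σ hσ => RatFan.latticeNormal_spec (σ := σ) hτ h6 hσ
    obtain ⟨hN, hinj⟩ := hp.isNormals hτ h6 hxτ (n := fun σ => latticeNormal N σ τ) hn
    refine ⟨_, hN, ?_⟩
    rw [Finset.sum_image hinj]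
    have hbal := S.balanced τ hτ h6 _ hn
    have hsum : ∑ σ ∈ S.conesAbove S.dim τ, (S.weight σ : ℕ) • latticeNormal N σ τ =
        ∑ σ ∈ S.conesAbove S.dim τ, latticeNormal N σ τ := by
      refine Finset.sum_congr rfl fun σ hσ => ?_
      obtain ⟨h8, h9, -⟩ := TropicalFan.mem_conesAbove.1 hσ
      rw [hS σ h8 h9, PNat.one_coe, one_smul]
    rw [hsum] at hbal
    exact ((IsRatCone.mem_coneLattice (S.rational τ hτ)).1 hbal).2

end Fans

/-! ### Supports of quasilinear cycles are quasilinear sets -/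

section Supports

variable {V W : Type*} [AddCommGroup V] [Module ℝ V] [AddCommGroup W] [Module ℝ W]
variable {N : RealLattice V} {N' : RealLattice W}

theorem TropicalFan.TropEquiv.support_eq {S S' : TropicalFan N} (h : S.TropEquiv S') :
    S.support = S'.support ∧ S.dim = S'.dim := by
  obtain ⟨T, h, h'⟩ := h
  exact ⟨h.support_eq.symm.trans h'.support_eq, h.dim_eq.symm.trans h'.dim_eq⟩

theorem FanCycle.support_eq {S S' : TropicalFan N} {F : FanCycle N} (h : F.IsFanStructure S)
    (h' : F.IsFanStructure S') : S.support = S'.support ∧ S.dim = S'.dim := by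
  have e : (Quot.mk _ S : FanCycle N) = Quot.mk _ S' := Eq.trans h (Eq.symm h')
  have := congrArg (Quot.lift (fun S : TropicalFan N => (S.support, S.dim))
    fun _ _ h => Prod.ext h.support_eq.1 h.support_eq.2) e
  exact ⟨congrArg Prod.fst this, congrArg Prod.snd this⟩

theorem IsTropSet.dim_unique {X : Set V} {d d' : ℕ} (h : IsTropSet N d X) (h' : IsPureSet d' X) :
    d = d' := by
  obtain ⟨A, hA, hX⟩ := h.poly
  obtain ⟨x, hx⟩ := h.nonempty
  obtain ⟨z, hz, -, hd⟩ := h.pure.exists_cell hA.1 hX hx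
  obtain ⟨z', hz', -, hd'⟩ := h'.exists_cell hA.1 hX hx
  have h1 := h'.finrank_cellSpan_le N hA.1 hX hz
  have h2 := h.pure.finrank_cellSpan_le N hA.1 hX hz'
  omega

theorem RatFan.isRat_span_support (S : RatFan N) : IsRat N (Submodule.span ℝ S.support) := by
  refine Submodule.span_le.2 ?_
  rintro x ⟨σ, hσ, hx⟩
  have h1 := IsRatCone.isRat_span (S.rational σ hσ)
  have h2 : Submodule.span ℝ (σ : Set V) ≤ Submodule.span ℝ S.support :=
    Submodule.span_mono fun z hz => ⟨σ, hσ, hz⟩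
  have h3 := h1 (Submodule.subset_span hx)
  refine Submodule.span_mono (s := {y | y ∈ Submodule.span ℝ (σ : Set V) ∧ y ∈ N.carrier}) ?_ h3
  exact fun y hy => ⟨h2 hy.1, hy.2⟩

theorem TropicalFan.Iso.setIso {S : TropicalFan N} {S' : TropicalFan N'} (e : S.Iso S') :
    SetIso N S.support N' S'.support := by
  obtain ⟨r, hr, hrU, hrid⟩ := S.toRatFan.isRat_span_support.exists_retraction
  obtain ⟨r', hr', hrU', hrid'⟩ := S'.toRatFan.isRat_span_support.exists_retraction
  have h1 : ∀ x ∈ S.support, ∀ hx : x ∈ Submodule.span ℝ S.support,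
      (e.toLinearEquiv ⟨x, hx⟩ : W) ∈ S'.support := by
    rintro x ⟨σ, hσ, hxσ⟩ hx
    obtain ⟨σ', hσ', h⟩ := e.map_cone σ hσ
    exact ⟨σ', hσ', (h ⟨x, hx⟩).2 hxσ⟩
  have h2 : ∀ x ∈ S'.support, ∀ hx : x ∈ Submodule.span ℝ S'.support,
      (e.toLinearEquiv.symm ⟨x, hx⟩ : V) ∈ S.support := by
    rintro x ⟨σ', hσ', hxσ⟩ hx
    obtain ⟨σ, hσ, h⟩ := e.comap_cone σ' hσ'
    refine ⟨σ, hσ, (h _).1 ?_⟩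
    rwa [LinearEquiv.apply_symm_apply]
  refine ⟨(Submodule.subtype _ ∘ₗ e.toLinearEquiv.toLinearMap) ∘ₗ r.codRestrict _ hrU,
    (Submodule.subtype _ ∘ₗ e.toLinearEquiv.symm.toLinearMap) ∘ₗ r'.codRestrict _ hrU',
    fun x hx => (e.mem_lattice_iff _).2 (hr x hx), fun x hx => ?_, fun x hx => ?_, fun x hx => ?_,
    fun x hx => ?_, fun x hx => ?_⟩
  · refine (e.mem_lattice_iff _).1 ?_
    show ((e.toLinearEquiv (e.toLinearEquiv.symm _) : Submodule.span ℝ S'.support) : W) ∈ N'.carrier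
    rw [LinearEquiv.apply_symm_apply]
    exact hr' x hx
  · have hx' := Submodule.subset_span (R := ℝ) hx
    have := h1 _ hx hx'
    have e1 : r.codRestrict _ hrU x = ⟨x, hx'⟩ := Subtype.ext (hrid x hx')
    rwa [← e1] at this
  · have hx' := Submodule.subset_span (R := ℝ) hx
    have := h2 _ hx hx'
    have e1 : r'.codRestrict _ hrU' x = ⟨x, hx'⟩ := Subtype.ext (hrid' x hx')
    rwa [← e1] at this
  · have hx' := Submodule.subset_span (R := ℝ) hx
    simp only [LinearMap.comp_apply, Submodule.subtype_apply, LinearEquiv.coe_coe]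
    have e1 : r.codRestrict _ hrU x = ⟨x, hx'⟩ := Subtype.ext (hrid x hx')
    rw [e1]
    have e2 : r'.codRestrict _ hrU' (e.toLinearEquiv ⟨x, hx'⟩ : W) = e.toLinearEquiv ⟨x, hx'⟩ :=
      Subtype.ext (hrid' _ (Subtype.prop _))
    rw [e2, LinearEquiv.symm_apply_apply]
  · have hx' := Submodule.subset_span (R := ℝ) hx
    simp only [LinearMap.comp_apply, Submodule.subtype_apply, LinearEquiv.coe_coe]
    have e1 : r'.codRestrict _ hrU' x = ⟨x, hx'⟩ := Subtype.ext (hrid' x hx')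
    rw [e1]
    have e2 : r.codRestrict _ hrU (e.toLinearEquiv.symm ⟨x, hx'⟩ : V) =
        e.toLinearEquiv.symm ⟨x, hx'⟩ := Subtype.ext (hrid _ (Subtype.prop _))
    rw [e2, LinearEquiv.apply_symm_apply]

theorem PLFunction.isPL {S : RatFan N} (φ : PLFunction S) : IsPL N S.support φ.toFun := by
  obtain ⟨A, hA, hAσ, -, hSA⟩ := S.exists_arrangement
  refine ⟨A, hA, hSA, ?_⟩
  rintro x ⟨σ, hσ, hx⟩
  have hrat : IsRatCone N σ := S.rational σ hσ
  obtain ⟨r, hr, hrU, hrid⟩ := hrat.isRat_span.exists_retraction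
  refine ⟨φ.lin σ ∘ₗ r, fun y hy => ?_, fun y hy => ?_⟩
  · obtain ⟨k, hk⟩ := φ.integral σ hσ (r y) (hrat.mem_coneLattice.2 ⟨hr y hy, hrU y⟩)
    exact RealLattice.mem_int.2 ⟨k, hk.symm⟩
  · have hyσ := hAσ σ hσ x hx y hy
    rw [φ.eq_lin σ hσ y hyσ, LinearMap.comp_apply, hrid y (Submodule.subset_span hyσ)]

namespace PLFunction

variable {S : TropicalFan N} (φ : PLFunction S.toRatFan)

theorem mem_graphCone {σ : PointedCone ℝ V} {z : V × ℝ} :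
    z ∈ φ.graphCone σ ↔ z.1 ∈ σ ∧ z.2 = φ.lin σ z.1 := by
  unfold graphCone
  rw [PointedCone.mem_map]
  constructor
  · rintro ⟨x, hx, rfl⟩
    exact ⟨hx, rfl⟩
  · rintro ⟨h1, h2⟩
    exact ⟨z.1, h1, Prod.ext rfl h2.symm⟩

theorem mem_upperCone {σ : PointedCone ℝ V} {z : V × ℝ} :
    z ∈ φ.upperCone σ ↔ z.1 ∈ σ ∧ φ.lin σ z.1 ≤ z.2 := by
  unfold upperCone
  rw [Submodule.mem_sup]
  constructor
  · rintro ⟨y, hy, w, hw, rfl⟩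
    obtain ⟨h1, h2⟩ := φ.mem_graphCone.1 hy
    obtain ⟨c, rfl⟩ := Submodule.mem_span_singleton.1 hw
    have e : c • ((0 : V), (1 : ℝ)) = (0, (c : ℝ)) := by
      show (c : ℝ) • ((0 : V), (1 : ℝ)) = (0, (c : ℝ))
      rw [Prod.smul_mk, smul_zero, smul_eq_mul, mul_one]
    rw [e]
    refine ⟨by simpa using h1, ?_⟩
    simp only [Prod.fst_add, Prod.snd_add, add_zero, h2]
    linarith [c.2]
  · rintro ⟨h1, h2⟩
    refine ⟨(z.1, φ.lin σ z.1), φ.mem_graphCone.2 ⟨h1, rfl⟩, (0, z.2 - φ.lin σ z.1), ?_, by ext <;> simp⟩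
    refine Submodule.mem_span_singleton.2 ⟨⟨z.2 - φ.lin σ z.1, sub_nonneg.2 h2⟩, ?_⟩
    show (z.2 - φ.lin σ z.1) • ((0 : V), (1 : ℝ)) = _
    simp

variable {φ}

theorem divCones_subset {ρ : PointedCone ℝ V} (h : ρ ∈ φ.divCones) : ρ ∈ S.cones := by
  obtain ⟨τ, hτ, -, -, hρ⟩ := h
  exact S.face_mem τ hτ ρ hρ

theorem IsDivisor.mem_cones {Δ : TropicalFan N} (h : φ.IsDivisor Δ) {ρ : PointedCone ℝ V} :
    ρ ∈ Δ.cones ↔ ρ ∈ φ.divCones := by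
  rw [← h.cones_eq]
  exact Iff.rfl

theorem IsModification.mem_cones {T : TropicalFan (N.prod RealLattice.int)} (h : φ.IsModification T)
    {κ : PointedCone ℝ (V × ℝ)} :
    κ ∈ T.cones ↔ (∃ σ ∈ S.cones, φ.graphCone σ = κ) ∨ ∃ ρ ∈ φ.divCones, φ.upperCone ρ = κ := by
  have := Set.ext_iff.1 h.cones_eq κ
  exact this

theorem IsModification.support_eq {Δ : TropicalFan N} {T : TropicalFan (N.prod RealLattice.int)}
    (h : φ.IsModification T) (hΔ : φ.IsDivisor Δ) :
    T.support = modif S.support Δ.support φ.toFun := by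
  ext z
  constructor
  · rintro ⟨κ, hκ, hz⟩
    rcases h.mem_cones.1 hκ with ⟨σ, hσ, rfl⟩ | ⟨ρ, hρ, rfl⟩
    · obtain ⟨h1, h2⟩ := φ.mem_graphCone.1 hz
      exact Or.inl ⟨⟨σ, hσ, h1⟩, by rw [h2, φ.eq_lin σ hσ _ h1]⟩
    · obtain ⟨h1, h2⟩ := φ.mem_upperCone.1 hz
      exact Or.inr ⟨⟨ρ, hΔ.mem_cones.2 hρ, h1⟩, by rwa [φ.eq_lin ρ (divCones_subset hρ) _ h1]⟩
  · rintro (⟨⟨σ, hσ, h1⟩, h2⟩ | ⟨⟨ρ, hρ, h1⟩, h2⟩)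
    · exact ⟨φ.graphCone σ, h.mem_cones.2 (Or.inl ⟨σ, hσ, rfl⟩),
        φ.mem_graphCone.2 ⟨h1, by rw [h2, φ.eq_lin σ hσ _ h1]⟩⟩
    · have hρ' := hΔ.mem_cones.1 hρ
      exact ⟨φ.upperCone ρ, h.mem_cones.2 (Or.inr ⟨ρ, hρ', rfl⟩),
        φ.mem_upperCone.2 ⟨h1, by rwa [← φ.eq_lin ρ (divCones_subset hρ') _ h1]⟩⟩

end PLFunction

end Supports

theorem FanCycle.IsIsomorphic.setIso {V W : Type*} [AddCommGroup V] [Module ℝ V] [AddCommGroup W]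
    [Module ℝ W] {N : RealLattice V} {N' : RealLattice W} {F : FanCycle N} {G : FanCycle N'}
    (h : F.IsIsomorphic G) {S : TropicalFan N} {S' : TropicalFan N'} (hS : F.IsFanStructure S)
    (hS' : G.IsFanStructure S') : SetIso N S.support N' S'.support := by
  obtain ⟨S₁, S₁', h1, h1', ⟨e⟩⟩ := h
  rw [(FanCycle.support_eq hS h1).1, (FanCycle.support_eq hS' h1').1]
  exact e.setIso

/-- Every fan structure on a quasilinear cycle is supported on a quasilinear set. -/
theorem FanCycle.IsQuasilinear.qlSet {V : Type u} [AddCommGroup V] [Module ℝ V]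
    {N : RealLattice V} {F : FanCycle N} (h : F.IsQuasilinear) {S : TropicalFan N}
    (hS : F.IsFanStructure S) : QLSet N S.dim S.support := by
  suffices h : ∃ d, QLSet N d S.support by
    obtain ⟨d, h⟩ := h
    rwa [h.isTropSet.dim_unique S.isPureSet] at h
  induction h with
  | of_complete F G hF hG hFG =>
    obtain ⟨S', hS', hc⟩ := hG
    have := hFG.setIso hS hS'
    rw [show S'.support = Set.univ from hc] at this
    exact ⟨_, (QLSet.complete _).iso this⟩
  | of_modification F G D M hF _ _ hM hFM ihG ihD =>
    obtain ⟨S', φ, Δ, T, hS', hΔ, hΔD, hT, hTM⟩ := hM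
    obtain ⟨S₀, hS₀, hred⟩ := hF
    obtain ⟨d₁, hQ⟩ := ihG hS'
    obtain ⟨d₂, hD⟩ := ihD hΔD
    obtain rfl := hQ.isTropSet.dim_unique S'.isPureSet
    obtain rfl := hD.isTropSet.dim_unique Δ.isPureSet
    have hTt := hred.isTropSet.of_setIso (hFM.setIso hS₀ hTM)
    rw [hTt.dim_unique T.isPureSet, hT.dim_eq, hT.support_eq hΔ, ← hΔ.dim_eq] at hTt
    rw [← hΔ.dim_eq] at hQ
    have hsub : Δ.support ⊆ S'.support := by
      rintro x ⟨ρ, hρ, hx⟩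
      exact ⟨ρ, PLFunction.divCones_subset (hΔ.mem_cones.1 hρ), hx⟩
    have hiso := hFM.setIso hS hTM
    rw [hT.support_eq hΔ] at hiso
    exact ⟨_, (QLSet.modif hQ hD hsub φ.isPL hTt).iso hiso⟩

/-! ### Fan structures on tropical sets -/

section CellSystems

variable {V W : Type*} [AddCommGroup V] [Module ℝ V] [AddCommGroup W] [Module ℝ W]
variable {N : RealLattice V} {N' : RealLattice W}

/-- A decomposition of `X` into the relative interiors of the cones `C x`, closed under faces. -/
structure IsCellSystem (N : RealLattice V) (X : Set V) (C : V → PointedCone ℝ V) : Prop where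
  finite : (C '' X).Finite
  subset : ∀ x ∈ X, ∀ y ∈ C x, y ∈ X
  rational : ∀ x ∈ X, IsRatCone N (C x)
  stronglyConvex : ∀ x ∈ X, ∀ y ∈ C x, -y ∈ C x → y = 0
  relInt : ∀ x ∈ X, x ∈ coneRelInt (C x)
  face : ∀ x ∈ X, ∀ y ∈ C x, (C y).IsFaceOf (C x)

variable {X : Set V} {C : V → PointedCone ℝ V}

theorem IsCellSystem.exists_eq (h : IsCellSystem N X C) {K : PointedCone ℝ V} {x : V} (hx : x ∈ X)
    (hK : K ≤ C x) (hKC : ∀ y ∈ K, C y ≤ K) : ∃ y ∈ X, K = C y := by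
  have hKX : ∀ y ∈ K, y ∈ X := fun y hy => h.subset x hx y (hK hy)
  obtain ⟨_, ⟨⟨y, hy, rfl⟩, hmax⟩⟩ := (h.finite.subset (Set.image_mono hKX)).exists_maximal
    (Set.Nonempty.image C ⟨0, zero_mem K⟩)
  refine ⟨y, hKX y hy, le_antisymm (fun z hz => ?_) (hKC y hy)⟩
  have hyz : y + z ∈ K := add_mem hy hz
  have hyzX := hKX _ hyz
  have hface := h.face x hx _ (hK hyz)
  have hself := (h.relInt _ hyzX).1
  have h1 := hface.mem_of_add_mem_left (hK hy) (hK hz) hself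
  have h2 := hface.mem_of_add_mem_right (hK hy) (hK hz) hself
  exact hmax ⟨_, hyz, rfl⟩ (h.face _ hyzX y h1).le h2

/-- A cell system is the set of cones of a fan. -/
theorem IsCellSystem.exists_fan (h : IsCellSystem N X C) (hne : X.Nonempty) :
    ∃ S : RatFan N, (∀ κ, κ ∈ S.cones ↔ ∃ x ∈ X, κ = C x) ∧ S.support = X := by
  have hmem : ∀ κ, κ ∈ h.finite.toFinset ↔ ∃ x ∈ X, κ = C x := fun κ => by
    rw [Set.Finite.mem_toFinset]
    exact ⟨fun ⟨x, hx, e⟩ => ⟨x, hx, e.symm⟩, fun ⟨x, hx, e⟩ => ⟨x, hx, e.symm⟩⟩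
  refine ⟨⟨h.finite.toFinset, ?_, ?_, ?_, ?_, ?_⟩, hmem, ?_⟩
  · obtain ⟨x, hx⟩ := hne
    exact ⟨_, (hmem _).2 ⟨x, hx, rfl⟩⟩
  · intro κ hκ
    obtain ⟨x, hx, rfl⟩ := (hmem κ).1 hκ
    exact h.rational x hx
  · intro κ hκ
    obtain ⟨x, hx, rfl⟩ := (hmem κ).1 hκ
    exact h.stronglyConvex x hx
  · intro κ hκ τ hτ
    obtain ⟨x, hx, rfl⟩ := (hmem κ).1 hκ
    refine (hmem τ).2 (h.exists_eq hx hτ.le fun y hy z hz => ?_)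
    have hyX := h.subset x hx y (hτ.le hy)
    obtain ⟨ε, hε, h'⟩ := (h.relInt y hyX).2 z hz
    have hle := (h.face x hx y (hτ.le hy)).le
    exact hτ.mem_of_smul_add_mem (hle hz) (hle h') hε (by simpa using hy)
  · intro κ hκ κ' hκ'
    obtain ⟨x, hx, rfl⟩ := (hmem κ).1 hκ
    obtain ⟨x', hx', rfl⟩ := (hmem κ').1 hκ'
    obtain ⟨y, hy, e⟩ := h.exists_eq hx (K := C x ⊓ C x') inf_le_left fun y hy =>
      le_inf (h.face x hx y hy.1).le (h.face x' hx' y hy.2).le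
    have hy' : y ∈ C x ⊓ C x' := e ▸ (h.relInt y hy).1
    rw [e]
    exact h.face x hx y hy'.1
  · ext y
    constructor
    · rintro ⟨κ, hκ, hy⟩
      obtain ⟨x, hx, rfl⟩ := (hmem κ).1 hκ
      exact h.subset x hx y hy
    · exact fun hy => ⟨C y, (hmem _).2 ⟨y, hy, rfl⟩, (h.relInt y hy).1⟩

theorem cell_isFaceOf {A : Set (V →ₗ[ℝ] ℝ)} {x y : V} (h : y ∈ cell A x) :
    (cell A y).IsFaceOf (cell A x) := by
  refine isFaceOf_of_add (fun z hz => cell_trans h hz) fun a ha b hb hab f hf => ?_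
  have h1 := h f hf
  have h2 := ha f hf
  have h3 := hb f hf
  have h4 := hab f hf
  rw [map_add] at h4
  grind

theorem mem_coneRelInt_cell {A : Set (V →ₗ[ℝ] ℝ)} (hA : A.Finite) (x : V) :
    x ∈ coneRelInt (cell A x) := by
  refine ⟨self_mem_cell, fun y hy => ?_⟩
  obtain ⟨t, ht, h0⟩ := ((eventually_signs hA x (-y)).and eventually_pos).exists
  refine ⟨t, h0, fun f hf => ?_⟩
  have h1 := ht f hf
  have h2 := hy f hf
  rw [smul_neg, ← sub_eq_add_neg, map_neg] at h1
  unfold LexSign at h1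
  grind

theorem cell_stronglyConvex {A : Set (V →ₗ[ℝ] ℝ)} (hess : ∀ x : V, (∀ f ∈ A, f x = 0) → x = 0)
    {x y : V} (hy : y ∈ cell A x) (hy' : -y ∈ cell A x) : y = 0 := by
  refine hess y fun f hf => ?_
  have h1 := hy f hf
  have h2 := hy' f hf
  rw [map_neg] at h2
  grind

theorem isCellSystem_cell {A : Set (V →ₗ[ℝ] ℝ)} (hA : IsRatArr N A)
    (hess : ∀ x : V, (∀ f ∈ A, f x = 0) → x = 0) (hX : IsCellular A X) :
    IsCellSystem N X (cell A) where
  finite := (finite_cells hA.1).subset (Set.image_subset_range _ _)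
  subset := hX
  rational x _ := isRatCone_cell hA x
  stronglyConvex _ _ _ := cell_stronglyConvex hess
  relInt x _ := mem_coneRelInt_cell hA.1 x
  face _ _ _ := cell_isFaceOf

/-- A fan supported on a tropical set is a tropical fan, with weights one. -/
theorem RatFan.exists_tropicalFan (S : RatFan N) {d : ℕ} (h : IsTropSet N d S.support) :
    ∃ T : TropicalFan N, T.toRatFan = S ∧ T.dim = d ∧ ∀ σ, T.weight σ = 1 := by
  classical
  have hp := RatFan.isPure_of_isPureSet h.pure
  refine ⟨{ toRatFan := S, dim := d, pure := hp, weight := fun _ => 1, balanced := ?_ },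
    rfl, rfl, fun _ => rfl⟩
  intro τ hτ hd n hn
  simp only [PNat.one_coe, one_smul]
  have hτr : IsRatCone N τ := S.rational τ hτ
  obtain ⟨x, -, hx⟩ := hτr.exists_interior
  obtain ⟨hN, hinj⟩ := hp.isNormals hτ hd hx hn
  obtain ⟨s, hs, hsum⟩ := h.balanced x ⟨τ, hτ, hx.1⟩ _ hτr.isRat_span hd (by
    intro z hz l hl
    obtain ⟨m, hm, c, hc, h1⟩ := (hN.cover z).1 hz
    exact (hN.cover _).2 ⟨m, hm, c, hc, by rw [add_sub_right_comm]; exact add_mem h1 hl⟩)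
  have h1 := add_mem (hN.sum_sub_sum_mem hs) hsum
  rw [sub_add_cancel, Finset.sum_image hinj] at h1
  exact hτr.mem_coneLattice.2 ⟨sum_mem fun σ hσ => (hn σ hσ).1, h1⟩

theorem exists_essential {A : Set (V →ₗ[ℝ] ℝ)} (hA : IsRatArr N A) :
    ∃ B, A ⊆ B ∧ IsRatArr N B ∧ ∀ x : V, (∀ f ∈ B, f x = 0) → x = 0 := by
  obtain ⟨B, hB, h⟩ := exists_coords N
  exact ⟨A ∪ B, Set.subset_union_left, hA.union hB, fun x hx => h x fun f hf => hx f (Or.inr hf)⟩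

/-- The fan of cells of an arrangement on a tropical set. -/
theorem IsTropSet.exists_tropicalFan {d : ℕ} (h : IsTropSet N d X) {A : Set (V →ₗ[ℝ] ℝ)}
    (hA : IsRatArr N A) (hess : ∀ x : V, (∀ f ∈ A, f x = 0) → x = 0) (hX : IsCellular A X) :
    ∃ T : TropicalFan N, T.support = X ∧ T.dim = d ∧ (∀ σ, T.weight σ = 1) ∧
      ∀ κ, κ ∈ T.cones ↔ ∃ x ∈ X, κ = cell A x := by
  obtain ⟨S, hS, hsupp⟩ := (isCellSystem_cell hA hess hX).exists_fan h.nonempty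
  obtain ⟨T, rfl, hd, hw⟩ := S.exists_tropicalFan (hsupp.symm ▸ h)
  exact ⟨T, hsupp, hd, hw, hS⟩

theorem coneDim_cell {A : Set (V →ₗ[ℝ] ℝ)} (hA : A.Finite) (x : V) :
    coneDim (cell A x) = finrank ℝ (cellSpan A x) := by
  unfold coneDim
  rw [span_cell hA]

theorem TropicalFan.refines_of_cells {S T : TropicalFan N} (hS : S.IsReduced) {A : Set (V →ₗ[ℝ] ℝ)}
    (hA : ∀ σ ∈ S.cones, IsCellular A (σ : Set V)) (hd : T.dim = S.dim) (hsupp : T.support = S.support)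
    (hw : ∀ σ, T.weight σ = 1) (hT : ∀ κ ∈ T.cones, ∃ x ∈ S.support, κ = cell A x) :
    T.Refines S where
  dim_eq := hd
  support_eq := hsupp
  exists_le κ hκ := by
    obtain ⟨x, ⟨σ, hσ, hx⟩, rfl⟩ := hT κ hκ
    exact ⟨σ, hσ, hA σ hσ x hx⟩
  weight_eq κ hκ hκd := by
    obtain ⟨x, ⟨σ, hσ, hx⟩, rfl⟩ := hT κ hκ
    have hle : cell A x ≤ σ := hA σ hσ x hx
    have hσd : coneDim σ = S.dim :=
      le_antisymm (S.coneDim_le hσ) (hd ▸ hκd ▸ TropicalFan.coneDim_mono N hle)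
    exact ⟨σ, hσ, hσd, hle, by rw [hw, hS σ hσ hσd]⟩

theorem TropicalFan.IsReduced.of_weight {S : TropicalFan N} (h : ∀ σ, S.weight σ = 1) :
    S.IsReduced := fun σ _ _ => h σ

/-- A sufficiently fine arrangement subdivides a reduced tropical fan. -/
theorem TropicalFan.IsReduced.exists_arrangement {S : TropicalFan N} (hS : S.IsReduced) :
    ∃ A, IsRatArr N A ∧ (∀ x : V, (∀ f ∈ A, f x = 0) → x = 0) ∧ IsCellular A S.support ∧
      ∀ B, A ⊆ B → IsRatArr N B → ∃ T : TropicalFan N, T.Refines S ∧ T.support = S.support ∧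
        (∀ σ, T.weight σ = 1) ∧ ∀ κ, κ ∈ T.cones ↔ ∃ x ∈ S.support, κ = cell B x := by
  obtain ⟨A₀, hA₀, hA₀σ, -, hS₀⟩ := S.toRatFan.exists_arrangement
  obtain ⟨A, hA₀A, hA, hess⟩ := exists_essential hA₀
  refine ⟨A, hA, hess, hS₀.mono hA₀A, fun B hAB hB => ?_⟩
  obtain ⟨T, hsupp, hd, hw, hT⟩ := hS.isTropSet.exists_tropicalFan hB
    (fun x hx => hess x fun f hf => hx f (hAB hf)) (hS₀.mono (hA₀A.trans hAB))
  exact ⟨T, TropicalFan.refines_of_cells hS (fun σ hσ => (hA₀σ σ hσ).mono (hA₀A.trans hAB)) hd hsupp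
    hw fun κ hκ => (hT κ).1 hκ, hsupp, hw, hT⟩

theorem mk_eq_of_refines {S T : TropicalFan N} (h : T.Refines S) :
    (Quot.mk _ T : FanCycle N) = Quot.mk _ S :=
  Quot.sound ⟨T, TropicalFan.Refines.refl T, h⟩

theorem map_mem_span {X : Set V} {X' : Set W} {p : V →ₗ[ℝ] W} (h : ∀ x ∈ X, p x ∈ X') {x : V}
    (hx : x ∈ Submodule.span ℝ X) : p x ∈ Submodule.span ℝ X' :=
  (Submodule.span_le.2 fun y hy => Submodule.subset_span (h y hy) :
    Submodule.span ℝ X ≤ (Submodule.span ℝ X').comap p) hx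

theorem eq_of_mem_span {X : Set V} {f : V →ₗ[ℝ] V} (h : ∀ x ∈ X, f x = x) {x : V}
    (hx : x ∈ Submodule.span ℝ X) : f x = x :=
  LinearMap.eqOn_span (f := f) (g := LinearMap.id) h hx

/-- Reduced tropical fans with isomorphic supports represent isomorphic cycles. -/
theorem FanCycle.isIsomorphic_of_setIso {S : TropicalFan N} {S' : TropicalFan N'} (hS : S.IsReduced)
    (hS' : S'.IsReduced) (h : SetIso N S.support N' S'.support) :
    FanCycle.IsIsomorphic (Quot.mk _ S : FanCycle N) (Quot.mk _ S' : FanCycle N') := by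
  obtain ⟨p, q, h⟩ := h
  obtain ⟨A₀, hA₀, -, hX, hfan⟩ := hS.exists_arrangement
  obtain ⟨A₀', hA₀', -, hX', hfan'⟩ := hS'.exists_arrangement
  let A := A₀ ∪ (fun f => f ∘ₗ p) '' A₀'
  let A' := A₀' ∪ (fun f => f ∘ₗ q) '' A₀
  obtain ⟨T, hTS, hT, hTw, hTc⟩ := hfan A Set.subset_union_left (hA₀.union (hA₀'.comp h.lat))
  obtain ⟨T', hTS', hT', hTw', hTc'⟩ := hfan' A' Set.subset_union_left
    (hA₀'.union (hA₀.comp h.lat_symm))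
  have hcell : ∀ x ∈ S.support, ∀ y ∈ S.support, (p y ∈ cell A' (p x) ↔ y ∈ cell A x) := by
    intro x hx y hy
    constructor
    · rintro h1 f (hf | ⟨f, hf, rfl⟩)
      · have := h1 _ (Or.inr ⟨f, hf, rfl⟩)
        simpa [h.left_inv x hx, h.left_inv y hy] using this
      · exact h1 f (Or.inl hf)
    · rintro h1 f (hf | ⟨f, hf, rfl⟩)
      · exact h1 _ (Or.inr ⟨f, hf, rfl⟩)
      · have := h1 f (Or.inl hf)
        simpa [h.left_inv x hx, h.left_inv y hy] using this
  have hpq : ∀ x ∈ Submodule.span ℝ S.support, q (p x) = x := fun x hx =>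
    eq_of_mem_span (f := q ∘ₗ p) h.left_inv hx
  have hqp : ∀ x ∈ Submodule.span ℝ S'.support, p (q x) = x := fun x hx =>
    eq_of_mem_span (f := p ∘ₗ q) h.right_inv hx
  have hmem : ∀ z ∈ Submodule.span ℝ S.support, ∀ x ∈ S.support,
      (p z ∈ cell A' (p x) ↔ z ∈ cell A x) := by
    intro z hz x hx
    constructor
    · intro h1
      have h2 : p z ∈ S'.support :=
        hX' (p x) (h.mem x hx) _ (cell_anti Set.subset_union_left h1)
      have h3 := h.mem_symm _ h2
      rw [hpq z hz] at h3
      exact (hcell x hx z h3).1 h1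
    · intro h1
      exact (hcell x hx z (hX x hx z (cell_anti Set.subset_union_left h1))).2 h1
  rw [← hT] at hpq hmem
  rw [← hT'] at hqp
  have hp' : ∀ z ∈ Submodule.span ℝ T.support, p z ∈ Submodule.span ℝ T'.support := fun z hz =>
    map_mem_span (by rw [hT, hT']; exact h.mem) hz
  have hq' : ∀ z ∈ Submodule.span ℝ T'.support, q z ∈ Submodule.span ℝ T.support := fun z hz =>
    map_mem_span (by rw [hT, hT']; exact h.mem_symm) hz
  let e : Submodule.span ℝ T.support ≃ₗ[ℝ] Submodule.span ℝ T'.support :=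
    LinearEquiv.ofLinearMap (p.restrict hp') (q.restrict hq')
      (LinearMap.ext fun x => Subtype.ext (hqp x x.2))
      (LinearMap.ext fun x => Subtype.ext (hpq x x.2))
  have he : ∀ x, (e x : W) = p x := fun x => rfl
  refine ⟨T, T', mk_eq_of_refines hTS, mk_eq_of_refines hTS', ⟨e, fun x => ?_, fun σ hσ => ?_,
    fun σ' hσ' => ?_, fun σ _ σ' _ _ _ => by rw [hTw, hTw']⟩⟩
  · rw [he]
    refine ⟨fun hx => ?_, fun hx => h.lat _ hx⟩
    rw [← hpq x x.2]
    exact h.lat_symm _ hx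
  · obtain ⟨x, hx, rfl⟩ := (hTc σ).1 hσ
    exact ⟨_, (hTc' _).2 ⟨p x, h.mem x hx, rfl⟩, fun z => hmem z z.2 x (hT.symm ▸ hx)⟩
  · obtain ⟨x, hx, rfl⟩ := (hTc' σ').1 hσ'
    refine ⟨_, (hTc _).2 ⟨q x, h.mem_symm x hx, rfl⟩, fun z => ?_⟩
    have := hmem z z.2 (q x) (hT.symm ▸ h.mem_symm x hx)
    rwa [h.right_inv x hx] at this

end CellSystems

/-! ### Cycles supported on quasilinear sets are quasilinear -/

section ModificationFans

variable {V : Type*} [AddCommGroup V] [Module ℝ V] {N : RealLattice V}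
variable {A : Set (V →ₗ[ℝ] ℝ)} {Y E : Set V} {φ : V → ℝ} {d : ℕ}

/-- A piecewise linear function on the fan of cells of an adapted arrangement. -/
theorem IsPLFor.exists_plFunction {S : TropicalFan N} (hφ : IsPLFor N A Y φ)
    (hS : ∀ κ, κ ∈ S.cones ↔ ∃ x ∈ Y, κ = cell A x) :
    ∃ Φ : PLFunction S.toRatFan, Φ.toFun = φ ∧
      ∀ σ ∈ S.cones, LatMap N RealLattice.int (Φ.lin σ) := by
  have h : ∀ σ ∈ S.cones, ∃ l : V →ₗ[ℝ] ℝ, LatMap N RealLattice.int l ∧ ∀ y ∈ σ, φ y = l y := by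
    intro σ hσ
    obtain ⟨x, hx, rfl⟩ := (hS σ).1 hσ
    exact hφ x hx
  choose! l hl hlφ using h
  refine ⟨⟨φ, l, fun σ hσ x hx => ?_, hlφ⟩, rfl, hl⟩
  obtain ⟨k, hk⟩ := RealLattice.mem_int.1
    (hl σ hσ x ((IsRatCone.mem_coneLattice (S.rational σ hσ)).1 hx).1)
  exact ⟨k, hk.symm⟩

/-- The order of vanishing is one on the divisor of a tropical modification, and zero elsewhere. -/
theorem PLFunction.ord_eq {S : TropicalFan N} (Φ : PLFunction S.toRatFan) (hA : IsRatArr N A)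
    (hS : ∀ κ, κ ∈ S.cones ↔ ∃ x ∈ S.support, κ = cell A x) (hw : ∀ σ, S.weight σ = 1)
    (hY : IsCellular A S.support) (hE : IsCellular A E) (hEY : E ⊆ S.support)
    (hlat : ∀ σ ∈ S.cones, LatMap N RealLattice.int (Φ.lin σ)) (hd : S.dim = d + 1)
    (hEt : IsTropSet N d E)
    (hM : IsBalanced (N.prod RealLattice.int) (d + 1) (modif S.support E Φ.toFun)) {y : V}
    (hy : y ∈ S.support) (hyd : coneDim (cell A y) = d) :
    (y ∈ E → Φ.ord (cell A y) = 1) ∧ (y ∉ E → Φ.ord (cell A y) = 0) := by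
  classical
  have hτ : cell A y ∈ S.cones := (hS _).2 ⟨y, hy, rfl⟩
  have hτd : coneDim (cell A y) + 1 = S.dim := by rw [hd, hyd]
  have hφ : IsPLFor N A S.support Φ.toFun := fun x hx =>
    ⟨Φ.lin (cell A x), hlat _ ((hS _).2 ⟨x, hx, rfl⟩), Φ.eq_lin _ ((hS _).2 ⟨x, hx, rfl⟩)⟩
  have hn := fun σ hσ => RatFan.latticeNormal_spec (σ := σ) hτ hτd hσ
  have hp : S.toRatFan.IsPure S.dim := S.pure
  obtain ⟨hN, hinj⟩ := hp.isNormals hτ hτd (mem_coneRelInt_cell hA.1 y)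
    (n := fun σ => latticeNormal N σ (cell A y)) hn
  rw [span_cell hA.1] at hN
  have hfin : finrank ℝ (cellSpan A y) = d := by rw [← coneDim_cell hA.1, hyd]
  have hder : ∀ σ ∈ S.conesAbove S.dim (cell A y),
      der Φ.toFun y (latticeNormal N σ (cell A y)) = Φ.lin σ (latticeNormal N σ (cell A y)) := by
    intro σ hσ
    obtain ⟨h1, -, h2⟩ := TropicalFan.mem_conesAbove.1 hσ
    refine der_eq (eventually_pos.mono fun t ht => ?_)
    have hyσ := h2.le (self_mem_cell (A := A) (x := y))
    rw [Φ.eq_lin σ h1 _ (add_mem hyσ (σ.smul_mem ht.le (hn σ hσ).2.1.1)), Φ.eq_lin σ h1 _ hyσ,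
      map_add, map_smul, smul_eq_mul]
  have hord : ∀ T : Finset (V × ℝ), ((localStar E y = ∅ ∧ T = ∅) ∨
      (localStar E y = (cellSpan A y : Set V) ∧ T = {(0, 1)})) →
      Φ.ord (cell A y) = ∑ m ∈ T, m.2 := by
    intro T hT
    have := (modif_balance hA.1 hM hY hE hEY hφ hy (hlat _ hτ) (Φ.eq_lin _ hτ) le_rfl
      (isRat_cellSpan hA y) (by rw [hfin]) hN hT).2
    rw [Finset.sum_image hinj, Finset.sum_image hinj, Finset.sum_congr rfl hder] at this
    unfold PLFunction.ord
    simp only [hw, PNat.one_coe, one_smul]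
    linarith
  constructor
  · intro hyE
    rw [hord {(0, 1)} (Or.inr ⟨localStar_eq_cellSpan N hA.1 hE
      (fun x hx => hEt.pure.finrank_cellSpan_le N hA.1 hE hx) hyE hfin, rfl⟩)]
    simp
  · intro hyE
    rw [hord ∅ (Or.inl ⟨Set.eq_empty_of_forall_notMem fun v hv =>
      hyE (mem_of_mem_localStar hE hA.1 hv), rfl⟩)]
    simp

theorem PLFunction.isDivisor {S Δ : TropicalFan N} (Φ : PLFunction S.toRatFan) (hA : IsRatArr N A)
    (hS : ∀ κ, κ ∈ S.cones ↔ ∃ x ∈ S.support, κ = cell A x)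
    (hE : IsCellular A Δ.support) (hEY : Δ.support ⊆ S.support)
    (hd : S.dim = Δ.dim + 1) (hEt : IsTropSet N Δ.dim Δ.support)
    (hΔ : ∀ κ, κ ∈ Δ.cones ↔ ∃ x ∈ Δ.support, κ = cell A x) (hw : ∀ σ, Δ.weight σ = 1)
    (hord : ∀ y ∈ S.support, coneDim (cell A y) = Δ.dim →
      (y ∈ Δ.support → Φ.ord (cell A y) = 1) ∧ (y ∉ Δ.support → Φ.ord (cell A y) = 0)) :
    Φ.IsDivisor Δ where
  dim_eq := hd.symm
  cones_eq := by
    ext ρ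
    constructor
    · intro hρ
      obtain ⟨x, hx, rfl⟩ := (hΔ ρ).1 hρ
      obtain ⟨z, hz, hxz, hzd⟩ := hEt.pure.exists_cell hA.1 hE hx
      rw [← coneDim_cell hA.1] at hzd
      refine ⟨cell A z, (hS _).2 ⟨z, hEY hz, rfl⟩, by rw [hzd, hd], ?_, cell_isFaceOf hxz⟩
      rw [(hord z (hEY hz) hzd).1 hz]
      exact one_ne_zero
    · rintro ⟨τ, hτ, hτd, h0, hρ⟩
      obtain ⟨y, hy, rfl⟩ := (hS τ).1 hτ
      rw [hd, add_left_inj] at hτd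
      have hyE : y ∈ Δ.support := by
        by_contra hyE
        exact h0 ((hord y hy hτd).2 hyE)
      exact Δ.face_mem _ ((hΔ _).2 ⟨y, hyE, rfl⟩) ρ hρ
  weight_eq := by
    intro τ hτ hτd
    obtain ⟨y, hy, rfl⟩ := (hΔ τ).1 hτ
    rw [(hord y (hEY hy) hτd).1 hy, hw]
    simp

open Classical in
/-- The cones of a tropical modification form a cell system. -/
theorem PLFunction.isCellSystem {S : TropicalFan N} (Φ : PLFunction S.toRatFan) (hA : IsRatArr N A)
    (hess : ∀ x : V, (∀ f ∈ A, f x = 0) → x = 0)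
    (hS : ∀ κ, κ ∈ S.cones ↔ ∃ x ∈ S.support, κ = cell A x)
    (hY : IsCellular A S.support) (hE : IsCellular A E) (hEY : E ⊆ S.support)
    (hlat : ∀ σ ∈ S.cones, LatMap N RealLattice.int (Φ.lin σ)) :
    IsCellSystem (N.prod RealLattice.int) (modif S.support E Φ.toFun) fun z =>
      if z.2 = Φ.toFun z.1 then Φ.graphCone (cell A z.1) else Φ.upperCone (cell A z.1) := by
  have hcone : ∀ x ∈ S.support, cell A x ∈ S.cones := fun x hx => (hS _).2 ⟨x, hx, rfl⟩
  have hlin : ∀ x ∈ S.support, ∀ y ∈ cell A x, Φ.toFun y = Φ.lin (cell A x) y := fun x hx =>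
    Φ.eq_lin _ (hcone x hx)
  have hbase : ∀ z ∈ modif S.support E Φ.toFun, z.1 ∈ S.support := fun z hz =>
    hz.elim (fun h => h.1) fun h => hEY h.1
  have hle : ∀ z ∈ modif S.support E Φ.toFun, Φ.toFun z.1 ≤ z.2 := fun z hz =>
    hz.elim (fun h => h.2.ge) fun h => h.2
  have hmem : ∀ z ∈ modif S.support E Φ.toFun, ∀ w,
      w ∈ (if z.2 = Φ.toFun z.1 then Φ.graphCone (cell A z.1) else Φ.upperCone (cell A z.1)) ↔
        w.1 ∈ cell A z.1 ∧ Φ.lin (cell A z.1) w.1 ≤ w.2 ∧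
          (z.2 = Φ.toFun z.1 → w.2 = Φ.lin (cell A z.1) w.1) := by
    intro z hz w
    split_ifs with h0
    · rw [Φ.mem_graphCone]
      exact ⟨fun h => ⟨h.1, h.2.ge, fun _ => h.2⟩, fun h => ⟨h.1, h.2.2 h0⟩⟩
    · rw [Φ.mem_upperCone]
      exact ⟨fun h => ⟨h.1, h.2, fun h' => absurd h' h0⟩, fun h => ⟨h.1, h.2.1⟩⟩
  have hsub : ∀ z ∈ modif S.support E Φ.toFun, ∀ w,
      w.1 ∈ cell A z.1 ∧ Φ.lin (cell A z.1) w.1 ≤ w.2 ∧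
        (z.2 = Φ.toFun z.1 → w.2 = Φ.lin (cell A z.1) w.1) → w ∈ modif S.support E Φ.toFun := by
    rintro z hz w ⟨h1, h2, h3⟩
    have hwφ := hlin _ (hbase z hz) _ h1
    by_cases h0 : z.2 = Φ.toFun z.1
    · exact Or.inl ⟨hY _ (hbase z hz) _ h1, by rw [h3 h0, hwφ]⟩
    · have hzE : z.1 ∈ E := hz.elim (fun h => absurd h.2 h0) fun h => h.1
      exact Or.inr ⟨hE _ hzE _ h1, by rwa [hwφ]⟩
  constructor
  · refine (((finite_cells hA.1).image Φ.graphCone).union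
      ((finite_cells hA.1).image Φ.upperCone)).subset ?_
    rintro _ ⟨z, -, rfl⟩
    by_cases h0 : z.2 = Φ.toFun z.1
    · simp only [h0, if_true]
      exact Or.inl ⟨_, ⟨z.1, rfl⟩, rfl⟩
    · simp only [h0, if_false]
      exact Or.inr ⟨_, ⟨z.1, rfl⟩, rfl⟩
  · exact fun z hz w hw => hsub z hz w ((hmem z hz w).1 hw)
  · intro z hz
    obtain ⟨G, hG, hGc⟩ := isRatCone_cell hA z.1
    have hl := latMap_graphMap (hlat _ (hcone _ (hbase z hz)))
    have hgr : Φ.graphCone (cell A z.1) =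
        PointedCone.hull ℝ ((G.image (graphMap (Φ.lin (cell A z.1))) : Finset (V × ℝ)) : Set (V × ℝ)) := by
      unfold PLFunction.graphCone
      generalize Φ.lin (cell A z.1) = l
      rw [hGc, Finset.coe_image]
      exact Submodule.map_span ((graphMap l).restrictScalars {c : ℝ // 0 ≤ c}) _
    have himg : ∀ x ∈ G.image (graphMap (Φ.lin (cell A z.1))), x ∈ (N.prod RealLattice.int).carrier := by
      intro x hx
      obtain ⟨g, hg, rfl⟩ := Finset.mem_image.1 hx
      exact hl g (hG g hg)
    split_ifs
    · exact ⟨_, himg, hgr⟩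
    · refine ⟨G.image (graphMap (Φ.lin (cell A z.1))) ∪ {(0, 1)}, fun x hx => ?_, ?_⟩
      · rcases Finset.mem_union.1 hx with hx | hx
        · exact himg x hx
        · rw [Finset.mem_singleton.1 hx]
          exact ⟨zero_mem _, RealLattice.one_mem_int⟩
      · unfold PLFunction.upperCone
        rw [hgr, Finset.coe_union, Finset.coe_singleton]
        exact (Submodule.span_union _ _).symm
  · intro z hz w hw hw'
    rw [hmem z hz] at hw hw'
    have h1 : w.1 = 0 := cell_stronglyConvex hess hw.1 hw'.1
    have h2 := hw.2.1
    have h3 := hw'.2.1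
    simp only [Prod.fst_neg, Prod.snd_neg, h1, neg_zero, map_zero] at h2 h3
    exact Prod.ext h1 (le_antisymm (by simpa using h3) h2)
  · intro z hz
    have hzφ := hlin _ (hbase z hz) _ self_mem_cell
    refine ⟨(hmem z hz z).2 ⟨self_mem_cell, by rw [← hzφ]; exact hle z hz, fun h => by rw [h, hzφ]⟩,
      fun w hw => ?_⟩
    obtain ⟨h1, h2, h3⟩ := (hmem z hz w).1 hw
    obtain ⟨ε, hε, h4⟩ := (mem_coneRelInt_cell hA.1 z.1).2 w.1 h1
    have h5 : ∀ᶠ t : ℝ in 𝓝[>] 0, z.2 ≠ Φ.toFun z.1 →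
        0 < (z.2 - Φ.toFun z.1) + t * (Φ.lin (cell A z.1) w.1 - w.2) := by
      by_cases h0 : z.2 = Φ.toFun z.1
      · exact Eventually.of_forall fun _ h => absurd h0 h
      · exact (eventually_pos_of_pos _ (sub_pos.2 (lt_of_le_of_ne (hle z hz) (Ne.symm h0)))).mono
          fun _ h _ => h
    obtain ⟨t, ⟨h6, h7⟩, h8⟩ := ((h5.and eventually_pos).and (eventually_small ε hε)).exists
    refine ⟨t, h7, (hmem z hz _).2 ⟨sub_mem_cone_of_le hε self_mem_cell h4 h7.le h8.le, ?_, ?_⟩⟩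
    · show Φ.lin (cell A z.1) (z.1 - t • w.1) ≤ z.2 - t * w.2
      rw [map_sub, map_smul, smul_eq_mul, ← hzφ]
      by_cases h0 : z.2 = Φ.toFun z.1
      · rw [h3 h0, h0]
      · linarith [h6 h0]
    · intro h0
      show z.2 - t * w.2 = Φ.lin (cell A z.1) (z.1 - t • w.1)
      rw [map_sub, map_smul, smul_eq_mul, ← hzφ, h3 h0, h0]
  · intro z hz y hy
    have hy' := (hmem z hz y).1 hy
    have hyM := hsub z hz y hy'
    have hlin2 : ∀ w ∈ cell A y.1, Φ.lin (cell A y.1) w = Φ.lin (cell A z.1) w := fun w hw => by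
      rw [← hlin _ (hbase y hyM) _ hw, hlin _ (hbase z hz) _ (cell_trans hy'.1 hw)]
    have hyφ := hlin _ (hbase z hz) _ hy'.1
    refine isFaceOf_of_add (fun w hw => ?_) fun a ha b hb hab => ?_
    · obtain ⟨h1, h2, h3⟩ := (hmem y hyM w).1 hw
      rw [hlin2 _ h1] at h2 h3
      exact (hmem z hz w).2 ⟨cell_trans hy'.1 h1, h2, fun h0 => h3 (by rw [hy'.2.2 h0, hyφ])⟩
    · obtain ⟨a1, a2, -⟩ := (hmem z hz a).1 ha
      obtain ⟨b1, b2, -⟩ := (hmem z hz b).1 hb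
      obtain ⟨c1, -, c3⟩ := (hmem y hyM _).1 hab
      have h1 := (cell_isFaceOf hy'.1).mem_of_add_mem_left a1 b1 c1
      refine (hmem y hyM a).2 ⟨h1, by rwa [hlin2 _ h1], fun h0 => ?_⟩
      have h2 := c3 h0
      rw [hlin2 _ c1, Prod.fst_add, Prod.snd_add, map_add] at h2
      rw [hlin2 _ h1]
      linarith

/-- Every tropical modification of tropical sets is the support of the modification of a fan. -/
theorem exists_isModificationAlong (hY : IsTropSet N (d + 1) Y) (hE : IsTropSet N d E) (hEY : E ⊆ Y)
    (hφ : IsPL N Y φ) (hM : IsTropSet (N.prod RealLattice.int) (d + 1) (modif Y E φ)) :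
    ∃ (S Δ : TropicalFan N) (T : TropicalFan (N.prod RealLattice.int)),
      S.IsReduced ∧ Δ.IsReduced ∧ T.IsReduced ∧ S.support = Y ∧ Δ.support = E ∧
      T.support = modif Y E φ ∧
      FanCycle.IsModificationAlong (Quot.mk _ T) (Quot.mk _ S) (Quot.mk _ Δ) := by
  obtain ⟨A₀, hA₀, hYA, hEA, hφA⟩ := hφ.exists_common hE
  obtain ⟨A, hAA, hA, hess⟩ := exists_essential hA₀
  replace hYA := hYA.mono hAA
  replace hEA := hEA.mono hAA
  replace hφA := hφA.mono hAA
  obtain ⟨S, rfl, hSd, hSw, hS⟩ := hY.exists_tropicalFan hA hess hYA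
  obtain ⟨Δ, rfl, rfl, hΔw, hΔ⟩ := hE.exists_tropicalFan hA hess hEA
  obtain ⟨Φ, rfl, hlat⟩ := hφA.exists_plFunction hS
  obtain ⟨T₀, hT₀, hTs⟩ := (Φ.isCellSystem hA hess hS hYA hEA hEY hlat).exists_fan hM.nonempty
  obtain ⟨T, rfl, hTd, hTw⟩ := T₀.exists_tropicalFan (d := Δ.dim + 1) (hTs.symm ▸ hM)
  have hord := fun y hy hyd => Φ.ord_eq hA hS hSw hYA hEA hEY hlat hSd hE hM.balanced (y := y) hy hyd
  have hdiv := Φ.isDivisor hA hS hEA hEY hSd hE hΔ hΔw hord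
  refine ⟨S, Δ, T, .of_weight hSw, .of_weight hΔw, .of_weight hTw, rfl, rfl, hTs, S, Φ, Δ, T, rfl, hdiv,
    rfl, ⟨hTd.trans hSd.symm, ?_, fun σ _ _ => by rw [hTw, hSw], fun τ hτ hτd h0 => ?_⟩, rfl⟩
  · ext κ
    rw [← hdiv.cones_eq]
    refine (hT₀ κ).trans ⟨?_, ?_⟩
    · rintro ⟨z, hz, rfl⟩
      by_cases h0 : z.2 = Φ.toFun z.1
      · simp only [h0, if_true]
        refine Or.inl ⟨_, (hS _).2 ⟨z.1, ?_, rfl⟩, rfl⟩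
        exact hz.elim (fun h => h.1) fun h => hEY h.1
      · simp only [h0, if_false]
        refine Or.inr ⟨_, (hΔ _).2 ⟨z.1, ?_, rfl⟩, rfl⟩
        exact hz.elim (fun h => absurd h.2 h0) fun h => h.1
    · rintro (⟨σ, hσ, rfl⟩ | ⟨ρ, hρ, rfl⟩)
      · obtain ⟨x, hx, rfl⟩ := (hS σ).1 hσ
        exact ⟨(x, Φ.toFun x), Or.inl ⟨hx, rfl⟩, by simp⟩
      · obtain ⟨x, hx, rfl⟩ := (hΔ ρ).1 hρ
        exact ⟨(x, Φ.toFun x + 1), Or.inr ⟨hx, by simp⟩, by simp⟩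
  · obtain ⟨y, hy, rfl⟩ := (hS τ).1 hτ
    rw [hSd, add_left_inj] at hτd
    have hyE : y ∈ Δ.support := by
      by_contra hyE
      exact h0 ((hord y hy hτd).2 hyE)
    rw [(hord y hy hτd).1 hyE, hTw]
    simp

end ModificationFans

/-- A reduced tropical fan whose support is isomorphic to a quasilinear set represents a quasilinear
cycle. -/
theorem QLSet.isQuasilinear {V V' : Type u} [AddCommGroup V] [Module ℝ V] [AddCommGroup V']
    [Module ℝ V'] {N : RealLattice V} {N' : RealLattice V'} {d : ℕ} {X : Set V'} (h : QLSet N' d X)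
    {S : TropicalFan N} (hS : S.IsReduced) (hiso : SetIso N S.support N' X) :
    FanCycle.IsQuasilinear (Quot.mk _ S : FanCycle N) := by
  induction h generalizing V with
  | complete N' =>
    obtain ⟨A, hA, hess⟩ := exists_coords N'
    obtain ⟨S', hsupp, -, hw, -⟩ := (isTropSet_univ N').exists_tropicalFan hA hess isCellular_univ
    refine FanCycle.IsQuasilinear.of_complete _ (Quot.mk _ S') ⟨S, rfl, hS⟩ ⟨S', rfl, hsupp⟩
      (FanCycle.isIsomorphic_of_setIso hS (.of_weight hw) ?_)
    rwa [hsupp]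
  | iso _ h ih => exact ih hS (hiso.trans h)
  | modif hY hE hEY hφ hM ihY ihE =>
    obtain ⟨S₁, Δ, T, hS₁, hΔ, hT, rfl, rfl, hTs, hmod⟩ :=
      exists_isModificationAlong hY.isTropSet hE.isTropSet hEY hφ hM
    rw [← hTs] at hiso
    exact FanCycle.IsQuasilinear.of_modification _ _ _ _ ⟨S, rfl, hS⟩ (ihY hS₁ (SetIso.refl _ _))
      (ihE hΔ (SetIso.refl _ _)) hmod (FanCycle.isIsomorphic_of_setIso hS hT hiso)

theorem TropicalFan.IsReduced.prod {V W : Type*} [AddCommGroup V] [Module ℝ V] [AddCommGroup W]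
    [Module ℝ W] {N : RealLattice V} {N' : RealLattice W} {S : TropicalFan N} {S' : TropicalFan N'}
    (hS : S.IsReduced) (hS' : S'.IsReduced) : (S.prod S').IsReduced := by
  intro κ hκ hd
  obtain ⟨σ, hσ, σ', hσ', rfl⟩ := TropicalFan.mem_prod_cones'.1 hκ
  rw [TropicalFan.coneDim_prod N N', TropicalFan.prod_dim] at hd
  have h1 := S.coneDim_le hσ
  have h2 := S'.coneDim_le hσ'
  rw [TropicalFan.prod_weight, hS σ hσ (by omega), hS' σ' hσ' (by omega), one_mul]

theorem mainTheorem5 {V W : Type u} [AddCommGroup V] [Module ℝ V] [AddCommGroup W] [Module ℝ W]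
    {N : RealLattice V} {N' : RealLattice W} (F : FanCycle N) (G : FanCycle N')
    (hF : F.IsReduced) (hG : G.IsReduced) :
    (F.prod G).IsQuasilinear ↔ F.IsQuasilinear ∧ G.IsQuasilinear := by
  obtain ⟨S, rfl, hS⟩ := hF
  obtain ⟨S', rfl, hS'⟩ := hG
  have hprod : FanCycle.prod (Quot.mk _ S) (Quot.mk _ S') = Quot.mk _ (S.prod S') := rfl
  rw [hprod]
  constructor
  · intro h
    have hQ := h.qlSet rfl
    rw [TropicalFan.prod_support] at hQ
    obtain ⟨d, h1⟩ := hQ.of_prod hS.isTropSet hS'.isTropSet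
    obtain ⟨d', h2⟩ := (hQ.iso (setIso_swap _ _ _ _)).of_prod hS'.isTropSet hS.isTropSet
    exact ⟨h1.isQuasilinear hS (SetIso.refl _ _), h2.isQuasilinear hS' (SetIso.refl _ _)⟩
  · rintro ⟨hF, hG⟩
    have hQ := (hF.qlSet rfl).prod (hG.qlSet rfl)
    rw [← TropicalFan.prod_support] at hQ
    exact hQ.isQuasilinear (hS.prod hS') (SetIso.refl _ _)
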